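/- All logarithms, divergences and mutual informations are to base $2$. Let $\mathcal X,\mathcal Y_1,\mathcal Y_2,\mathcal Z$ be finite sets, let $P_{Y_1,Y_2,Z|X}$ be a discrete memoryless broadcast channel with a warden (who observes $Z$), with marginal channels $P_{Y_1|X},P_{Y_2|X},P_{Z|X}$, let $x_0\in\mathcal X$ be the zero symbol and $Q_0=P_{Z|X}(\cdot|x_0)$. Assume that (a) $Q_0$ is not in the convex hull of $\{P_{Z|X}(\cdot|x'):x'\ne x_0\}$; (b) $P_{Z|X}(\cdot|x)\ll Q_0$ for all $x$; (c) $P_{Y_k|X}(\cdot|x)\ll P_{Y_k|X}(\cdot|x_0)$ for all $x$ and $k=1,2$; and that the channel is degraded: there is a conditional distribution $P_{Y_2|Y_1}$ with $P_{Y_2|X}(y_2|x)=\sum_{y_1}P_{Y_1|X}(y_1|x)P_{Y_2|Y_1}(y_2|y_1)$. Let $\delta>0$. An $(n,\nu_1,\nu_2,\epsilon,\delta)$ covert code consists of a random key $S$ with an arbitrary law on an arbitrary finite set, an encoder mapping $(m_1,m_2,s)$, $m_k\in\{1,\dots,\nu_k\}$, to $\mathcal X^n$, and decoders mapping $(y_k^n,s)$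 to $\{1,\dots,\nu_k\}$, such that for uniform messages independent of the key each user $k$ decodes $m_k$ with average error probability at most $\epsilon$, and the law $P_{Z^n}$ of the warden's output satisfies $D(P_{Z^n}\|Q_0^{\times n})\le\delta$. A pair of nonnegative numbers $(L_1,L_2)$ is $\delta$-achievable if for all $\epsilon,\rho>0$ and all sufficiently large $n$ there is an $(n,\nu_1,\nu_2,\epsilon,\delta)$ covert code with $\nu_k=\lceil 2^{\sqrt{n\delta}(L_k-\rho)}\rceil$. The covert capacity region $\mathcal L_\delta^*$ is the set of all $\delta$-achievable pairs. For $n\ge1$ let $\mathcal L_{n,\delta}^{(I)}$ be the set of nonnegative pairs $(L_1,L_2)$ with $$L_1\le\sqrt{n/\delta}\;I(X;Y_1|U),\qquad L_2\le\sqrt{n/\delta}\;I(U;Y_2)$$ for some finite set $\mathcal U$ and some law $P_{U,X}$ on $\mathcal U\times\mathcal X$, the informations being computed under $P_{U,X}P_{Y_1Y_2|X}$, such that the induced $P_Z$ satisfies $D(P_Z\|Q_0)\le\delta/n$. Let $\mathcal L_\delta^{(I)}$ be the limit of these regions as $n\to\infty$, that is, the set of all limits of sequences $(\ell^{(n)})_{n\ge1}$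 with $\ell^{(n)}\in\mathcal L_{n,\delta}^{(I)}$ for every $n$. Then: 1. $\mathcal L_\delta^*=\mathcal L_\delta^{(I)}$. 2. Let $\mathcal U$ be a fixed finite set and $P^{(n)}_{U,X}$ a convergent sequence of laws on $\mathcal U\times\mathcal X$ with $D(P_Z^{(n)}\|Q_0)\le\delta/n$ for all large $n$. If it achieves a positive $L_2$, i.e. if for some $L_2>0$ one has $L_2\le\sqrt{n/\delta}\,I(U;Y_2)$ under $P^{(n)}_{U,X}$ for all large $n$, then there is a subset $B\subset\mathcal U$ such that $P^{(n)}_U(B)>0$ for all sufficiently large $n$ and $\lim_{n\to\infty}P^{(n)}_U(B)=0$. -/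

import Mathlib

open Filter Topology

noncomputable section

namespace CovertBC

/-! Probability mass functions on a finite set `α` are the elements of `stdSimplex ℝ α`.
All logarithms are to base 2. -/

open Classical in
/-- Kullback-Leibler divergence `D(P‖Q)` in bits; it is `⊤` unless `P ≪ Q`. -/
def klDivBits {α : Type*} [Fintype α] (P Q : α → ℝ) : EReal :=
  if ∀ a, Q a = 0 → P a = 0 then ((∑ a, P a * Real.logb 2 (P a / Q a) : ℝ) : EReal) else ⊤

/-- Mutual information `I(A;B)` in bits of a joint mass function on `α × β`. -/
def mutualInfo {α β : Type*} [Fintype α] [Fintype β] (P : α × β → ℝ) : ℝ :=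
  ∑ a, ∑ b, P (a, b) * Real.logb 2 (P (a, b) / ((∑ b', P (a, b')) * ∑ a', P (a', b)))

/-- Conditional mutual information `I(A;B|U)` in bits of a joint mass function of `(U, A, B)`. -/
def condMutualInfo {υ α β : Type*} [Fintype υ] [Fintype α] [Fintype β]
    (P : υ × α × β → ℝ) : ℝ :=
  ∑ u, ∑ a, ∑ b, P (u, a, b) *
    Real.logb 2 ((P (u, a, b) * ∑ a', ∑ b', P (u, a', b')) /
      ((∑ b', P (u, a, b')) * ∑ a', P (u, a', b)))

/-- A discrete memoryless broadcast channel with two users and a warden, together with its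
zero symbol `x₀`. -/
structure WardenBC (X Y₁ Y₂ Z : Type*) [Fintype Y₁] [Fintype Y₂] [Fintype Z] where
  /-- the transition law: `law x (y₁, y₂, z)` is the probability of `(y₁, y₂, z)` given `x` -/
  law : X → Y₁ × Y₂ × Z → ℝ
  law_mem : ∀ x, law x ∈ stdSimplex ℝ (Y₁ × Y₂ × Z)
  /-- the zero symbol -/
  x₀ : X

namespace WardenBC

variable {X Y₁ Y₂ Z : Type*} [Fintype Y₁] [Fintype Y₂] [Fintype Z]

/-- The marginal channel to user 1. -/
def W₁ (C : WardenBC X Y₁ Y₂ Z) (x : X) (y₁ : Y₁) : ℝ := ∑ y₂, ∑ z, C.law x (y₁, y₂, z)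

/-- The marginal channel to user 2. -/
def W₂ (C : WardenBC X Y₁ Y₂ Z) (x : X) (y₂ : Y₂) : ℝ := ∑ y₁, ∑ z, C.law x (y₁, y₂, z)

/-- The marginal channel to the warden. -/
def WZ (C : WardenBC X Y₁ Y₂ Z) (x : X) (z : Z) : ℝ := ∑ y₁, ∑ y₂, C.law x (y₁, y₂, z)

/-- The output law `Q₀` at the warden when no communication takes place. -/
def Q₀ (C : WardenBC X Y₁ Y₂ Z) : Z → ℝ := C.WZ C.x₀

/-- Non-redundancy of the zero symbol at the warden, and absolute continuity with respect to
the zero symbol at the warden and at both users. -/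
structure NonredundantAbsCont (C : WardenBC X Y₁ Y₂ Z) : Prop where
  not_redundant : C.Q₀ ∉ convexHull ℝ (C.WZ '' {x | x ≠ C.x₀})
  ac_warden : ∀ x z, C.Q₀ z = 0 → C.WZ x z = 0
  ac_user₁ : ∀ x y, C.W₁ C.x₀ y = 0 → C.W₁ x y = 0
  ac_user₂ : ∀ x y, C.W₂ C.x₀ y = 0 → C.W₂ x y = 0

/-- Stochastic degradedness: user 2's channel is user 1's channel followed by a channel `V`. -/
def Degraded (C : WardenBC X Y₁ Y₂ Z) : Prop :=
  ∃ V : Y₁ → Y₂ → ℝ, (∀ y₁, V y₁ ∈ stdSimplex ℝ Y₂) ∧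
    ∀ x y₂, C.W₂ x y₂ = ∑ y₁, C.W₁ x y₁ * V y₁ y₂

end WardenBC

/-- The `n`-fold memoryless extension of a channel `W`. -/
def memoryless {X Y : Type*} (W : X → Y → ℝ) {n : ℕ} (x : Fin n → X) (y : Fin n → Y) : ℝ :=
  ∏ i, W (x i) (y i)

/-- A keyed broadcast code of length `n` with `ν₁` and `ν₂` messages: a random key with values
in a finite set `S`, an encoder, and one decoder for each user. -/
structure Code (X Y₁ Y₂ : Type*) (n ν₁ ν₂ : ℕ) where
  S : Type
  [fintypeS : Fintype S]
  /-- the law of the key -/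
  PS : S → ℝ
  PS_mem : PS ∈ stdSimplex ℝ S
  enc : Fin ν₁ → Fin ν₂ → S → Fin n → X
  dec₁ : (Fin n → Y₁) → S → Fin ν₁
  dec₂ : (Fin n → Y₂) → S → Fin ν₂

attribute [instance] Code.fintypeS

namespace Code

variable {X Y₁ Y₂ Z : Type*} [Fintype Y₁] [Fintype Y₂] [Fintype Z] {n ν₁ ν₂ : ℕ}

/-- The average probability of error of user 1. -/
def err₁ (c : Code X Y₁ Y₂ n ν₁ ν₂) (C : WardenBC X Y₁ Y₂ Z) : ℝ :=
  1 / ((ν₁ : ℝ) * ν₂) * ∑ m₁, ∑ m₂, ∑ s, c.PS s *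
    ∑ y with c.dec₁ y s ≠ m₁, memoryless C.W₁ (c.enc m₁ m₂ s) y

/-- The average probability of error of user 2. -/
def err₂ (c : Code X Y₁ Y₂ n ν₁ ν₂) (C : WardenBC X Y₁ Y₂ Z) : ℝ :=
  1 / ((ν₁ : ℝ) * ν₂) * ∑ m₁, ∑ m₂, ∑ s, c.PS s *
    ∑ y with c.dec₂ y s ≠ m₂, memoryless C.W₂ (c.enc m₁ m₂ s) y

/-- The law of the warden's output sequence induced by the code. -/
def wardenLaw (c : Code X Y₁ Y₂ n ν₁ ν₂) (C : WardenBC X Y₁ Y₂ Z) (z : Fin n → Z) : ℝ :=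
  1 / ((ν₁ : ℝ) * ν₂) * ∑ m₁, ∑ m₂, ∑ s, c.PS s * memoryless C.WZ (c.enc m₁ m₂ s) z

/-- `c` is an `(n, ν₁, ν₂, ε, δ)` covert code for `C`. -/
def IsCovert (c : Code X Y₁ Y₂ n ν₁ ν₂) (C : WardenBC X Y₁ Y₂ Z) (ε δ : ℝ) : Prop :=
  c.err₁ C ≤ ε ∧ c.err₂ C ≤ ε ∧
    klDivBits (c.wardenLaw C) (fun z => ∏ i, C.Q₀ (z i)) ≤ (δ : EReal)

end Code

namespace WardenBC

variable {X Y₁ Y₂ Z : Type*} [Fintype X] [Fintype Y₁] [Fintype Y₂] [Fintype Z]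

/-- The covert capacity region: all `δ`-achievable pairs of covert rates. The number of
messages `2 ^ (√(n δ) (L - ρ))` is rounded up to an integer. -/
def covertCapacityRegion (C : WardenBC X Y₁ Y₂ Z) (δ : ℝ) : Set (ℝ × ℝ) :=
  {L | 0 ≤ L.1 ∧ 0 ≤ L.2 ∧ ∀ ε > 0, ∀ ρ > 0, ∀ᶠ n : ℕ in atTop,
    ∃ c : Code X Y₁ Y₂ n ⌈(2 : ℝ) ^ (√(n * δ) * (L.1 - ρ))⌉₊ ⌈(2 : ℝ) ^ (√(n * δ) * (L.2 - ρ))⌉₊,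
      c.IsCovert C ε δ}

section SingleLetter

variable {U : Type*} [Fintype U]

/-- The law of the warden's output induced by a joint law of `(U, X)`. -/
def outZ (C : WardenBC X Y₁ Y₂ Z) (P : U × X → ℝ) (z : Z) : ℝ := ∑ u, ∑ x, P (u, x) * C.WZ x z

/-- `I(X;Y₁|U)` under the joint law `P_{U,X} P_{Y₁|X}`. -/
def infoX1 (C : WardenBC X Y₁ Y₂ Z) (P : U × X → ℝ) : ℝ :=
  condMutualInfo fun t : U × X × Y₁ => P (t.1, t.2.1) * C.W₁ t.2.1 t.2.2

/-- `I(U;Y₂)` under the joint law `P_{U,X} P_{Y₂|X}`. -/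
def infoU2 (C : WardenBC X Y₁ Y₂ Z) (P : U × X → ℝ) : ℝ :=
  mutualInfo fun t : U × Y₂ => ∑ x, P (t.1, x) * C.W₂ x t.2

end SingleLetter

/-- The region at index `n`: nonnegative pairs bounded by `√(n/δ) I(X;Y₁|U)` and
`√(n/δ) I(U;Y₂)` for some auxiliary finite set `U` and some `P_{U,X}` with
`D(P_Z‖Q₀) ≤ δ/n`. -/
def infoRegionAt (C : WardenBC X Y₁ Y₂ Z) (δ : ℝ) (n : ℕ) : Set (ℝ × ℝ) :=
  {L | 0 ≤ L.1 ∧ 0 ≤ L.2 ∧ ∃ (U : Type) (_ : Fintype U) (P : U × X → ℝ),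
    P ∈ stdSimplex ℝ (U × X) ∧
    klDivBits (C.outZ P) C.Q₀ ≤ ((δ / n : ℝ) : EReal) ∧
    L.1 ≤ √(n / δ) * C.infoX1 P ∧ L.2 ≤ √(n / δ) * C.infoU2 P}

/-- The limit of the regions `infoRegionAt δ n` as `n → ∞`: all limits of sequences of pairs
whose `n`-th term belongs to the `n`-th region. -/
def infoRegion (C : WardenBC X Y₁ Y₂ Z) (δ : ℝ) : Set (ℝ × ℝ) :=
  {L | ∃ ℓ : ℕ → ℝ × ℝ, (∀ n, 1 ≤ n → ℓ n ∈ C.infoRegionAt δ n) ∧ Tendsto ℓ atTop (𝓝 L)}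

end WardenBC

end CovertBC

end

/-! Both inclusions compare a code of length `n` with a single law on `U × X`.

Converse. Error probabilities depend only on the marginal channels, so the users' channel may be
replaced by the physically degraded one, in which `Y₂` is drawn from `Y₁` through `V`. With `i` a
uniform time, the auxiliary variable is `U = (i, M₂, S, past of (Y₁, Y₂))`. The chain rule and
Fano's inequality bound `log ν₁` and `log ν₂` by `n I(X;Y₁|U)` and `n I(U;Y₂)` up to corrections
that vanish after division by `√(n δ)`. The divergence of the warden's block dominates `n` times
that of its averaged marginal (`klDiv_average_le`), so the same law meets the constraint `δ / n`.
This is `exists_law_of_code`.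

Achievability. The key is unlimited, so it can be the entire random superposition codebook. For
fixed messages the codeword averaged over the key is exactly i.i.d., hence the warden sees exactly a
product law and the divergence is additive: no resolvability argument is needed
(`exists_code_of_law`). Reliability comes from threshold tests on information densities. The
single-letter law and the alphabet of `U` vary with `n`, and the message lengths are only of order
`√n`, so Chebyshev's inequality needs per-letter second moments that tend to zero uniformly in `U`.
Let `α` be the probability of a nonzero input symbol. Non-redundancy gives `α² ≤ c D(P_Z‖Q₀)`
(`exists_act_sq_le`), so `α = O(n^(-1/2))`; `secondMoment₁_le` and `secondMoment₂_le` bound the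
second moments by `α` times a constant that does not involve `U`. The block second moment is then
`O(√n)`, against a squared slack of order `n`.

Second claim. The chi-square bound `infoU2_le_chi` controls `I(U;Y₂)` by a multiple of `∑ α_u² /
P_U(u) + α²`, where `α_u` is the part of `α` on `U = u`. If all centres in use have probability
bounded away from zero, this is `O(α²) = O(1/n)`, too small for a rate of order `n^(-1/2)`. Hence
the centres whose limiting probability is zero must carry mass. -/

noncomputable section

open scoped Classical

namespace CovertBC

/-! ### Sums of products over function spaces -/

section Product

variable {ι A : Type*} [Fintype ι] [DecidableEq ι] [Fintype A]

/-- In a sum over functions weighted by a product, a coordinate of total mass one can be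
summed separately. -/
lemma sum_prod_split (p : ι → A → ℝ) (i : ι) (F : A → (ι → A) → ℝ)
    (hF : ∀ b f c, F b (Function.update f i c) = F b f) (hp : ∑ a, p i a = 1) :
    ∑ f : ι → A, (∏ j, p j (f j)) * F (f i) f
      = ∑ b, p i b * ∑ f : ι → A, (∏ j, p j (f j)) * F b f := by
  have hprod : ∀ (b : A) (g : {j // j ≠ i} → A),
      ∏ j, p j ((Equiv.funSplitAt i A).symm (b, g) j) = p i b * ∏ j : {j // j ≠ i}, p j (g j) := by
    intro b g
    rw [Fintype.prod_eq_mul_prod_subtype_ne _ i]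
    congr 1
    · simp [Equiv.funSplitAt]
    · refine Finset.prod_congr rfl fun j _ => ?_
      simp [Equiv.funSplitAt, j.2]
  have hi : ∀ (b : A) (g : {j // j ≠ i} → A), (Equiv.funSplitAt i A).symm (b, g) i = b := by
    intro b g
    simp [Equiv.funSplitAt]
  have hch : ∀ (a b c : A) (g : {j // j ≠ i} → A),
      F a ((Equiv.funSplitAt i A).symm (b, g)) = F a ((Equiv.funSplitAt i A).symm (c, g)) := by
    intro a b c g
    rw [← hF a ((Equiv.funSplitAt i A).symm (c, g)) b]
    congr 1
    funext j
    by_cases h : j = i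
    · subst h
      simp [Equiv.funSplitAt]
    · simp [Equiv.funSplitAt, h]
  rw [← Equiv.sum_comp (Equiv.funSplitAt i A).symm, Fintype.sum_prod_type]
  refine Finset.sum_congr rfl fun b _ => ?_
  rw [← Equiv.sum_comp (Equiv.funSplitAt i A).symm, Fintype.sum_prod_type, Finset.mul_sum]
  have : ∀ c : A, p i b * ∑ g, (∏ j, p j ((Equiv.funSplitAt i A).symm (c, g) j)) *
      F b ((Equiv.funSplitAt i A).symm (c, g)) = p i c * (p i b *
        ∑ g : {j // j ≠ i} → A, (∏ j : {j // j ≠ i}, p j (g j)) *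
          F b ((Equiv.funSplitAt i A).symm (b, g))) := by
    intro c
    simp only [hprod, Finset.mul_sum]
    refine Finset.sum_congr rfl fun g _ => ?_
    rw [hch b c b]
    ring
  simp only [this]
  rw [← Finset.sum_mul, hp, one_mul, Finset.mul_sum]
  refine Finset.sum_congr rfl fun g _ => ?_
  rw [hprod, hi, mul_assoc]

lemma sum_prod_eq_one (p : ι → A → ℝ) (hp : ∀ i, ∑ a, p i a = 1) :
    ∑ f : ι → A, ∏ j, p j (f j) = 1 := by
  rw [← Fintype.prod_sum]
  simp [hp]

/-- The marginal of a product law at one coordinate. -/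
lemma sum_prod_coord (p : ι → A → ℝ) (hp : ∀ i, ∑ a, p i a = 1) (i : ι) (G : A → ℝ) :
    ∑ f : ι → A, (∏ j, p j (f j)) * G (f i) = ∑ b, p i b * G b := by
  rw [sum_prod_split p i (fun b _ => G b) (fun _ _ _ => rfl) (hp i)]
  refine Finset.sum_congr rfl fun b _ => ?_
  rw [← Finset.sum_mul, sum_prod_eq_one p hp, one_mul]

/-- The marginal of a product law at two coordinates. -/
lemma sum_prod_coord₂ (p : ι → A → ℝ) (hp : ∀ i, ∑ a, p i a = 1) {i k : ι} (hik : i ≠ k)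
    (G : A → A → ℝ) :
    ∑ f : ι → A, (∏ j, p j (f j)) * G (f i) (f k) = ∑ b, p i b * ∑ c, p k c * G b c := by
  rw [sum_prod_split p i (fun b f => G b (f k))
    (fun b f c => by simp only [Function.update_of_ne hik.symm]) (hp i)]
  refine Finset.sum_congr rfl fun b _ => ?_
  rw [sum_prod_coord p hp k]

/-- The second moment of a sum of centred independent terms. -/
lemma sum_prod_sq (p : A → ℝ) (hp : ∑ a, p a = 1) (g : A → ℝ) (hg : ∑ a, p a * g a = 0) :
    ∑ f : ι → A, (∏ j, p (f j)) * (∑ j, g (f j)) ^ 2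
      = Fintype.card ι * ∑ a, p a * g a ^ 2 := by
  have h1 : ∀ f : ι → A, (∏ j, p (f j)) * (∑ j, g (f j)) ^ 2
      = ∑ i, ∑ k, (∏ j, p (f j)) * (g (f i) * g (f k)) := by
    intro f
    rw [sq, Finset.sum_mul_sum, Finset.mul_sum]
    simp only [Finset.mul_sum]
  simp only [h1]
  rw [Finset.sum_comm]
  have h2 : ∀ i : ι, ∑ f : ι → A, ∑ k, (∏ j, p (f j)) * (g (f i) * g (f k))
      = ∑ a, p a * g a ^ 2 := by
    intro i
    rw [Finset.sum_comm, Finset.sum_eq_single i]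
    · rw [sum_prod_coord (fun _ => p) (fun _ => hp) i (fun a => g a * g a)]
      simp only [sq]
    · intro k _ hk
      rw [sum_prod_coord₂ (fun _ => p) (fun _ => hp) hk.symm (fun a b => g a * g b)]
      refine Finset.sum_eq_zero fun b _ => ?_
      have : ∑ c, p c * (g b * g c) = g b * ∑ c, p c * g c := by
        rw [Finset.mul_sum]
        exact Finset.sum_congr rfl fun c _ => by ring
      rw [this, hg]
      simp
    · simp
  simp [h2]

/-- Chebyshev's inequality for the sum of independent copies of a function. -/
lemma chebyshev_sum (p : A → ℝ) (hp0 : ∀ a, 0 ≤ p a) (hp : ∑ a, p a = 1) (g : A → ℝ)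
    {γ t : ℝ} (ht : 0 < t) (hγ : γ + t ≤ Fintype.card ι * ∑ a, p a * g a) :
    ∑ f : ι → A, (∏ j, p (f j)) * (if ∑ j, g (f j) ≤ γ then 1 else 0)
      ≤ Fintype.card ι * (∑ a, p a * g a ^ 2) / t ^ 2 := by
  set μ := ∑ a, p a * g a with hμ
  have hc : ∑ a, p a * (g a - μ) = 0 := by
    simp only [mul_sub, Finset.sum_sub_distrib, ← Finset.sum_mul, hp]
    simp [hμ]
  -- The variance is replaced by the raw second moment, which is the quantity the chi-square bounds
  -- control.
  have hsq : ∑ a, p a * (g a - μ) ^ 2 ≤ ∑ a, p a * g a ^ 2 := by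
    have : ∑ a, p a * (g a - μ) ^ 2 = ∑ a, p a * g a ^ 2 - μ ^ 2 := by
      have h : ∀ a, p a * (g a - μ) ^ 2 = p a * g a ^ 2 - 2 * μ * (p a * g a) + μ ^ 2 * p a := by
        intro a; ring
      simp only [h, Finset.sum_add_distrib, Finset.sum_sub_distrib, ← Finset.mul_sum, hp, ← hμ]
      ring
    rw [this]
    nlinarith [sq_nonneg μ]
  have h2 := sum_prod_sq (ι := ι) p hp (fun a => g a - μ) hc
  rw [le_div_iff₀ (by positivity), Finset.sum_mul]
  calc ∑ f : ι → A, (∏ j, p (f j)) * (if ∑ j, g (f j) ≤ γ then 1 else 0) * t ^ 2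
      ≤ ∑ f : ι → A, (∏ j, p (f j)) * (∑ j, (g (f j) - μ)) ^ 2 := by
        refine Finset.sum_le_sum fun f _ => ?_
        rw [mul_assoc]
        refine mul_le_mul_of_nonneg_left ?_ (Finset.prod_nonneg fun j _ => hp0 _)
        split_ifs with h
        · rw [Finset.sum_sub_distrib]
          simp only [Finset.sum_const, Finset.card_univ, nsmul_eq_mul, one_mul]
          nlinarith
        · rw [zero_mul]; positivity
    _ = Fintype.card ι * ∑ a, p a * (g a - μ) ^ 2 := h2
    _ ≤ _ := by gcongr

end Product

/-! ### Entropies of functions on a finite probability space -/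

section Entropy

variable {Ω A B D : Type*} [Fintype Ω]

/-- The law of `f` under `p`. -/
def push (p : Ω → ℝ) (f : Ω → A) (a : A) : ℝ := ∑ ω, if f ω = a then p ω else 0

/-- The entropy, in bits, of `f` under `p`. -/
def ent (p : Ω → ℝ) (f : Ω → A) : ℝ := -∑ ω, p ω * Real.logb 2 (push p f (f ω))

lemma push_nonneg {p : Ω → ℝ} (hp : ∀ ω, 0 ≤ p ω) (f : Ω → A) (a : A) : 0 ≤ push p f a :=
  Finset.sum_nonneg fun ω _ => by split_ifs <;> simp [hp]

lemma push_pos {p : Ω → ℝ} (hp : ∀ ω, 0 ≤ p ω) (f : Ω → A) {ω : Ω} (hω : 0 < p ω) :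
    0 < push p f (f ω) := by
  refine Finset.sum_pos' (fun ω' _ => by split_ifs <;> simp [hp]) ⟨ω, Finset.mem_univ _, by simpa⟩

lemma push_congr (p : Ω → ℝ) {f : Ω → A} {g : Ω → B} (ω : Ω)
    (h : ∀ ω', f ω' = f ω ↔ g ω' = g ω) : push p f (f ω) = push p g (g ω) := by
  simp only [push, h]

lemma ent_congr (p : Ω → ℝ) {f : Ω → A} {g : Ω → B} (h : ∀ ω ω', f ω' = f ω ↔ g ω' = g ω) :
    ent p f = ent p g := by
  simp only [ent, fun ω => push_congr p ω (h ω)]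

lemma sum_push_mul [Fintype A] (p : Ω → ℝ) (f : Ω → A) (φ : A → ℝ) :
    ∑ a, push p f a * φ a = ∑ ω, p ω * φ (f ω) := by
  simp only [push, Finset.sum_mul]
  rw [Finset.sum_comm]
  simp

lemma sum_push [Fintype A] (p : Ω → ℝ) (f : Ω → A) : ∑ a, push p f a = ∑ ω, p ω := by
  simpa using sum_push_mul p f (fun _ => 1)

lemma sum_push_prod_right [Fintype B] (p : Ω → ℝ) (f : Ω → A) (g : Ω → B) (a : A) :
    ∑ b, push p (fun ω => (f ω, g ω)) (a, b) = push p f a := by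
  simp only [push]
  rw [Finset.sum_comm]
  refine Finset.sum_congr rfl fun ω _ => ?_
  by_cases h : f ω = a <;> simp [h]

lemma sum_push_prod_left [Fintype A] (p : Ω → ℝ) (f : Ω → A) (g : Ω → B) (b : B) :
    ∑ a, push p (fun ω => (f ω, g ω)) (a, b) = push p g b := by
  simp only [push]
  rw [Finset.sum_comm]
  refine Finset.sum_congr rfl fun ω _ => ?_
  by_cases h : g ω = b <;> simp [h]

lemma mul_logb_le {p q : ℝ} (hp : 0 ≤ p) (hq : 0 ≤ q) (h : q = 0 → p = 0) :
    (p - q) / Real.log 2 ≤ p * Real.logb 2 (p / q) := by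
  have h2 : 0 < Real.log 2 := Real.log_pos one_lt_two
  rw [Real.logb, ← mul_div_assoc]
  refine div_le_div_of_nonneg_right ?_ h2.le
  rcases hp.eq_or_lt with rfl | hp
  · simpa
  have hq' : 0 < q := lt_of_le_of_ne hq fun h' => hp.ne' (h h'.symm)
  have h1 := Real.one_sub_inv_le_log_of_pos (div_pos hp hq')
  have h3 := mul_le_mul_of_nonneg_left h1 hp.le
  have h4 : p * (1 - (p / q)⁻¹) = p - q := by field_simp
  linarith

/-- Gibbs' inequality. -/
lemma gibbs (p q : Ω → ℝ) (hp : ∀ ω, 0 ≤ p ω) (hq : ∀ ω, 0 ≤ q ω) (hpq : ∑ ω, q ω ≤ ∑ ω, p ω)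
    (h : ∀ ω, q ω = 0 → p ω = 0) : 0 ≤ ∑ ω, p ω * Real.logb 2 (p ω / q ω) := by
  have h2 : 0 < Real.log 2 := Real.log_pos one_lt_two
  calc (0 : ℝ) ≤ ∑ ω, (p ω - q ω) / Real.log 2 := by
        rw [← Finset.sum_div, Finset.sum_sub_distrib]
        exact div_nonneg (by linarith) h2.le
    _ ≤ _ := Finset.sum_le_sum fun ω _ => mul_logb_le (hp ω) (hq ω) (h ω)

/-- The conditional entropy of `f` given `g` is at most the cross entropy with respect to any
conditional law `q`. -/
lemma cond_gibbs {p : Ω → ℝ} (hp : ∀ ω, 0 ≤ p ω) [Fintype A] (f : Ω → A) (g : Ω → B)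
    (q : B → A → ℝ) (hq : ∀ b a, 0 ≤ q b a) (hq1 : ∀ b, ∑ a, q b a ≤ 1)
    (hpos : ∀ ω, 0 < p ω → 0 < q (g ω) (f ω)) :
    ent p (fun ω => (f ω, g ω)) - ent p g ≤ -∑ ω, p ω * Real.logb 2 (q (g ω) (f ω)) := by
  set P := fun ω => push p (fun ω => (f ω, g ω)) (f ω, g ω) with hP
  set G := fun ω => push p g (g ω) with hG
  have hP0 : ∀ ω, 0 ≤ P ω := fun ω => push_nonneg hp _ _
  have hG0 : ∀ ω, 0 ≤ G ω := fun ω => push_nonneg hp _ _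
  have hPp : ∀ ω, 0 < p ω → 0 < P ω := fun ω h => push_pos hp (fun ω => (f ω, g ω)) h
  have hGp : ∀ ω, 0 < p ω → 0 < G ω := fun ω h => push_pos hp g h
  -- The reference measure for Gibbs' inequality lives on `Ω` itself: `p` is reweighted by `q` over
  -- the true conditional probability `P / G`. Grouping by the values of `f` and `g` shows that its
  -- mass does not exceed that of `p`; values never taken contribute `0 / 0 = 0`.
  have hsum : ∑ ω, p ω * G ω * q (g ω) (f ω) / P ω ≤ ∑ ω, p ω := by
    have h1 : ∀ ω, p ω * G ω * q (g ω) (f ω) / P ω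
        = ∑ ω', p ω' * (if g ω = g ω' then q (g ω') (f ω) * (p ω / P ω) else 0) := by
      intro ω
      have hGω : G ω = ∑ ω', if g ω' = g ω then p ω' else 0 := rfl
      have : p ω * G ω * q (g ω) (f ω) / P ω = G ω * (q (g ω) (f ω) * (p ω / P ω)) := by ring
      rw [this, hGω, Finset.sum_mul]
      refine Finset.sum_congr rfl fun ω' _ => ?_
      by_cases h : g ω = g ω'
      · simp [h]
      · simp [h, Ne.symm h]
    simp only [h1]
    rw [Finset.sum_comm]
    refine Finset.sum_le_sum fun ω' _ => ?_
    rw [← Finset.mul_sum]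
    refine mul_le_of_le_one_right (hp ω') ?_
    have h3 : ∀ ω, (if g ω = g ω' then q (g ω') (f ω) * (p ω / P ω) else 0)
        = ∑ a, q (g ω') a * (if f ω = a ∧ g ω = g ω' then
            p ω / push p (fun ω => (f ω, g ω)) (a, g ω') else 0) := by
      intro ω
      rw [Finset.sum_eq_single (f ω)]
      · by_cases h : g ω = g ω'
        · simp [h, hP]
        · simp [h]
      · intro a _ ha
        simp [Ne.symm ha]
      · simp
    simp only [h3]
    rw [Finset.sum_comm]
    refine le_trans (Finset.sum_le_sum fun a _ => ?_) (hq1 (g ω'))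
    rw [← Finset.mul_sum]
    refine mul_le_of_le_one_right (hq _ _) ?_
    have h4 : ∑ ω, (if f ω = a ∧ g ω = g ω' then
        p ω / push p (fun ω => (f ω, g ω)) (a, g ω') else 0)
        = push p (fun ω => (f ω, g ω)) (a, g ω') / push p (fun ω => (f ω, g ω)) (a, g ω') := by
      conv_rhs => enter [1]; rw [push]
      rw [Finset.sum_div]
      refine Finset.sum_congr rfl fun ω _ => ?_
      by_cases h : f ω = a ∧ g ω = g ω' <;> simp [h, Prod.ext_iff]
    rw [h4]
    exact div_self_le_one _
  have key := gibbs p (fun ω => p ω * G ω * q (g ω) (f ω) / P ω) hp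
    (fun ω => div_nonneg (mul_nonneg (mul_nonneg (hp ω) (hG0 ω)) (hq _ _)) (hP0 ω)) hsum ?_
  · have h5 : ∀ ω, p ω * Real.logb 2 (p ω / (p ω * G ω * q (g ω) (f ω) / P ω))
        = p ω * Real.logb 2 (P ω) - p ω * Real.logb 2 (G ω)
          - p ω * Real.logb 2 (q (g ω) (f ω)) := by
      intro ω
      rcases (hp ω).eq_or_lt with h0 | h0
      · simp [← h0]
      have e : p ω / (p ω * G ω * q (g ω) (f ω) / P ω) = P ω / (G ω * q (g ω) (f ω)) := by
        have := (hPp ω h0).ne'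
        have := (hGp ω h0).ne'
        have := (hpos ω h0).ne'
        field_simp
      rw [e, Real.logb_div (hPp ω h0).ne' (mul_pos (hGp ω h0) (hpos ω h0)).ne',
        Real.logb_mul (hGp ω h0).ne' (hpos ω h0).ne']
      ring
    simp only [h5, Finset.sum_sub_distrib] at key
    simp only [ent]
    linarith
  · intro ω h
    by_contra h0
    have h0 : 0 < p ω := lt_of_le_of_ne (hp ω) (Ne.symm h0)
    have := div_pos (mul_pos (mul_pos h0 (hGp ω h0)) (hpos ω h0)) (hPp ω h0)
    exact this.ne' h

/-- Conditioning on more reduces entropy. -/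
lemma cond_ent_le {p : Ω → ℝ} (hp : ∀ ω, 0 ≤ p ω) [Fintype A] (f : Ω → A) (g : Ω → B)
    (h : B → D) :
    ent p (fun ω => (f ω, g ω)) - ent p g
      ≤ ent p (fun ω => (f ω, h (g ω))) - ent p (fun ω => h (g ω)) := by
  -- The test law is the true conditional law of `f` given the coarser `h ∘ g`, whose cross entropy
  -- is the right-hand side.
  have key := cond_gibbs hp f g
    (fun b a => push p (fun ω => (f ω, h (g ω))) (a, h b) / push p (fun ω => h (g ω)) (h b))
    (fun b a => div_nonneg (push_nonneg hp _ _) (push_nonneg hp _ _))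
    (fun b => by
      rw [← Finset.sum_div, sum_push_prod_left]
      exact div_self_le_one _)
    (fun ω h0 => div_pos (push_pos hp (fun ω => (f ω, h (g ω))) h0)
      (push_pos hp (fun ω => h (g ω)) h0))
  refine key.trans (le_of_eq ?_)
  have h5 : ∀ ω, p ω * Real.logb 2 (push p (fun ω => (f ω, h (g ω))) (f ω, h (g ω)) /
      push p (fun ω => h (g ω)) (h (g ω)))
      = p ω * Real.logb 2 (push p (fun ω => (f ω, h (g ω))) (f ω, h (g ω)))
        - p ω * Real.logb 2 (push p (fun ω => h (g ω)) (h (g ω))) := by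
    intro ω
    rcases (hp ω).eq_or_lt with h0 | h0
    · simp [← h0]
    rw [Real.logb_div (push_pos hp (fun ω => (f ω, h (g ω))) h0).ne'
      (push_pos hp (fun ω => h (g ω)) h0).ne']
    ring
  simp only [h5, Finset.sum_sub_distrib, ent]
  ring

/-- Fano's inequality, for a uniform bound `ν` on the number of values. -/
lemma fano {p : Ω → ℝ} (hp : ∀ ω, 0 ≤ p ω) (hp1 : ∑ ω, p ω = 1) {ν : ℕ} (f : Ω → Fin ν)
    (g : Ω → B) (d : B → Fin ν) :
    ent p (fun ω => (f ω, g ω)) - ent p g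
      ≤ 1 + (∑ ω, if d (g ω) = f ω then 0 else p ω) * Real.logb 2 ν := by
  rcases Nat.eq_zero_or_pos ν with rfl | hν
  · have : IsEmpty Ω := ⟨fun ω => (f ω).elim0⟩
    simp at hp1
  have hν' : (0 : ℝ) < ν := by exact_mod_cast hν
  have hν1 : (1 : ℝ) ≤ ν := by exact_mod_cast hν
  have hqp : ∀ (b : B) (a : Fin ν), 0 < (if d b = a then (1 / 2 : ℝ) else 0) + 1 / (2 * ν) := by
    intro b a
    have : 0 < 1 / (2 * (ν : ℝ)) := by positivity
    split_ifs <;> linarith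
  -- The test law is half a point mass at the decoder's guess and half uniform: a correct guess
  -- costs at most one bit, a wrong one `1 + log ν`.
  refine (cond_gibbs hp f g (fun b a => (if d b = a then (1 / 2 : ℝ) else 0) + 1 / (2 * ν))
    (fun b a => (hqp b a).le) (fun b => ?_) (fun ω _ => hqp _ _)).trans ?_
  · rw [Finset.sum_add_distrib]
    simp
    field_simp
    norm_num
  · have hone : ∀ a : ℝ, 1 + a = ∑ ω, p ω + a := fun a => by rw [hp1]
    rw [← Finset.sum_neg_distrib, Finset.sum_mul, hone, ← Finset.sum_add_distrib]
    refine Finset.sum_le_sum fun ω _ => ?_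
    have hlog2 : Real.logb 2 2 = 1 := Real.logb_self_eq_one one_lt_two
    split_ifs with h
    · have : -1 ≤ Real.logb 2 (1 / 2 + 1 / (2 * (ν : ℝ))) := by
        rw [Real.le_logb_iff_rpow_le one_lt_two (by positivity)]
        rw [Real.rpow_neg_one]
        have : 0 < 1 / (2 * (ν : ℝ)) := by positivity
        linarith
      nlinarith [hp ω]
    · rw [zero_add, one_div, Real.logb_inv, Real.logb_mul two_ne_zero hν'.ne', hlog2]
      nlinarith [hp ω]

end Entropy

/-! ### Single-letter informations as entropies -/

section SingleLetterEntropy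

variable {Ω υ α β : Type*} [Fintype Ω]

lemma sum_push_prod_mul [Fintype α] (p : Ω → ℝ) (f : Ω → υ) (g : Ω → α) (u : υ) (φ : α → ℝ) :
    ∑ a, push p (fun ω => (f ω, g ω)) (u, a) * φ a
      = ∑ ω, if f ω = u then p ω * φ (g ω) else 0 := by
  simp only [push, Finset.sum_mul]
  rw [Finset.sum_comm]
  refine Finset.sum_congr rfl fun ω _ => ?_
  by_cases h : f ω = u <;> simp [h]

variable [Fintype υ] [Fintype α] [Fintype β]

lemma condMutualInfo_push (p : Ω → ℝ) (U : Ω → υ) (A : Ω → α) (B : Ω → β) :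
    condMutualInfo (push p fun ω => (U ω, A ω, B ω))
      = ∑ ω, p ω * Real.logb 2
        ((push p (fun ω => (U ω, A ω, B ω)) (U ω, A ω, B ω) * push p U (U ω)) /
          (push p (fun ω => (U ω, A ω)) (U ω, A ω) * push p (fun ω => (U ω, B ω)) (U ω, B ω))) := by
  have h1 : ∀ u, ∑ a, ∑ b, push p (fun ω => (U ω, A ω, B ω)) (u, a, b) = push p U u := by
    intro u
    rw [← sum_push_prod_right p U (fun ω => (A ω, B ω)), Fintype.sum_prod_type]
  have h2 : ∀ u a, ∑ b, push p (fun ω => (U ω, A ω, B ω)) (u, a, b)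
      = push p (fun ω => (U ω, A ω)) (u, a) := by
    intro u a
    rw [← sum_push_prod_right p (fun ω => (U ω, A ω)) B]
    refine Finset.sum_congr rfl fun b _ => ?_
    simp only [push, Prod.mk.injEq, and_assoc]
  have h3 : ∀ u b, ∑ a, push p (fun ω => (U ω, A ω, B ω)) (u, a, b)
      = push p (fun ω => (U ω, B ω)) (u, b) := by
    intro u b
    rw [← sum_push_prod_right p (fun ω => (U ω, B ω)) A]
    refine Finset.sum_congr rfl fun a _ => ?_
    refine Finset.sum_congr rfl fun ω _ => ?_
    by_cases hU : U ω = u <;> by_cases hB : B ω = b <;> simp [hU, hB]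
  rw [condMutualInfo]
  simp only [h1]
  simp only [h2, h3]
  rw [← sum_push_mul p (fun ω => (U ω, A ω, B ω)) (fun t => Real.logb 2
    ((push p (fun ω => (U ω, A ω, B ω)) t * push p U t.1) /
      (push p (fun ω => (U ω, A ω)) (t.1, t.2.1) * push p (fun ω => (U ω, B ω)) (t.1, t.2.2))))]
  rw [Fintype.sum_prod_type]
  simp only [Fintype.sum_prod_type]

lemma mutualInfo_push (p : Ω → ℝ) (A : Ω → α) (B : Ω → β) :
    mutualInfo (push p fun ω => (A ω, B ω))
      = ∑ ω, p ω * Real.logb 2 (push p (fun ω => (A ω, B ω)) (A ω, B ω) /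
          (push p A (A ω) * push p B (B ω))) := by
  rw [mutualInfo]
  simp only [sum_push_prod_right, sum_push_prod_left]
  rw [← sum_push_mul p (fun ω => (A ω, B ω)) (fun t => Real.logb 2
    (push p (fun ω => (A ω, B ω)) t / (push p A t.1 * push p B t.2)))]
  rw [Fintype.sum_prod_type]

/-- Conditional entropies appear throughout as differences `ent (f, g) - ent g` with the conditioned
variable first, the shape in which `cond_gibbs` and `cond_ent_le` apply. -/
lemma mutualInfo_push_eq_ent {p : Ω → ℝ} (hp : ∀ ω, 0 ≤ p ω) (A : Ω → α) (B : Ω → β) :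
    mutualInfo (push p fun ω => (A ω, B ω))
      = ent p B - (ent p (fun ω => (B ω, A ω)) - ent p A) := by
  rw [mutualInfo_push, ent_congr p (f := fun ω => (B ω, A ω)) (g := fun ω => (A ω, B ω))
    (fun ω ω' => by simp [and_comm])]
  have : ∀ ω, p ω * Real.logb 2 (push p (fun ω => (A ω, B ω)) (A ω, B ω) /
          (push p A (A ω) * push p B (B ω)))
      = p ω * Real.logb 2 (push p (fun ω => (A ω, B ω)) (A ω, B ω))
        - p ω * Real.logb 2 (push p A (A ω)) - p ω * Real.logb 2 (push p B (B ω)) := by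
    intro ω
    rcases (hp ω).eq_or_lt with h0 | h0
    · simp [← h0]
    rw [Real.logb_div (push_pos hp (fun ω => (A ω, B ω)) h0).ne'
      (mul_pos (push_pos hp A h0) (push_pos hp B h0)).ne',
      Real.logb_mul (push_pos hp A h0).ne' (push_pos hp B h0).ne']
    ring
  simp only [this, Finset.sum_sub_distrib, ent]
  ring

lemma condMutualInfo_push_eq_ent {p : Ω → ℝ} (hp : ∀ ω, 0 ≤ p ω) (U : Ω → υ) (A : Ω → α)
    (B : Ω → β) :
    condMutualInfo (push p fun ω => (U ω, A ω, B ω))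
      = (ent p (fun ω => (B ω, U ω)) - ent p U)
        - (ent p (fun ω => (B ω, (U ω, A ω))) - ent p (fun ω => (U ω, A ω))) := by
  rw [condMutualInfo_push, ent_congr p (f := fun ω => (B ω, U ω)) (g := fun ω => (U ω, B ω))
    (fun ω ω' => by simp [and_comm]), ent_congr p (f := fun ω => (B ω, (U ω, A ω)))
    (g := fun ω => (U ω, A ω, B ω)) (fun ω ω' => by simp only [Prod.mk.injEq]; tauto)]
  have : ∀ ω, p ω * Real.logb 2
        ((push p (fun ω => (U ω, A ω, B ω)) (U ω, A ω, B ω) * push p U (U ω)) /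
          (push p (fun ω => (U ω, A ω)) (U ω, A ω) * push p (fun ω => (U ω, B ω)) (U ω, B ω)))
      = p ω * Real.logb 2 (push p (fun ω => (U ω, A ω, B ω)) (U ω, A ω, B ω))
        + p ω * Real.logb 2 (push p U (U ω))
        - p ω * Real.logb 2 (push p (fun ω => (U ω, A ω)) (U ω, A ω))
        - p ω * Real.logb 2 (push p (fun ω => (U ω, B ω)) (U ω, B ω)) := by
    intro ω
    rcases (hp ω).eq_or_lt with h0 | h0
    · simp [← h0]
    have h1 := push_pos hp U h0
    have h2 := push_pos hp (fun ω => (U ω, A ω)) h0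
    have h3 := push_pos hp (fun ω => (U ω, B ω)) h0
    have h4 := push_pos hp (fun ω => (U ω, A ω, B ω)) h0
    rw [Real.logb_div (mul_pos h4 h1).ne' (mul_pos h2 h3).ne', Real.logb_mul h4.ne' h1.ne',
      Real.logb_mul h2.ne' h3.ne']
    ring
  simp only [this, Finset.sum_sub_distrib, Finset.sum_add_distrib, ent]
  ring

lemma mutualInfo_push_nonneg {p : Ω → ℝ} (hp : ∀ ω, 0 ≤ p ω) (hp1 : ∑ ω, p ω = 1) (A : Ω → α)
    (B : Ω → β) : 0 ≤ mutualInfo (push p fun ω => (A ω, B ω)) := by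
  have h := cond_ent_le hp B A (fun _ => ())
  have h1 : ent p (fun _ => ()) = 0 := by simp [ent, push, hp1]
  have h2 : ent p (fun ω => (B ω, ())) = ent p B := ent_congr p fun ω ω' => by simp
  rw [mutualInfo_push_eq_ent hp]
  linarith

lemma condMutualInfo_push_nonneg {p : Ω → ℝ} (hp : ∀ ω, 0 ≤ p ω) (U : Ω → υ) (A : Ω → α)
    (B : Ω → β) : 0 ≤ condMutualInfo (push p fun ω => (U ω, A ω, B ω)) := by
  have h := cond_ent_le hp B (fun ω => (U ω, A ω)) Prod.fst
  rw [condMutualInfo_push_eq_ent hp]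
  linarith

end SingleLetterEntropy

/-! ### Memoryless channels with a random input block -/

section Block

variable {M X Y : Type*} {n : ℕ}

/-- The joint law of a random index `m` with law `μ` and of the output block of a memoryless
channel whose input is the codeword `x m`. -/
def blockLaw (μ : M → ℝ) (x : M → Fin n → X) (W : X → Y → ℝ) (ω : M × (Fin n → Y)) : ℝ :=
  μ ω.1 * memoryless W (x ω.1) ω.2

variable [Fintype Y]

lemma memoryless_nonneg {W : X → Y → ℝ} (hW : ∀ x, W x ∈ stdSimplex ℝ Y) (x : Fin n → X)
    (y : Fin n → Y) : 0 ≤ memoryless W x y :=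
  Finset.prod_nonneg fun _ _ => (hW _).1 _

lemma sum_memoryless {W : X → Y → ℝ} (hW : ∀ x, W x ∈ stdSimplex ℝ Y) (x : Fin n → X) :
    ∑ y, memoryless W x y = 1 :=
  sum_prod_eq_one (fun i => W (x i)) fun i => (hW (x i)).2

variable {μ : M → ℝ} {x : M → Fin n → X} {W : X → Y → ℝ}

lemma blockLaw_nonneg (hμ : ∀ m, 0 ≤ μ m) (hW : ∀ x, W x ∈ stdSimplex ℝ Y)
    (ω : M × (Fin n → Y)) : 0 ≤ blockLaw μ x W ω :=
  mul_nonneg (hμ _) (memoryless_nonneg hW _ _)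

variable [Fintype M]

lemma sum_blockLaw_fst (hW : ∀ x, W x ∈ stdSimplex ℝ Y) (F : M → ℝ) :
    ∑ ω, blockLaw μ x W ω * F ω.1 = ∑ m, μ m * F m := by
  rw [Fintype.sum_prod_type]
  refine Finset.sum_congr rfl fun m _ => ?_
  simp only [blockLaw, mul_comm _ (F m)]
  rw [← Finset.mul_sum, ← Finset.mul_sum, sum_memoryless hW]
  ring

lemma sum_blockLaw (hW : ∀ x, W x ∈ stdSimplex ℝ Y) : ∑ ω, blockLaw μ x W ω = ∑ m, μ m := by
  simpa using sum_blockLaw_fst (μ := μ) (x := x) hW (fun _ => 1)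

lemma push_blockLaw_fst {T : Type*} (hW : ∀ x, W x ∈ stdSimplex ℝ Y) (τ : M → T) (t : T) :
    push (blockLaw μ x W) (fun ω => τ ω.1) t = push μ τ t := by
  have := sum_blockLaw_fst (μ := μ) (x := x) hW (fun m => if τ m = t then 1 else 0)
  simpa [push] using this

lemma ent_blockLaw_fst {T : Type*} (hW : ∀ x, W x ∈ stdSimplex ℝ Y) (τ : M → T) :
    ent (blockLaw μ x W) (fun ω => τ ω.1) = ent μ τ := by
  simp only [ent, push_blockLaw_fst hW]
  rw [sum_blockLaw_fst hW (fun m => Real.logb 2 (push μ τ (τ m)))]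

/-- Given the input letter, an output letter is independent of everything that does not look
at it. -/
lemma sum_blockLaw_coord (hW : ∀ x, W x ∈ stdSimplex ℝ Y) (i : Fin n)
    (F : Y → M × (Fin n → Y) → ℝ)
    (hF : ∀ b m y c, F b (m, Function.update y i c) = F b (m, y)) :
    ∑ ω, blockLaw μ x W ω * F (ω.2 i) ω
      = ∑ ω, blockLaw μ x W ω * ∑ b, W (x ω.1 i) b * F b ω := by
  rw [Fintype.sum_prod_type, Fintype.sum_prod_type]
  refine Finset.sum_congr rfl fun m _ => ?_
  simp only [blockLaw, mul_assoc]
  rw [← Finset.mul_sum, ← Finset.mul_sum]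
  congr 1
  have := sum_prod_split (fun j => W (x m j)) i (fun b y => F b (m, y))
    (fun b y c => hF b m y c) (hW (x m i)).2
  simp only [memoryless]
  rw [this]
  simp only [Finset.mul_sum]
  rw [Finset.sum_comm]
  refine Finset.sum_congr rfl fun y _ => Finset.sum_congr rfl fun b _ => by ring

end Block

/-! ### The past of a block, and the chain rule -/

section Mask

variable {Y : Type*} {n : ℕ}

/-- The first `k` letters of a block. -/
def mask (k : ℕ) (y : Fin n → Y) (j : Fin n) : Option Y :=
  if (j : ℕ) < k then some (y j) else none

/-- The strict past ignores the present letter; this is the hypothesis of `sum_blockLaw_coord` when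
the past enters the auxiliary variable. -/
lemma mask_update (i : Fin n) (y : Fin n → Y) (c : Y) :
    mask i (Function.update y i c) = mask i y := by
  funext j
  by_cases h : j = i
  · subst h; simp [mask]
  · simp [mask, Function.update_of_ne h]

lemma mask_succ_eq_iff (i : Fin n) (y y' : Fin n → Y) :
    mask (i + 1) y = mask (i + 1) y' ↔ y i = y' i ∧ mask i y = mask i y' := by
  simp only [funext_iff, mask]
  constructor
  · intro h
    refine ⟨by simpa using h i, fun j => ?_⟩
    have := h j
    split_ifs with h1
    · simpa [Nat.lt_succ_of_lt h1] using this
    · rfl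
  · rintro ⟨h0, h⟩ j
    have := h j
    rcases lt_trichotomy (j : ℕ) i with h1 | h1 | h1
    · simpa [h1, Nat.lt_succ_of_lt h1] using this
    · have : j = i := Fin.ext h1
      subst this
      simp [h0]
    · have : ¬ (j : ℕ) < i + 1 := by omega
      simp [this]

lemma mask_zero (y y' : Fin n → Y) : mask 0 y = mask 0 y' := by
  funext j; simp [mask]

lemma mask_all_eq_iff (y y' : Fin n → Y) : mask n y = mask n y' ↔ y = y' := by
  simp [funext_iff, mask]

/-- The chain rule for the entropy of a block. -/
lemma sum_ent_mask {Ω T : Type*} [Fintype Ω] (p : Ω → ℝ) (t : Ω → T) (y : Ω → Fin n → Y) :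
    ∑ i : Fin n, (ent p (fun ω => (y ω i, (t ω, mask i (y ω))))
        - ent p (fun ω => (t ω, mask i (y ω))))
      = ent p (fun ω => (t ω, y ω)) - ent p t := by
  have h1 : ∀ i : Fin n, ent p (fun ω => (y ω i, (t ω, mask i (y ω))))
      = ent p (fun ω => (t ω, mask ((i : ℕ) + 1) (y ω))) := by
    intro i
    refine ent_congr p fun ω ω' => ?_
    simp only [Prod.mk.injEq, mask_succ_eq_iff]
    tauto
  simp only [h1]
  rw [Fin.sum_univ_eq_sum_range (fun k => ent p (fun ω => (t ω, mask (k + 1) (y ω)))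
    - ent p (fun ω => (t ω, mask k (y ω)))) n,
    Finset.sum_range_sub (fun k => ent p (fun ω => (t ω, mask k (y ω))))]
  congr 1
  · exact ent_congr p fun ω ω' => by simp [mask_all_eq_iff]
  · exact ent_congr p fun ω ω' => by simp [mask_zero (y ω') (y ω)]

end Mask

/-- Given the index, the codeword is determined and the output letters are independent, so the
conditional entropy of the block splits into expected log-likelihoods of single letters. -/
lemma ent_fst_sub_ent_id {M X Y : Type*} [Fintype M] [Fintype Y] {n : ℕ} {μ : M → ℝ}
    {x : M → Fin n → X} {W : X → Y → ℝ} (hμ : ∀ m, 0 ≤ μ m) (hW : ∀ x, W x ∈ stdSimplex ℝ Y) :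
    ent (blockLaw μ x W) (fun ω => ω) - ent (blockLaw μ x W) (fun ω => ω.1)
      = -∑ i, ∑ ω, blockLaw μ x W ω * Real.logb 2 (W (x ω.1 i) (ω.2 i)) := by
  rw [Finset.sum_comm, ent, ent]
  simp only [push_blockLaw_fst hW (fun m => m)]
  rw [sub_eq_iff_eq_add, ← sub_eq_add_neg, eq_sub_iff_add_eq, neg_add_eq_iff_eq_add,
    ← sub_eq_add_neg, eq_sub_iff_add_eq, ← Finset.sum_add_distrib]
  refine Finset.sum_congr rfl fun ω _ => ?_
  have h1 : push (blockLaw μ x W) (fun ω => ω) ω = blockLaw μ x W ω := by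
    rw [push, Finset.sum_eq_single ω] <;> simp +contextual
  have h2 : push μ (fun m => m) ω.1 = μ ω.1 := by simp [push]
  rw [h1, h2, ← Finset.mul_sum]
  rcases (blockLaw_nonneg (x := x) hμ hW ω).eq_or_lt with h0 | h0
  · simp [← h0]
  have h3 : μ ω.1 ≠ 0 ∧ ∏ i, W (x ω.1 i) (ω.2 i) ≠ 0 := by
    have := h0.ne'
    simpa [blockLaw, memoryless] using this
  have h4 : Real.logb 2 (blockLaw μ x W ω)
      = Real.logb 2 (μ ω.1) + ∑ i, Real.logb 2 (W (x ω.1 i) (ω.2 i)) := by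
    rw [blockLaw, memoryless, Real.logb_mul h3.1 h3.2, Real.logb_prod]
    intro i _ h
    exact h3.2 (Finset.prod_eq_zero (Finset.mem_univ i) h)
  rw [h4]
  ring

/-! ### Time sharing -/

section TimeSharing

variable {Ω A : Type*} {n : ℕ}

/-- The product of the uniform law on `Fin n` with `p`. -/
def timeShare (n : ℕ) (p : Ω → ℝ) (t : Fin n × Ω) : ℝ := p t.2 / n

lemma timeShare_nonneg {p : Ω → ℝ} (hp : ∀ ω, 0 ≤ p ω) (t : Fin n × Ω) :
    0 ≤ timeShare n p t := div_nonneg (hp _) (Nat.cast_nonneg _)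

variable [Fintype Ω]

lemma sum_timeShare (p : Ω → ℝ) (F : Fin n × Ω → ℝ) :
    ∑ t, timeShare n p t * F t = (∑ i, ∑ ω, p ω * F (i, ω)) / n := by
  rw [Fintype.sum_prod_type, Finset.sum_div]
  refine Finset.sum_congr rfl fun i _ => ?_
  rw [Finset.sum_div]
  refine Finset.sum_congr rfl fun ω _ => ?_
  rw [timeShare]
  ring

lemma sum_timeShare_one (hn : n ≠ 0) {p : Ω → ℝ} (hp : ∑ ω, p ω = 1) :
    ∑ t, timeShare n p t = 1 := by
  have := sum_timeShare (n := n) p (fun _ => 1)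
  simp only [mul_one, hp] at this
  rw [this]
  simp [hn]

/-- The time index is uniform and visible in the pair. Its contribution `logb 2 n` cancels in every
conditional entropy given a variable that contains the time. -/
lemma ent_timeShare (hn : n ≠ 0) {p : Ω → ℝ} (hp : ∀ ω, 0 ≤ p ω) (hp1 : ∑ ω, p ω = 1)
    (f : Fin n → Ω → A) :
    ent (timeShare n p) (fun t => (t.1, f t.1 t.2))
      = (∑ i, ent p (f i)) / n + Real.logb 2 n := by
  have hn' : (n : ℝ) ≠ 0 := by exact_mod_cast hn
  have h1 : ∀ (i : Fin n) (a : A), push (timeShare n p) (fun t => (t.1, f t.1 t.2)) (i, a)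
      = push p (f i) a / n := by
    intro i a
    simp only [push]
    rw [Fintype.sum_prod_type, Finset.sum_eq_single i, Finset.sum_div]
    · refine Finset.sum_congr rfl fun ω _ => ?_
      by_cases h : f i ω = a <;> simp [h, timeShare]
    · intro j _ hj
      simp [hj]
    · simp
  have h2 : ∀ i ω, p ω * Real.logb 2 (push p (f i) (f i ω) / n)
      = p ω * Real.logb 2 (push p (f i) (f i ω)) - p ω * Real.logb 2 n := by
    intro i ω
    rcases (hp ω).eq_or_lt with h0 | h0
    · simp [← h0]
    rw [Real.logb_div (push_pos hp (f i) h0).ne' hn']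
    ring
  rw [ent, sum_timeShare]
  simp only [h1, h2, Finset.sum_sub_distrib, ← Finset.sum_mul, hp1, ent, Finset.sum_neg_distrib]
  simp only [Finset.sum_const, Finset.card_univ, Fintype.card_fin, nsmul_eq_mul]
  field_simp
  ring

end TimeSharing

/-! ### Marginal channels and the physically degraded channel -/

namespace WardenBC

section Marginals

variable {X Y₁ Y₂ Z : Type*} [Fintype Y₁] [Fintype Y₂] [Fintype Z] (C : WardenBC X Y₁ Y₂ Z)

lemma W₁_mem (x : X) : C.W₁ x ∈ stdSimplex ℝ Y₁ := by
  refine ⟨fun y => Finset.sum_nonneg fun _ _ => Finset.sum_nonneg fun _ _ => (C.law_mem x).1 _, ?_⟩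
  rw [← (C.law_mem x).2, Fintype.sum_prod_type]
  simp only [W₁, Fintype.sum_prod_type]

lemma W₂_mem (x : X) : C.W₂ x ∈ stdSimplex ℝ Y₂ := by
  refine ⟨fun y => Finset.sum_nonneg fun _ _ => Finset.sum_nonneg fun _ _ => (C.law_mem x).1 _, ?_⟩
  rw [← (C.law_mem x).2, Fintype.sum_prod_type]
  simp only [W₂, Fintype.sum_prod_type]
  rw [Finset.sum_comm]

lemma WZ_mem (x : X) : C.WZ x ∈ stdSimplex ℝ Z := by
  refine ⟨fun y => Finset.sum_nonneg fun _ _ => Finset.sum_nonneg fun _ _ => (C.law_mem x).1 _, ?_⟩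
  rw [← (C.law_mem x).2, Fintype.sum_prod_type]
  simp only [WZ, Fintype.sum_prod_type]
  rw [Finset.sum_comm]
  refine Finset.sum_congr rfl fun _ _ => ?_
  rw [Finset.sum_comm]

/-- The physically degraded channel to the pair of users. -/
def pairLaw (V : Y₁ → Y₂ → ℝ) (x : X) (y : Y₁ × Y₂) : ℝ := C.W₁ x y.1 * V y.1 y.2

variable {C} {V : Y₁ → Y₂ → ℝ}

lemma sum_pairLaw_fst (hV : ∀ y₁, V y₁ ∈ stdSimplex ℝ Y₂) (x : X) (G : Y₁ → ℝ) :
    ∑ b, C.pairLaw V x b * G b.1 = ∑ a, C.W₁ x a * G a := by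
  rw [Fintype.sum_prod_type]
  refine Finset.sum_congr rfl fun a _ => ?_
  simp only [pairLaw, mul_right_comm _ (V _ _)]
  rw [← Finset.mul_sum, (hV a).2, mul_one]

lemma sum_pairLaw_snd (hdeg : ∀ x y₂, C.W₂ x y₂ = ∑ y₁, C.W₁ x y₁ * V y₁ y₂) (x : X)
    (G : Y₂ → ℝ) : ∑ b, C.pairLaw V x b * G b.2 = ∑ a, C.W₂ x a * G a := by
  rw [Fintype.sum_prod_type, Finset.sum_comm]
  refine Finset.sum_congr rfl fun a _ => ?_
  rw [hdeg, Finset.sum_mul]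
  rfl

lemma pairLaw_mem (hV : ∀ y₁, V y₁ ∈ stdSimplex ℝ Y₂) (x : X) :
    C.pairLaw V x ∈ stdSimplex ℝ (Y₁ × Y₂) := by
  refine ⟨fun b => mul_nonneg ((C.W₁_mem x).1 _) ((hV _).1 _), ?_⟩
  have := sum_pairLaw_fst (C := C) hV x (fun _ => 1)
  simp only [mul_one] at this
  rw [this, (C.W₁_mem x).2]

end Marginals

/-! ### Single-letterization of the block informations -/

section BlockConverse

variable {X Y₁ Y₂ Z M T υ : Type*} [Fintype X] [Fintype Y₁] [Fintype Y₂] [Fintype Z] [Fintype M]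
  [Fintype υ] {C : WardenBC X Y₁ Y₂ Z} {V : Y₁ → Y₂ → ℝ} {n : ℕ}
  {μ : M → ℝ} {x : M → Fin n → X} {τ : M → T}
  {e : Fin n × T × (Fin n → Option (Y₁ × Y₂)) → υ}

/-- The auxiliary variable of the converse: the time index, a function of the input index, and
the past outputs. -/
def auxVar (τ : M → T) (e : Fin n × T × (Fin n → Option (Y₁ × Y₂)) → υ)
    (t : Fin n × M × (Fin n → Y₁ × Y₂)) : υ := e (t.1, τ t.2.1, mask t.1 t.2.2)

/-- The joint law of the auxiliary variable and the input letter at a uniform time. -/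
def auxLaw (C : WardenBC X Y₁ Y₂ Z) (V : Y₁ → Y₂ → ℝ) (μ : M → ℝ) (x : M → Fin n → X)
    (τ : M → T) (e : Fin n × T × (Fin n → Option (Y₁ × Y₂)) → υ) : υ × X → ℝ :=
  push (timeShare n (blockLaw μ x (C.pairLaw V))) fun t => (auxVar τ e t, x t.2.1 t.1)

lemma auxLaw_mem (hn : n ≠ 0) (hV : ∀ y₁, V y₁ ∈ stdSimplex ℝ Y₂) (hμ : μ ∈ stdSimplex ℝ M) :
    auxLaw C V μ x τ e ∈ stdSimplex ℝ (υ × X) := by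
  refine ⟨fun _ => push_nonneg (timeShare_nonneg (blockLaw_nonneg hμ.1 (pairLaw_mem hV))) _ _, ?_⟩
  rw [auxLaw, sum_push, sum_timeShare_one hn]
  rw [sum_blockLaw (pairLaw_mem hV), hμ.2]

-- This is the Markov property of the time-shared model: a variable that does not look at the
-- present output depends on it only through the present input.
omit [Fintype X] [Fintype υ] in
lemma sum_timeShare_coord (hV : ∀ y₁, V y₁ ∈ stdSimplex ℝ Y₂)
    (F : Y₁ × Y₂ → Fin n × M × (Fin n → Y₁ × Y₂) → ℝ)
    (hF : ∀ b i m y c, F b (i, m, Function.update y i c) = F b (i, m, y)) :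
    ∑ t, timeShare n (blockLaw μ x (C.pairLaw V)) t * F (t.2.2 t.1) t
      = ∑ t, timeShare n (blockLaw μ x (C.pairLaw V)) t *
        ∑ b, C.pairLaw V (x t.2.1 t.1) b * F b t := by
  rw [sum_timeShare, sum_timeShare]
  congr 1
  refine Finset.sum_congr rfl fun i _ => ?_
  exact sum_blockLaw_coord (pairLaw_mem hV) i (fun b ω => F b (i, ω))
    (fun b m y c => hF b i m y c)

-- The auxiliary variable sees only past outputs, so the present `Y₁` is generated from the present
-- input alone. Hence informations of the block model are those of `auxLaw` followed by the channel.
omit [Fintype X] [Fintype υ] in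
lemma push_auxVar_fst (hV : ∀ y₁, V y₁ ∈ stdSimplex ℝ Y₂) (s : υ × X × Y₁) :
    push (timeShare n (blockLaw μ x (C.pairLaw V)))
        (fun t => (auxVar τ e t, x t.2.1 t.1, (t.2.2 t.1).1)) s
      = auxLaw C V μ x τ e (s.1, s.2.1) * C.W₁ s.2.1 s.2.2 := by
  obtain ⟨u, a, y⟩ := s
  have h := sum_timeShare_coord (C := C) (μ := μ) (x := x) hV
    (fun b t => if auxVar τ e t = u ∧ x t.2.1 t.1 = a ∧ b.1 = y then 1 else 0)
    (fun b i m y c => by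
      have h : auxVar τ e (i, m, Function.update y i c) = auxVar τ e (i, m, y) := by
        simp only [auxVar, mask_update]
      by_cases h' : auxVar τ e (i, m, y) = u <;> simp [h, h'])
  have h1 : ∀ t : Fin n × M × (Fin n → Y₁ × Y₂), (∑ b, C.pairLaw V (x t.2.1 t.1) b *
      if auxVar τ e t = u ∧ x t.2.1 t.1 = a ∧ b.1 = y then (1 : ℝ) else 0)
      = if auxVar τ e t = u ∧ x t.2.1 t.1 = a then C.W₁ a y else 0 := by
    intro t
    rw [sum_pairLaw_fst hV (x t.2.1 t.1) (fun c => if auxVar τ e t = u ∧ x t.2.1 t.1 = a ∧ c = y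
      then (1 : ℝ) else 0)]
    by_cases h1 : auxVar τ e t = u
    · by_cases h2 : x t.2.1 t.1 = a
      · simp [h1, h2]
      · simp [h2]
    · simp [h1]
  simp only [h1] at h
  simp only [auxLaw, push, Finset.sum_mul, Prod.mk.injEq]
  simpa [mul_ite, ite_mul] using h

omit [Fintype υ] in
lemma push_auxVar_snd (hV : ∀ y₁, V y₁ ∈ stdSimplex ℝ Y₂)
    (hdeg : ∀ x y₂, C.W₂ x y₂ = ∑ y₁, C.W₁ x y₁ * V y₁ y₂) (s : υ × Y₂) :
    push (timeShare n (blockLaw μ x (C.pairLaw V)))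
        (fun t => (auxVar τ e t, (t.2.2 t.1).2)) s
      = ∑ a, auxLaw C V μ x τ e (s.1, a) * C.W₂ a s.2 := by
  obtain ⟨u, y⟩ := s
  have h := sum_timeShare_coord (C := C) (μ := μ) (x := x) hV
    (fun b t => if auxVar τ e t = u ∧ b.2 = y then 1 else 0)
    (fun b i m y c => by
      have h : auxVar τ e (i, m, Function.update y i c) = auxVar τ e (i, m, y) := by
        simp only [auxVar, mask_update]
      by_cases h' : auxVar τ e (i, m, y) = u <;> simp [h, h'])
  have h1 : ∀ t : Fin n × M × (Fin n → Y₁ × Y₂), (∑ b, C.pairLaw V (x t.2.1 t.1) b *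
      if auxVar τ e t = u ∧ b.2 = y then (1 : ℝ) else 0)
      = if auxVar τ e t = u then C.W₂ (x t.2.1 t.1) y else 0 := by
    intro t
    rw [sum_pairLaw_snd hdeg (x t.2.1 t.1) (fun c => if auxVar τ e t = u ∧ c = y
      then (1 : ℝ) else 0)]
    by_cases h1 : auxVar τ e t = u
    · simp [h1]
    · simp [h1]
  simp only [h1] at h
  rw [auxLaw, sum_push_prod_mul _ _ _ u (fun a => C.W₂ a y)]
  simp only [push, Prod.mk.injEq]
  simpa [mul_ite] using h

lemma infoX1_auxLaw_eq (hV : ∀ y₁, V y₁ ∈ stdSimplex ℝ Y₂) :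
    C.infoX1 (auxLaw C V μ x τ e)
      = condMutualInfo (push (timeShare n (blockLaw μ x (C.pairLaw V)))
        (fun t => (auxVar τ e t, x t.2.1 t.1, (t.2.2 t.1).1))) := by
  rw [infoX1]
  congr 1
  funext s
  rw [push_auxVar_fst hV]

lemma infoU2_auxLaw_eq (hV : ∀ y₁, V y₁ ∈ stdSimplex ℝ Y₂)
    (hdeg : ∀ x y₂, C.W₂ x y₂ = ∑ y₁, C.W₁ x y₁ * V y₁ y₂) :
    C.infoU2 (auxLaw C V μ x τ e)
      = mutualInfo (push (timeShare n (blockLaw μ x (C.pairLaw V)))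
        (fun t => (auxVar τ e t, (t.2.2 t.1).2))) := by
  rw [infoU2]
  congr 1
  funext s
  rw [push_auxVar_snd hV hdeg]

lemma infoX1_auxLaw_nonneg (hV : ∀ y₁, V y₁ ∈ stdSimplex ℝ Y₂) (hμ : ∀ m, 0 ≤ μ m) :
    0 ≤ C.infoX1 (auxLaw C V μ x τ e) := by
  rw [infoX1_auxLaw_eq hV]
  exact condMutualInfo_push_nonneg (timeShare_nonneg (blockLaw_nonneg hμ (pairLaw_mem hV))) _ _ _

lemma infoU2_auxLaw_nonneg (hn : n ≠ 0) (hV : ∀ y₁, V y₁ ∈ stdSimplex ℝ Y₂)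
    (hdeg : ∀ x y₂, C.W₂ x y₂ = ∑ y₁, C.W₁ x y₁ * V y₁ y₂) (hμ : μ ∈ stdSimplex ℝ M) :
    0 ≤ C.infoU2 (auxLaw C V μ x τ e) := by
  rw [infoU2_auxLaw_eq hV hdeg]
  refine mutualInfo_push_nonneg (timeShare_nonneg (blockLaw_nonneg hμ.1 (pairLaw_mem hV)))
    (sum_timeShare_one hn ?_) _ _
  rw [sum_blockLaw (pairLaw_mem hV), hμ.2]

omit [Fintype X] [Fintype υ] in
/-- Time sharing turns the conditional entropy given the auxiliary variable into an average. -/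
lemma ent_auxVar (hn : n ≠ 0) (he : Function.Injective e) (hV : ∀ y₁, V y₁ ∈ stdSimplex ℝ Y₂)
    (hμ : μ ∈ stdSimplex ℝ M) {B : Type*} (g : Y₁ × Y₂ → B) :
    n * (ent (timeShare n (blockLaw μ x (C.pairLaw V))) (fun t => (g (t.2.2 t.1), auxVar τ e t))
        - ent (timeShare n (blockLaw μ x (C.pairLaw V))) (auxVar τ e))
      = ∑ i : Fin n, (ent (blockLaw μ x (C.pairLaw V))
            (fun ω => (g (ω.2 i), (τ ω.1, mask i ω.2)))
          - ent (blockLaw μ x (C.pairLaw V)) (fun ω => (τ ω.1, mask i ω.2))) := by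
  have hn' : (n : ℝ) ≠ 0 := by exact_mod_cast hn
  have hp := blockLaw_nonneg (x := x) hμ.1 (pairLaw_mem (C := C) hV)
  have hp1 : ∑ ω, blockLaw μ x (C.pairLaw V) ω = 1 := by
    rw [sum_blockLaw (pairLaw_mem hV), hμ.2]
  have h1 := ent_timeShare hn hp hp1 (fun i ω => (τ ω.1, mask i ω.2))
  have h2 := ent_timeShare hn hp hp1 (fun i ω => (g (ω.2 i), (τ ω.1, mask i ω.2)))
  rw [ent_congr _ (f := auxVar τ e)
      (g := fun t : Fin n × M × (Fin n → Y₁ × Y₂) => (t.1, (τ t.2.1, mask t.1 t.2.2)))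
      (fun t t' => by simp only [auxVar, he.eq_iff]),
    ent_congr _ (f := fun t => (g (t.2.2 t.1), auxVar τ e t))
      (g := fun t : Fin n × M × (Fin n → Y₁ × Y₂) =>
        (t.1, (g (t.2.2 t.1), (τ t.2.1, mask t.1 t.2.2))))
      (fun t t' => by simp only [auxVar, Prod.mk.injEq, he.eq_iff]; tauto), h1, h2,
    Finset.sum_sub_distrib]
  field_simp
  ring

/-- The single-letter bound for the information that the first user receives. -/
lemma block_le_infoX1 (hn : n ≠ 0) (he : Function.Injective e)
    (hV : ∀ y₁, V y₁ ∈ stdSimplex ℝ Y₂) (hμ : μ ∈ stdSimplex ℝ M) :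
    (ent μ (fun m => m) - ent μ τ) - (ent (blockLaw μ x (C.pairLaw V)) (fun ω => ω)
        - ent (blockLaw μ x (C.pairLaw V)) (fun ω => (τ ω.1, ω.2)))
      ≤ n * C.infoX1 (auxLaw C V μ x τ e) := by
  have hn' : (n : ℝ) ≠ 0 := by exact_mod_cast hn
  set p := blockLaw μ x (C.pairLaw V) with hpdef
  have hp : ∀ ω, 0 ≤ p ω := blockLaw_nonneg (x := x) hμ.1 (pairLaw_mem (C := C) hV)
  have hp' := timeShare_nonneg (n := n) hp
  rw [infoX1_auxLaw_eq hV, condMutualInfo_push_eq_ent hp', mul_sub,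
    ent_auxVar (x := x) (C := C) hn he hV hμ Prod.fst, ← hpdef]
  -- By the Markov property the conditional law of `Y₁` given `U` and `X` is `C.W₁ X`, so this
  -- conditional entropy is an explicit expected log-likelihood.
  have h1 : n * (ent (timeShare n p) (fun t => ((t.2.2 t.1).1, (auxVar τ e t, x t.2.1 t.1)))
      - ent (timeShare n p) (fun t => (auxVar τ e t, x t.2.1 t.1)))
      = -∑ i, ∑ ω, p ω * Real.logb 2 (C.W₁ (x ω.1 i) (ω.2 i).1) := by
    have h2 : ∀ t, timeShare n p t * Real.logb 2 (C.W₁ (x t.2.1 t.1) (t.2.2 t.1).1)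
        = timeShare n p t * Real.logb 2 (push (timeShare n p)
            (fun t => ((t.2.2 t.1).1, (auxVar τ e t, x t.2.1 t.1)))
            ((t.2.2 t.1).1, (auxVar τ e t, x t.2.1 t.1)))
          - timeShare n p t * Real.logb 2 (push (timeShare n p)
            (fun t => (auxVar τ e t, x t.2.1 t.1)) (auxVar τ e t, x t.2.1 t.1)) := by
      intro t
      rcases (hp' t).eq_or_lt with h0 | h0
      · simp [← h0]
      have h3 := push_pos hp' (fun t => ((t.2.2 t.1).1, (auxVar τ e t, x t.2.1 t.1))) h0
      have h4 := push_pos hp' (fun t => (auxVar τ e t, x t.2.1 t.1)) h0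
      rw [push_congr (timeShare n p) (f := fun t => ((t.2.2 t.1).1, (auxVar τ e t, x t.2.1 t.1)))
        (g := fun t => (auxVar τ e t, x t.2.1 t.1, (t.2.2 t.1).1)) t
        (fun t' => by simp only [Prod.mk.injEq]; tauto), hpdef, push_auxVar_fst hV] at h3 ⊢
      have h5 : auxLaw C V μ x τ e (auxVar τ e t, x t.2.1 t.1) = push (timeShare n p)
            (fun t => (auxVar τ e t, x t.2.1 t.1)) (auxVar τ e t, x t.2.1 t.1) := rfl
      simp only [h5] at h3 ⊢
      rw [Real.logb_mul h4.ne' (pos_of_mul_pos_right h3 h4.le).ne']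
      ring
    have h6 := sum_timeShare (n := n) p
      (fun t => Real.logb 2 (C.W₁ (x t.2.1 t.1) (t.2.2 t.1).1))
    rw [eq_div_iff hn'] at h6
    simp only at h6
    rw [← h6]
    simp only [h2, Finset.sum_sub_distrib, ent]
    ring
  rw [h1]
  have h3 := ent_fst_sub_ent_id (x := x) hμ.1 (pairLaw_mem (C := C) hV)
  rw [ent_blockLaw_fst (pairLaw_mem hV) (fun m => m)] at h3
  have h4 := sum_ent_mask p (fun ω => τ ω.1) (fun ω => ω.2)
  rw [hpdef, ent_blockLaw_fst (pairLaw_mem hV) τ, ← hpdef] at h4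
  have h5 : ∀ i : Fin n, (ent p (fun ω => (ω.2 i, (τ ω.1, mask i ω.2)))
        - ent p (fun ω => (τ ω.1, mask i ω.2)))
        + ∑ ω, p ω * Real.logb 2 (C.pairLaw V (x ω.1 i) (ω.2 i))
      ≤ (ent p (fun ω => ((ω.2 i).1, (τ ω.1, mask i ω.2)))
        - ent p (fun ω => (τ ω.1, mask i ω.2)))
        + ∑ ω, p ω * Real.logb 2 (C.W₁ (x ω.1 i) (ω.2 i).1) := by
    intro i
    have hfac : ∀ ω, 0 < p ω →
        0 < C.W₁ (x ω.1 i) (ω.2 i).1 ∧ 0 < V (ω.2 i).1 (ω.2 i).2 := by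
      intro ω h0
      have h1 : C.pairLaw V (x ω.1 i) (ω.2 i) ≠ 0 := by
        intro h
        refine h0.ne' ?_
        rw [hpdef, blockLaw, memoryless, Finset.prod_eq_zero (Finset.mem_univ i) h, mul_zero]
      rw [pairLaw, mul_ne_zero_iff] at h1
      exact ⟨lt_of_le_of_ne ((C.W₁_mem _).1 _) h1.1.symm,
        lt_of_le_of_ne ((hV _).1 _) h1.2.symm⟩
    -- Degradedness enters here: the extra entropy of `Y₂` given `Y₁` is at most the cross entropy
    -- against `V`, which cancels the factor `V` in the log-likelihood of the pair.
    have h6 := cond_gibbs hp (fun ω => (ω.2 i).2) (fun ω => ((ω.2 i).1, (τ ω.1, mask i ω.2)))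
      (fun b a => V b.1 a) (fun b a => (hV _).1 _) (fun b => (hV _).2.le)
      (fun ω h0 => (hfac ω h0).2)
    have h7 : ent p (fun ω => ((ω.2 i).2, ((ω.2 i).1, (τ ω.1, mask i ω.2))))
        = ent p (fun ω => (ω.2 i, (τ ω.1, mask i ω.2))) :=
      ent_congr p fun ω ω' => by simp only [Prod.ext_iff]; tauto
    have h8 : ∑ ω, p ω * Real.logb 2 (C.pairLaw V (x ω.1 i) (ω.2 i))
        = ∑ ω, p ω * Real.logb 2 (C.W₁ (x ω.1 i) (ω.2 i).1)
          + ∑ ω, p ω * Real.logb 2 (V (ω.2 i).1 (ω.2 i).2) := by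
      rw [← Finset.sum_add_distrib]
      refine Finset.sum_congr rfl fun ω _ => ?_
      rcases (hp ω).eq_or_lt with h0 | h0
      · simp [← h0]
      rw [pairLaw, Real.logb_mul (hfac ω h0).1.ne' (hfac ω h0).2.ne']
      ring
    rw [h7] at h6
    rw [h8]
    linarith
  have h9 := Finset.sum_le_sum fun i (_ : i ∈ Finset.univ) => h5 i
  rw [Finset.sum_add_distrib, Finset.sum_add_distrib] at h9
  linarith

/-- The single-letter bound for the information that the second user receives. -/
lemma block_le_infoU2 {S : Type*} (h : T → S) (hn : n ≠ 0) (he : Function.Injective e)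
    (hV : ∀ y₁, V y₁ ∈ stdSimplex ℝ Y₂)
    (hdeg : ∀ x y₂, C.W₂ x y₂ = ∑ y₁, C.W₁ x y₁ * V y₁ y₂) (hμ : μ ∈ stdSimplex ℝ M) :
    (ent μ τ - ent μ (fun m => h (τ m)))
        - (ent (blockLaw μ x (C.pairLaw V)) (fun ω => (τ ω.1, fun i => (ω.2 i).2))
        - ent (blockLaw μ x (C.pairLaw V)) (fun ω => (h (τ ω.1), fun i => (ω.2 i).2)))
      ≤ n * C.infoU2 (auxLaw C V μ x τ e) := by
  have hn' : (n : ℝ) ≠ 0 := by exact_mod_cast hn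
  set p := blockLaw μ x (C.pairLaw V) with hpdef
  have hp : ∀ ω, 0 ≤ p ω := blockLaw_nonneg (x := x) hμ.1 (pairLaw_mem (C := C) hV)
  have hp1 : ∑ ω, p ω = 1 := by
    rw [hpdef, sum_blockLaw (pairLaw_mem hV), hμ.2]
  have hp' := timeShare_nonneg (n := n) hp
  rw [infoU2_auxLaw_eq hV hdeg, mutualInfo_push_eq_ent hp', mul_sub,
    ent_auxVar (x := x) (C := C) hn he hV hμ Prod.snd, ← hpdef]
  -- The past of both outputs determines the past of `Y₂`; forgetting the past of `Y₁` can only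
  -- raise the conditional entropy.
  have h1 : ∀ i : Fin n, (ent p (fun ω => ((ω.2 i).2, (τ ω.1, mask i ω.2)))
        - ent p (fun ω => (τ ω.1, mask i ω.2)))
      ≤ ent p (fun ω => ((ω.2 i).2, (τ ω.1, mask i fun i => (ω.2 i).2)))
        - ent p (fun ω => (τ ω.1, mask i fun i => (ω.2 i).2)) := by
    intro i
    have := cond_ent_le hp (fun ω => (ω.2 i).2) (fun ω => (τ ω.1, mask i ω.2))
      (fun b => (b.1, fun j => (b.2 j).map Prod.snd))
    have h2 : ∀ y : Fin n → Y₁ × Y₂, (fun j => (mask i y j).map Prod.snd)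
        = mask i fun i => (y i).2 := by
      intro y
      funext j
      by_cases h : (j : ℕ) < i <;> simp [mask, h]
    simpa only [h2] using this
  have h2 := Finset.sum_le_sum fun i (_ : i ∈ Finset.univ) => h1 i
  rw [sum_ent_mask p (fun ω => τ ω.1) (fun ω i => (ω.2 i).2)] at h2
  rw [show ent p (fun ω => τ ω.1) = ent μ τ from ent_blockLaw_fst (pairLaw_mem hV) τ] at h2
  set q := push (timeShare n p) (fun t => (t.2.2 t.1).2) with hq
  have hq0 : ∀ b, 0 ≤ q b := push_nonneg hp' _
  have hq1 : ∑ b, q b = 1 := by rw [hq, sum_push, sum_timeShare_one hn hp1]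
  have hqpos : ∀ ω, 0 < p ω → ∀ i : Fin n, 0 < q (ω.2 i).2 := by
    intro ω h0 i
    exact push_pos hp' (fun t => (t.2.2 t.1).2) (ω := (i, ω))
      (div_pos h0 (Nat.cast_pos.2 (Nat.pos_of_ne_zero hn)))
  -- Testing against the i.i.d. law with the time-averaged marginal `q` bounds the conditional block
  -- entropy by `n` times the entropy of one letter at a uniform time, without conditioning letter
  -- by letter.
  have h3 := cond_gibbs hp (fun ω i => (ω.2 i).2) (fun ω => h (τ ω.1))
    (fun _ y => ∏ i, q (y i)) (fun _ y => Finset.prod_nonneg fun _ _ => hq0 _)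
    (fun _ => (sum_prod_eq_one (fun _ : Fin n => q) fun _ => hq1).le)
    (fun ω h0 => Finset.prod_pos fun i _ => hqpos ω h0 i)
  have h4 : n * ent (timeShare n p) (fun t => (t.2.2 t.1).2)
      = -∑ ω, p ω * Real.logb 2 (∏ i, q (ω.2 i).2) := by
    rw [ent, ← hq, sum_timeShare p (fun t => Real.logb 2 (q (t.2.2 t.1).2)), mul_neg,
      mul_div_cancel₀ _ hn', Finset.sum_comm]
    congr 1
    refine Finset.sum_congr rfl fun ω _ => ?_
    rcases (hp ω).eq_or_lt with h0 | h0
    · simp [← h0]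
    rw [Real.logb_prod _ _ fun i _ => (hqpos ω h0 i).ne', Finset.mul_sum]
  rw [h4]
  rw [show ent p (fun ω => h (τ ω.1)) = ent μ (fun m => h (τ m)) from
    ent_blockLaw_fst (pairLaw_mem hV) fun m => h (τ m)] at h3
  have h5 : ent p (fun ω => (fun i => (ω.2 i).2, h (τ ω.1)))
      = ent p (fun ω => (h (τ ω.1), fun i => (ω.2 i).2)) :=
    ent_congr p fun ω ω' => by simp [and_comm]
  rw [h5] at h3
  linarith


lemma outZ_auxLaw (hV : ∀ y₁, V y₁ ∈ stdSimplex ℝ Y₂) (z : Z) :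
    C.outZ (auxLaw C V μ x τ e) z = (∑ i, ∑ m, μ m * C.WZ (x m i) z) / n := by
  rw [outZ]
  simp only [auxLaw, sum_push_prod_mul _ _ _ _ (fun a => C.WZ a z)]
  rw [Finset.sum_comm]
  simp only [Finset.sum_ite_eq, Finset.mem_univ, if_true]
  rw [sum_timeShare _ (fun t : Fin n × M × (Fin n → Y₁ × Y₂) => C.WZ (x t.2.1 t.1) z)]
  congr 1
  refine Finset.sum_congr rfl fun i _ => ?_
  exact sum_blockLaw_fst (pairLaw_mem hV) (fun m => C.WZ (x m i) z)

end BlockConverse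

end WardenBC

lemma klDivBits_le_coe_iff {α : Type*} [Fintype α] {P Q : α → ℝ} {r : ℝ} :
    klDivBits P Q ≤ (r : EReal) ↔
      (∀ a, Q a = 0 → P a = 0) ∧ ∑ a, P a * Real.logb 2 (P a / Q a) ≤ r := by
  rw [klDivBits]
  split_ifs with h
  · rw [EReal.coe_le_coe_iff]
    exact ⟨fun h' => ⟨h, h'⟩, And.right⟩
  · simp [h]

/-- The divergence from a product law dominates `n` times that of the average marginal. -/
lemma klDiv_average_le {Z : Type*} [Fintype Z] {n : ℕ} (hn : n ≠ 0) {R : (Fin n → Z) → ℝ}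
    (hR : ∀ z, 0 ≤ R z) (hR1 : ∑ z, R z = 1) {Q : Z → ℝ}
    (hac : ∀ z : Fin n → Z, ∏ i, Q (z i) = 0 → R z = 0) :
    n * ∑ a, push (timeShare n R) (fun t => t.2 t.1) a *
        Real.logb 2 (push (timeShare n R) (fun t => t.2 t.1) a / Q a)
      ≤ ∑ z, R z * Real.logb 2 (R z / ∏ i, Q (z i)) := by
  have hn' : (n : ℝ) ≠ 0 := by exact_mod_cast hn
  have hR' := timeShare_nonneg (n := n) hR
  set q := push (timeShare n R) (fun t => t.2 t.1) with hq
  have hq0 : ∀ a, 0 ≤ q a := push_nonneg hR' _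
  have hq1 : ∑ a, q a = 1 := by rw [hq, sum_push, sum_timeShare_one hn hR1]
  have hqpos : ∀ z, 0 < R z → ∀ i : Fin n, 0 < q (z i) := fun z h0 i =>
    push_pos hR' (fun t => t.2 t.1) (ω := (i, z))
      (div_pos h0 (Nat.cast_pos.2 (Nat.pos_of_ne_zero hn)))
  have hQpos : ∀ z, 0 < R z → ∀ i : Fin n, Q (z i) ≠ 0 := fun z h0 i h =>
    h0.ne' (hac z (Finset.prod_eq_zero (Finset.mem_univ i) h))
  -- The gap between the two sides is the divergence of `R` from the i.i.d. law with marginal `q`.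
  have hg := gibbs R (fun z => ∏ i, q (z i)) hR (fun z => Finset.prod_nonneg fun _ _ => hq0 _)
    (by rw [sum_prod_eq_one (fun _ : Fin n => q) fun _ => hq1, hR1]) (fun z h => by
      by_contra h0
      have h0 : 0 < R z := lt_of_le_of_ne (hR z) (Ne.symm h0)
      exact (Finset.prod_pos fun i _ => hqpos z h0 i).ne' h)
  rw [hq, sum_push_mul _ _ (fun a => Real.logb 2 (push (timeShare n R) (fun t => t.2 t.1) a / Q a)),
    ← hq, sum_timeShare R (fun t => Real.logb 2 (q (t.2 t.1) / Q (t.2 t.1))),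
    mul_div_cancel₀ _ hn', Finset.sum_comm]
  rw [← sub_nonneg, ← Finset.sum_sub_distrib]
  refine hg.trans (Finset.sum_le_sum fun z _ => le_of_eq ?_)
  rcases (hR z).eq_or_lt with h0 | h0
  · simp [← h0]
  rw [← Finset.mul_sum, ← mul_sub,
    ← Real.logb_prod _ _ fun i _ => div_ne_zero (hqpos z h0 i).ne' (hQpos z h0 i),
    Finset.prod_div_distrib, ← Real.logb_div]
  · congr 2
    have h1 : ∏ i, Q (z i) ≠ 0 := Finset.prod_ne_zero_iff.2 fun i _ => hQpos z h0 i
    have h2 : ∏ i, q (z i) ≠ 0 := Finset.prod_ne_zero_iff.2 fun i _ => (hqpos z h0 i).ne'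
    field_simp
  · exact div_ne_zero h0.ne' (Finset.prod_ne_zero_iff.2 fun i _ => hQpos z h0 i)
  · exact div_ne_zero (Finset.prod_ne_zero_iff.2 fun i _ => (hqpos z h0 i).ne')
      (Finset.prod_ne_zero_iff.2 fun i _ => hQpos z h0 i)

/-! ### From a covert code to a single-letter law -/

namespace WardenBC

variable {X Y₁ Y₂ Z : Type*} [Fintype X] [Fintype Y₁] [Fintype Y₂] [Fintype Z]
  {C : WardenBC X Y₁ Y₂ Z} {V : Y₁ → Y₂ → ℝ} {n ν₁ ν₂ : ℕ}

omit [Fintype X] in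
lemma sum_memoryless_pairLaw_fst (hV : ∀ y₁, V y₁ ∈ stdSimplex ℝ Y₂) (x : Fin n → X)
    (G : (Fin n → Y₁) → ℝ) :
    ∑ y, memoryless (C.pairLaw V) x y * G (fun i => (y i).1)
      = ∑ y, memoryless C.W₁ x y * G y := by
  rw [← Equiv.sum_comp (Equiv.arrowProdEquivProdArrow (Fin n) (fun _ => Y₁) (fun _ => Y₂)).symm,
    Fintype.sum_prod_type]
  refine Finset.sum_congr rfl fun y _ => ?_
  simp only [memoryless, pairLaw, Equiv.arrowProdEquivProdArrow_symm_apply,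
    Finset.prod_mul_distrib]
  have := sum_prod_eq_one (fun i : Fin n => V (y i)) fun i => (hV (y i)).2
  simp only [mul_right_comm _ (∏ i, V _ _)]
  rw [← Finset.mul_sum, this, mul_one]

omit [Fintype X] in
lemma sum_memoryless_pairLaw_snd (hdeg : ∀ x y₂, C.W₂ x y₂ = ∑ y₁, C.W₁ x y₁ * V y₁ y₂)
    (x : Fin n → X) (G : (Fin n → Y₂) → ℝ) :
    ∑ y, memoryless (C.pairLaw V) x y * G (fun i => (y i).2)
      = ∑ y, memoryless C.W₂ x y * G y := by
  rw [← Equiv.sum_comp (Equiv.arrowProdEquivProdArrow (Fin n) (fun _ => Y₁) (fun _ => Y₂)).symm,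
    Fintype.sum_prod_type, Finset.sum_comm]
  refine Finset.sum_congr rfl fun y _ => ?_
  simp only [memoryless, pairLaw, Equiv.arrowProdEquivProdArrow_symm_apply]
  rw [← Finset.sum_mul]
  congr 1
  simp only [hdeg]
  rw [Fintype.prod_sum]

/-- The law of the messages and the key. -/
def msgLaw (c : Code X Y₁ Y₂ n ν₁ ν₂) (m : Fin ν₁ × Fin ν₂ × c.S) : ℝ :=
  c.PS m.2.2 / (ν₁ * ν₂)

omit [Fintype X] [Fintype Y₁] [Fintype Y₂] in
lemma sum_msgLaw_mul (c : Code X Y₁ Y₂ n ν₁ ν₂) (F : Fin ν₁ × Fin ν₂ × c.S → ℝ) :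
    ∑ m, msgLaw c m * F m
      = 1 / ((ν₁ : ℝ) * ν₂) * ∑ m₁, ∑ m₂, ∑ s, c.PS s * F (m₁, m₂, s) := by
  simp only [Fintype.sum_prod_type, Finset.mul_sum, msgLaw]
  refine Finset.sum_congr rfl fun _ _ => Finset.sum_congr rfl fun _ _ =>
    Finset.sum_congr rfl fun _ _ => by ring

omit [Fintype X] [Fintype Y₁] [Fintype Y₂] in
lemma msgLaw_mem (c : Code X Y₁ Y₂ n ν₁ ν₂) (hν₁ : 0 < ν₁) (hν₂ : 0 < ν₂) :
    msgLaw c ∈ stdSimplex ℝ (Fin ν₁ × Fin ν₂ × c.S) := by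
  refine ⟨fun m => div_nonneg (c.PS_mem.1 _) (by positivity), ?_⟩
  have := sum_msgLaw_mul c (fun _ => 1)
  simp only [mul_one, c.PS_mem.2] at this
  rw [this]
  have h1 : (ν₁ : ℝ) ≠ 0 := by positivity
  have h2 : (ν₂ : ℝ) ≠ 0 := by positivity
  simp
  field_simp

-- The difference is the conditional entropy of the first message given the second message and the
-- key: the message is uniform and independent of both, whatever the law of the key.
omit [Fintype X] [Fintype Y₁] [Fintype Y₂] in
lemma ent_msgLaw₁ (c : Code X Y₁ Y₂ n ν₁ ν₂) (hν₁ : 0 < ν₁) (hν₂ : 0 < ν₂) :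
    ent (msgLaw c) (fun m => m) - ent (msgLaw c) (fun m => m.2) = Real.logb 2 ν₁ := by
  have h1 : (ν₁ : ℝ) ≠ 0 := by positivity
  have h2 : (ν₂ : ℝ) ≠ 0 := by positivity
  have e1 : ∀ m, push (msgLaw c) (fun m => m) m = msgLaw c m := by
    intro m
    rw [push, Finset.sum_eq_single m] <;> simp +contextual
  have e2 : ∀ m, push (msgLaw c) (fun m => m.2) m = c.PS m.2 / ν₂ := by
    intro m
    rw [← sum_push_prod_left (msgLaw c) Prod.fst (fun m => m.2) m]
    have : ∀ a, push (msgLaw c) (fun m => (m.1, m.2)) (a, m) = c.PS m.2 / (ν₁ * ν₂) :=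
      fun a => e1 (a, m)
    simp only [this]
    simp
    field_simp
  have hm := msgLaw_mem c hν₁ hν₂
  have e3 : ∀ m, msgLaw c m * Real.logb 2 (c.PS m.2.2 / ν₂)
      = msgLaw c m * Real.logb 2 (msgLaw c m) + msgLaw c m * Real.logb 2 ν₁ := by
    intro m
    rcases (hm.1 m).eq_or_lt with h0 | h0
    · simp [← h0]
    have : c.PS m.2.2 / ν₂ = msgLaw c m * ν₁ := by rw [msgLaw]; field_simp
    rw [this, Real.logb_mul h0.ne' h1]
    ring
  simp only [ent, e1, e2, e3, Finset.sum_add_distrib, ← Finset.sum_mul, hm.2]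
  ring

omit [Fintype X] [Fintype Y₁] [Fintype Y₂] in
lemma ent_msgLaw₂ (c : Code X Y₁ Y₂ n ν₁ ν₂) (hν₁ : 0 < ν₁) (hν₂ : 0 < ν₂) :
    ent (msgLaw c) (fun m => m.2) - ent (msgLaw c) (fun m => m.2.2) = Real.logb 2 ν₂ := by
  have h1 : (ν₁ : ℝ) ≠ 0 := by positivity
  have h2 : (ν₂ : ℝ) ≠ 0 := by positivity
  have hm := msgLaw_mem c hν₁ hν₂
  have e2 : ∀ m, push (msgLaw c) (fun m => m.2) m = c.PS m.2 / ν₂ := by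
    intro m
    rw [← sum_push_prod_left (msgLaw c) Prod.fst (fun m => m.2) m]
    have : ∀ a, push (msgLaw c) (fun m => (m.1, m.2)) (a, m) = c.PS m.2 / (ν₁ * ν₂) := by
      intro a
      rw [push, Finset.sum_eq_single (a, m)] <;> simp +contextual [msgLaw]
    simp only [this]
    simp
    field_simp
  have e4 : ∀ s, push (msgLaw c) (fun m => m.2.2) s = c.PS s := by
    intro s
    rw [← sum_push_prod_left (msgLaw c) (fun m => m.2.1) (fun m => m.2.2) s]
    have : ∀ a, push (msgLaw c) (fun m => (m.2.1, m.2.2)) (a, s) = c.PS s / ν₂ :=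
      fun a => e2 (a, s)
    simp only [this]
    simp
    field_simp
  have e3 : ∀ m, msgLaw c m * Real.logb 2 (c.PS m.2.2 / ν₂)
      = msgLaw c m * Real.logb 2 (c.PS m.2.2) - msgLaw c m * Real.logb 2 ν₂ := by
    intro m
    rcases (hm.1 m).eq_or_lt with h0 | h0
    · simp [← h0]
    have : c.PS m.2.2 ≠ 0 := fun h => h0.ne' (by rw [msgLaw, h, zero_div])
    rw [Real.logb_div this h2]
    ring
  simp only [ent, e2, e3, e4, Finset.sum_sub_distrib, ← Finset.sum_mul, hm.2]
  ring

/-- Every covert code yields a single-letter law that satisfies the divergence constraint and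
dominates the message lengths up to Fano's correction. -/
theorem exists_law_of_code (hV : ∀ y₁, V y₁ ∈ stdSimplex ℝ Y₂)
    (hdeg : ∀ x y₂, C.W₂ x y₂ = ∑ y₁, C.W₁ x y₁ * V y₁ y₂) (hn : n ≠ 0) (hν₁ : 0 < ν₁)
    (hν₂ : 0 < ν₂) {ε δ : ℝ} (c : Code X Y₁ Y₂ n ν₁ ν₂) (hc : c.IsCovert C ε δ) :
    ∃ (U : Type) (_ : Fintype U) (P : U × X → ℝ), P ∈ stdSimplex ℝ (U × X) ∧
      klDivBits (C.outZ P) C.Q₀ ≤ ((δ / n : ℝ) : EReal) ∧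
      0 ≤ C.infoX1 P ∧ 0 ≤ C.infoU2 P ∧
      (1 - ε) * Real.logb 2 ν₁ - 1 ≤ n * C.infoX1 P ∧
      (1 - ε) * Real.logb 2 ν₂ - 1 ≤ n * C.infoU2 P := by
  have hn' : (n : ℝ) ≠ 0 := by exact_mod_cast hn
  have hnpos : (0 : ℝ) < n := by positivity
  obtain ⟨herr₁, herr₂, hkl⟩ := hc
  -- Relabelling by `Fin` keeps the auxiliary alphabet in `Type`, while the output alphabets may
  -- live in any universe.
  set e := Fintype.equivFin (Fin n × (Fin ν₂ × c.S) × (Fin n → Option (Y₁ × Y₂))) with he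
  set μ := msgLaw c with hμdef
  have hμ : μ ∈ stdSimplex ℝ _ := msgLaw_mem c hν₁ hν₂
  set x : Fin ν₁ × Fin ν₂ × c.S → Fin n → X := fun m => c.enc m.1 m.2.1 m.2.2 with hx
  set p := blockLaw μ x (C.pairLaw V) with hpdef
  have hp : ∀ ω, 0 ≤ p ω := blockLaw_nonneg (x := x) hμ.1 (pairLaw_mem (C := C) hV)
  have hp1 : ∑ ω, p ω = 1 := by rw [hpdef, sum_blockLaw (pairLaw_mem hV), hμ.2]
  have hlog : ∀ ν : ℕ, 0 ≤ Real.logb 2 ν := by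
    intro ν
    rcases Nat.eq_zero_or_pos ν with rfl | h
    · simp
    · exact Real.logb_nonneg one_lt_two (by exact_mod_cast h)
  refine ⟨_, inferInstance, auxLaw C V μ x Prod.snd e, auxLaw_mem hn hV hμ, ?_,
    infoX1_auxLaw_nonneg hV hμ.1, infoU2_auxLaw_nonneg hn hV hdeg hμ, ?_, ?_⟩
  · rw [klDivBits_le_coe_iff] at hkl ⊢
    have hR : ∀ z, c.wardenLaw C z = ∑ m, μ m * memoryless C.WZ (x m) z := by
      intro z
      rw [sum_msgLaw_mul c]
      rfl
    have hR0 : ∀ z, 0 ≤ c.wardenLaw C z := fun z => by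
      rw [hR]
      exact Finset.sum_nonneg fun m _ => mul_nonneg (hμ.1 m) (memoryless_nonneg C.WZ_mem _ _)
    have hRF : ∀ F : (Fin n → Z) → ℝ, ∑ z, c.wardenLaw C z * F z
        = ∑ m, μ m * ∑ z, memoryless C.WZ (x m) z * F z := by
      intro F
      simp only [hR, Finset.sum_mul, Finset.mul_sum, mul_assoc]
      rw [Finset.sum_comm]
    have hR1 : ∑ z, c.wardenLaw C z = 1 := by
      have := hRF (fun _ => 1)
      simpa [sum_memoryless C.WZ_mem, hμ.2] using this
    have hout : C.outZ (auxLaw C V μ x Prod.snd e)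
        = push (timeShare n (c.wardenLaw C)) (fun t => t.2 t.1) := by
      funext a
      rw [outZ_auxLaw hV]
      have := sum_timeShare (n := n) (c.wardenLaw C) (fun t => if t.2 t.1 = a then 1 else 0)
      simp only [mul_ite, mul_one, mul_zero] at this
      rw [push, this]
      congr 1
      refine Finset.sum_congr rfl fun i _ => ?_
      have h1 := hRF (fun z => if z i = a then 1 else 0)
      simp only [mul_ite, mul_one, mul_zero] at h1
      rw [h1]
      refine Finset.sum_congr rfl fun m _ => ?_
      have h2 := sum_prod_coord (fun j => C.WZ (x m j)) (fun j => (C.WZ_mem _).2) i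
        (fun b => if b = a then 1 else 0)
      simp only [mul_ite, mul_one, mul_zero, Finset.sum_ite_eq', Finset.mem_univ, if_true] at h2
      rw [← h2]
      rfl
    refine ⟨fun a ha => ?_, ?_⟩
    · rw [hout, push]
      refine Finset.sum_eq_zero fun t _ => ?_
      split_ifs with h
      · rw [timeShare, hkl.1 t.2 (Finset.prod_eq_zero (Finset.mem_univ t.1) (by rw [h, ha])),
          zero_div]
      · rfl
    · have := klDiv_average_le hn hR0 hR1 hkl.1
      rw [hout, le_div_iff₀ hnpos, mul_comm]
      exact this.trans hkl.2
  · have h1 := block_le_infoX1 (C := C) (x := x) (τ := Prod.snd) hn e.injective hV hμ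
    -- User 1 is granted the other message and both output blocks; the decoder ignores the extra
    -- data, so its error probability is unchanged.
    have h2 := fano hp hp1 (fun ω => ω.1.1) (fun ω => (ω.1.2, ω.2))
      (fun b => c.dec₁ (fun i => (b.2 i).1) b.1.2)
    have h3 : ent p (fun ω => (ω.1.1, (ω.1.2, ω.2))) = ent p (fun ω => ω) :=
      ent_congr p fun ω ω' => by simp only [Prod.ext_iff]; tauto
    have h4 : (∑ ω : (Fin ν₁ × Fin ν₂ × c.S) × (Fin n → Y₁ × Y₂),
        if c.dec₁ (fun i => (ω.2 i).1) ω.1.2.2 = ω.1.1 then 0 else p ω) = c.err₁ C := by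
      rw [Code.err₁, Fintype.sum_prod_type]
      have := sum_msgLaw_mul c (fun m => ∑ y with c.dec₁ y m.2.2 ≠ m.1,
        memoryless C.W₁ (c.enc m.1 m.2.1 m.2.2) y)
      simp only at this
      rw [← this]
      refine Finset.sum_congr rfl fun m _ => ?_
      have h5 := sum_memoryless_pairLaw_fst (C := C) hV (x m)
        (fun y => if c.dec₁ y m.2.2 = m.1 then 0 else 1)
      simp only [mul_ite, mul_zero, mul_one] at h5
      simp only [ne_eq, Finset.sum_filter, ite_not]
      rw [← h5, Finset.mul_sum]
      refine Finset.sum_congr rfl fun y _ => ?_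
      split_ifs <;> simp [hpdef, blockLaw, hμdef]
    rw [h3, h4] at h2
    have h5 := ent_msgLaw₁ c hν₁ hν₂
    have h6 := mul_le_mul_of_nonneg_right herr₁ (hlog ν₁)
    rw [← hpdef, h5] at h1
    linarith
  · have h1 := block_le_infoU2 (C := C) (x := x) (τ := Prod.snd) Prod.snd hn e.injective hV hdeg hμ
    have h2 := fano hp hp1 (fun ω => ω.1.2.1) (fun ω => (ω.1.2.2, fun i => (ω.2 i).2))
      (fun b => c.dec₂ b.2 b.1)
    have h3 : ent p (fun ω => (ω.1.2.1, (ω.1.2.2, fun i => (ω.2 i).2)))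
        = ent p (fun ω => (ω.1.2, fun i => (ω.2 i).2)) :=
      ent_congr p fun ω ω' => by simp only [Prod.ext_iff]; tauto
    have h4 : (∑ ω : (Fin ν₁ × Fin ν₂ × c.S) × (Fin n → Y₁ × Y₂),
        if c.dec₂ (fun i => (ω.2 i).2) ω.1.2.2 = ω.1.2.1 then 0 else p ω) = c.err₂ C := by
      rw [Code.err₂, Fintype.sum_prod_type]
      have := sum_msgLaw_mul c (fun m => ∑ y with c.dec₂ y m.2.2 ≠ m.2.1,
        memoryless C.W₂ (c.enc m.1 m.2.1 m.2.2) y)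
      simp only at this
      rw [← this]
      refine Finset.sum_congr rfl fun m _ => ?_
      have h5 := sum_memoryless_pairLaw_snd (C := C) hdeg (x m)
        (fun y => if c.dec₂ y m.2.2 = m.2.1 then 0 else 1)
      simp only [mul_ite, mul_zero, mul_one] at h5
      simp only [ne_eq, Finset.sum_filter, ite_not]
      rw [← h5, Finset.mul_sum]
      refine Finset.sum_congr rfl fun y _ => ?_
      split_ifs <;> simp [hpdef, blockLaw, hμdef]
    rw [h3, h4] at h2
    have h5 := ent_msgLaw₂ c hν₁ hν₂
    have h6 := mul_le_mul_of_nonneg_right herr₂ (hlog ν₂)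
    rw [← hpdef, h5] at h1
    linarith

end WardenBC

/-! ### One-shot superposition coding with unlimited common randomness -/

section Decode

variable {ν : ℕ}

/-- The index that is the only one to satisfy `G`, if there is one. -/
def uniqueIndex (hν : 0 < ν) (G : Fin ν → Prop) : Fin ν :=
  if h : ∃ m, G m ∧ ∀ m', m' ≠ m → ¬ G m' then h.choose else ⟨0, hν⟩

/-- Union bound: a wrong decision requires that the true index fails the test or that some other
index passes it. -/
lemma uniqueIndex_ne_le (hν : 0 < ν) (G : Fin ν → Prop) (m : Fin ν) :
    (if uniqueIndex hν G ≠ m then (1 : ℝ) else 0)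
      ≤ (if G m then 0 else 1) + ∑ m' ∈ Finset.univ.erase m, if G m' then 1 else 0 := by
  have h0 : (0 : ℝ) ≤ ∑ m' ∈ Finset.univ.erase m, if G m' then 1 else 0 :=
    Finset.sum_nonneg fun _ _ => by split_ifs <;> norm_num
  by_cases hm : G m
  · by_cases hex : ∃ m' ∈ Finset.univ.erase m, G m'
    · obtain ⟨m', hm', hG⟩ := hex
      have h1 : (1 : ℝ) ≤ ∑ m' ∈ Finset.univ.erase m, if G m' then 1 else 0 := by
        refine le_trans ?_ (Finset.single_le_sum (fun _ _ => ?_) hm')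
        · simp [hG]
        · split_ifs <;> norm_num
      split_ifs <;> linarith
    · push Not at hex
      have h : ∃ m, G m ∧ ∀ m', m' ≠ m → ¬ G m' := ⟨m, hm, fun m' h => hex m' (by simp [h])⟩
      have h1 : uniqueIndex hν G = m := by
        rw [uniqueIndex, dif_pos h]
        by_contra h2
        exact h.choose_spec.2 m (Ne.symm h2) hm
      simp [h1, hm]
  · simp only [hm, if_false]
    split_ifs <;> linarith

end Decode

section OneShot

variable {U X A₁ A₂ : Type*} [Fintype U] [Fintype X] [Fintype A₁] [Fintype A₂]

/-- The conditional law of the input given the cloud centre. -/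
def condLaw (p : U × X → ℝ) (u : U) (x : X) : ℝ :=
  -- On a null centre the value is arbitrary; the marginal of `X` keeps it a probability law.
  if ∑ x', p (u, x') = 0 then ∑ u', p (u', x) else p (u, x) / ∑ x', p (u, x')

lemma condLaw_mem {p : U × X → ℝ} (hp : p ∈ stdSimplex ℝ (U × X)) (u : U) :
    condLaw p u ∈ stdSimplex ℝ X := by
  by_cases h : ∑ x', p (u, x') = 0
  · refine ⟨fun x => ?_, ?_⟩
    · rw [condLaw, if_pos h]
      exact Finset.sum_nonneg fun _ _ => hp.1 _
    · simp only [condLaw, if_pos h]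
      rw [Finset.sum_comm, ← Fintype.sum_prod_type, hp.2]
  · refine ⟨fun x => ?_, ?_⟩
    · rw [condLaw, if_neg h]
      exact div_nonneg (hp.1 _) (Finset.sum_nonneg fun _ _ => hp.1 _)
    · simp only [condLaw, if_neg h]
      rw [← Finset.sum_div, div_self h]

lemma sum_mul_condLaw {p : U × X → ℝ} (hp : p ∈ stdSimplex ℝ (U × X)) (u : U) (x : X) :
    (∑ x', p (u, x')) * condLaw p u x = p (u, x) := by
  by_cases h : ∑ x', p (u, x') = 0
  · rw [h, zero_mul]
    exact ((Finset.sum_eq_zero_iff_of_nonneg fun _ _ => hp.1 _).1 h x (Finset.mem_univ x)).symm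
  · rw [condLaw, if_neg h, mul_div_cancel₀ _ h]

/-- The law of a random cloud: a centre and conditionally independent satellites. -/
def cloudLaw (ν : ℕ) (p : U × X → ℝ) (c : U × (Fin ν → X)) : ℝ :=
  (∑ x', p (c.1, x')) * ∏ m, condLaw p c.1 (c.2 m)

variable {p : U × X → ℝ} {ν : ℕ}

lemma cloudLaw_nonneg (hp : p ∈ stdSimplex ℝ (U × X)) (c : U × (Fin ν → X)) :
    0 ≤ cloudLaw ν p c :=
  mul_nonneg (Finset.sum_nonneg fun _ _ => hp.1 _)
    (Finset.prod_nonneg fun _ _ => (condLaw_mem hp _).1 _)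

lemma sum_cloudLaw_coord (hp : p ∈ stdSimplex ℝ (U × X)) (m : Fin ν) (G : U → X → ℝ) :
    ∑ c, cloudLaw ν p c * G c.1 (c.2 m) = ∑ u, ∑ x, p (u, x) * G u x := by
  rw [Fintype.sum_prod_type]
  refine Finset.sum_congr rfl fun u _ => ?_
  simp only [cloudLaw, mul_assoc]
  rw [← Finset.mul_sum, sum_prod_coord (fun _ => condLaw p u) (fun _ => (condLaw_mem hp u).2) m
    (G u), Finset.mul_sum]
  refine Finset.sum_congr rfl fun x _ => ?_
  rw [← mul_assoc, sum_mul_condLaw hp]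

lemma sum_cloudLaw_coord₂ (hp : p ∈ stdSimplex ℝ (U × X)) {m m' : Fin ν} (hm : m ≠ m')
    (G : U → X → X → ℝ) :
    ∑ c, cloudLaw ν p c * G c.1 (c.2 m) (c.2 m')
      = ∑ u, ∑ x, p (u, x) * ∑ x', condLaw p u x' * G u x x' := by
  rw [Fintype.sum_prod_type]
  refine Finset.sum_congr rfl fun u _ => ?_
  simp only [cloudLaw, mul_assoc]
  rw [← Finset.mul_sum, sum_prod_coord₂ (fun _ => condLaw p u) (fun _ => (condLaw_mem hp u).2) hm
    (G u), Finset.mul_sum]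
  refine Finset.sum_congr rfl fun x _ => ?_
  rw [← mul_assoc, sum_mul_condLaw hp]

lemma sum_cloudLaw (hp : p ∈ stdSimplex ℝ (U × X)) : ∑ c, cloudLaw ν p c = 1 := by
  rw [Fintype.sum_prod_type, ← hp.2, Fintype.sum_prod_type]
  refine Finset.sum_congr rfl fun u _ => ?_
  simp only [cloudLaw]
  rw [← Finset.mul_sum, sum_prod_eq_one (fun _ => condLaw p u) fun _ => (condLaw_mem hp u).2,
    mul_one]

/-- The threshold test of the second user. -/
def test₂ (p : U × X → ℝ) (W₂ : X → A₂ → ℝ) (g : ℝ) (u : U) (b : A₂) : Prop :=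
  g * ((∑ x, p (u, x)) * ∑ u', ∑ x, p (u', x) * W₂ x b) < ∑ x, p (u, x) * W₂ x b

/-- The threshold test of the first user. -/
def test₁ (p : U × X → ℝ) (W₁ : X → A₁ → ℝ) (g : ℝ) (u : U) (x : X) (a : A₁) : Prop :=
  g * (∑ x', p (u, x') * W₁ x' a) < W₁ x a * ∑ x', p (u, x')

/-- The probability that the true cloud fails the test of the second user. -/
def miss₂ (p : U × X → ℝ) (W₂ : X → A₂ → ℝ) (g : ℝ) : ℝ :=
  ∑ u, ∑ x, p (u, x) * ∑ b, W₂ x b * if test₂ p W₂ g u b then 0 else 1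

/-- The probability that the true satellite fails the test of the first user. -/
def miss₁ (p : U × X → ℝ) (W₁ : X → A₁ → ℝ) (g : ℝ) : ℝ :=
  ∑ u, ∑ x, p (u, x) * ∑ a, W₁ x a * if test₁ p W₁ g u x a then 0 else 1

/-- Change of measure: where the test passes, the product of the marginals is at most `1 / g` times
the joint law, and the joint law has total mass one. -/
lemma false_alarm₂ (hp : p ∈ stdSimplex ℝ (U × X)) {W₂ : X → A₂ → ℝ}
    (hW₂ : ∀ x, W₂ x ∈ stdSimplex ℝ A₂) {g : ℝ} (hg : 0 < g) :
    ∑ u, ∑ x, p (u, x) * ∑ b, W₂ x b * (∑ u', ∑ x', p (u', x') * if test₂ p W₂ g u' b then 1 else 0)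
      ≤ 1 / g := by
  have h1 : ∀ b : A₂, (∑ u, ∑ x, p (u, x) * W₂ x b) *
      (∑ u', ∑ x', p (u', x') * if test₂ p W₂ g u' b then 1 else 0)
      ≤ (∑ u, ∑ x, p (u, x) * W₂ x b) / g := by
    intro b
    rw [Finset.mul_sum, Finset.sum_div]
    refine Finset.sum_le_sum fun u _ => ?_
    rw [← Finset.sum_mul]
    have h0 : 0 ≤ ∑ x, p (u, x) * W₂ x b :=
      Finset.sum_nonneg fun x _ => mul_nonneg (hp.1 _) ((hW₂ x).1 b)
    split_ifs with h
    · rw [test₂] at h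
      rw [le_div_iff₀ hg, mul_one]
      nlinarith
    · rw [mul_zero, mul_zero]
      positivity
  have h2 : ∀ F : A₂ → ℝ, ∑ u, ∑ x, p (u, x) * ∑ b, W₂ x b * F b
      = ∑ b, (∑ u, ∑ x, p (u, x) * W₂ x b) * F b := by
    intro F
    simp only [Finset.sum_mul, Finset.mul_sum]
    rw [Finset.sum_comm' (t' := Finset.univ) (s' := fun _ => Finset.univ) (by simp)]
    rw [Finset.sum_comm]
    conv_rhs => rw [Finset.sum_comm]
    refine Finset.sum_congr rfl fun u _ => ?_
    conv_rhs => rw [Finset.sum_comm]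
    exact Finset.sum_congr rfl fun x _ => Finset.sum_congr rfl fun b _ => by ring
  rw [h2]
  refine (Finset.sum_le_sum fun b _ => h1 b).trans (le_of_eq ?_)
  rw [← Finset.sum_div]
  congr 1
  have h3 := h2 (fun _ => 1)
  simp only [mul_one, (hW₂ _).2] at h3
  rw [← h3, ← hp.2, Fintype.sum_prod_type]

/-- The same change of measure conditionally on the centre, for an independent satellite of the true
cloud. -/
lemma false_alarm₁ (hp : p ∈ stdSimplex ℝ (U × X)) {W₁ : X → A₁ → ℝ}
    (hW₁ : ∀ x, W₁ x ∈ stdSimplex ℝ A₁) {g : ℝ} (hg : 0 < g) :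
    ∑ u, ∑ x, p (u, x) * ∑ x', condLaw p u x' *
        ∑ a, W₁ x a * (if test₁ p W₁ g u x' a then 1 else 0) ≤ 1 / g := by
  have h1 : ∀ u, ∑ x, p (u, x) * ∑ x', condLaw p u x' *
        ∑ a, W₁ x a * (if test₁ p W₁ g u x' a then 1 else 0)
      = ∑ x', condLaw p u x' * ∑ a, (∑ x, p (u, x) * W₁ x a) *
        (if test₁ p W₁ g u x' a then 1 else 0) := by
    intro u
    simp only [Finset.mul_sum, Finset.sum_mul]
    rw [Finset.sum_comm]
    refine Finset.sum_congr rfl fun x' _ => ?_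
    rw [Finset.sum_comm]
    exact Finset.sum_congr rfl fun a _ => Finset.sum_congr rfl fun x _ => by ring
  have h2 : ∀ u, ∑ x', condLaw p u x' * ∑ a, (∑ x, p (u, x) * W₁ x a) *
        (if test₁ p W₁ g u x' a then 1 else 0) ≤ (∑ x, p (u, x)) / g := by
    intro u
    have h3 : (∑ x, p (u, x)) / g = ∑ x', condLaw p u x' * ((∑ x, p (u, x)) / g) := by
      rw [← Finset.sum_mul, (condLaw_mem hp u).2, one_mul]
    rw [h3]
    refine Finset.sum_le_sum fun x' _ => mul_le_mul_of_nonneg_left ?_ ((condLaw_mem hp u).1 _)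
    have h4 : (∑ x, p (u, x)) / g = ∑ a, W₁ x' a * ((∑ x, p (u, x)) / g) := by
      rw [← Finset.sum_mul, (hW₁ x').2, one_mul]
    rw [h4]
    have hpu : 0 ≤ ∑ x, p (u, x) := Finset.sum_nonneg fun _ _ => hp.1 _
    refine Finset.sum_le_sum fun a _ => ?_
    split_ifs with h
    · rw [test₁] at h
      rw [mul_one, mul_div_assoc', le_div_iff₀ hg, mul_comm]
      exact h.le
    · rw [mul_zero]
      exact mul_nonneg ((hW₁ x').1 a) (by positivity)
  simp only [h1]
  refine (Finset.sum_le_sum fun u _ => h2 u).trans (le_of_eq ?_)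
  rw [← Finset.sum_div, ← hp.2, Fintype.sum_prod_type]

/-- Superposition coding with unlimited common randomness: the key is the random codebook,
together with a random map with which the first user simulates the output of the second. -/
theorem exists_superposition_code (hp : p ∈ stdSimplex ℝ (U × X)) {W₁ : X → A₁ → ℝ}
    {W₂ : X → A₂ → ℝ} {V : A₁ → A₂ → ℝ} (hW₁ : ∀ x, W₁ x ∈ stdSimplex ℝ A₁)
    (hV : ∀ a, V a ∈ stdSimplex ℝ A₂) (hdeg : ∀ x b, W₂ x b = ∑ a, W₁ x a * V a b)
    {ν₁ ν₂ : ℕ} (hν₁ : 0 < ν₁) (hν₂ : 0 < ν₂) {g₁ g₂ : ℝ} (hg₁ : 0 < g₁) (hg₂ : 0 < g₂) :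
    ∃ (S : Type) (_ : Fintype S) (PS : S → ℝ) (enc : Fin ν₁ → Fin ν₂ → S → X)
      (dec₁ : A₁ → S → Fin ν₁) (dec₂ : A₂ → S → Fin ν₂), PS ∈ stdSimplex ℝ S ∧
      ∀ m₁ m₂,
        (∑ s, PS s * ∑ a, W₁ (enc m₁ m₂ s) a * (if dec₁ a s ≠ m₁ then 1 else 0)
          ≤ (miss₂ p W₂ g₂ + (ν₂ - 1 : ℝ) / g₂) + (miss₁ p W₁ g₁ + (ν₁ - 1 : ℝ) / g₁)) ∧
        (∑ s, PS s * ∑ b, W₂ (enc m₁ m₂ s) b * (if dec₂ b s ≠ m₂ then 1 else 0)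
          ≤ miss₂ p W₂ g₂ + (ν₂ - 1 : ℝ) / g₂) ∧
        ∀ F : X → ℝ, ∑ s, PS s * F (enc m₁ m₂ s) = ∑ u, ∑ x, p (u, x) * F x := by
  have hW₂ : ∀ x, W₂ x ∈ stdSimplex ℝ A₂ := by
    intro x
    refine ⟨fun b => ?_, ?_⟩
    · rw [hdeg]
      exact Finset.sum_nonneg fun a _ => mul_nonneg ((hW₁ x).1 a) ((hV a).1 b)
    · simp only [hdeg]
      rw [Finset.sum_comm]
      simp only [← Finset.mul_sum, (hV _).2, mul_one, (hW₁ x).2]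
  -- the codebook and its law
  let Q : (Fin ν₂ → U × (Fin ν₁ → X)) → ℝ := fun c => ∏ m, cloudLaw ν₁ p (c m)
  have hQ0 : ∀ c, 0 ≤ Q c := fun c => Finset.prod_nonneg fun m _ => cloudLaw_nonneg hp _
  have hQ1 : ∑ c, Q c = 1 :=
    sum_prod_eq_one (fun _ : Fin ν₂ => cloudLaw ν₁ p) fun _ => sum_cloudLaw hp
  have hQc : ∀ (m : Fin ν₂) (G : U × (Fin ν₁ → X) → ℝ),
      ∑ c, Q c * G (c m) = ∑ c, cloudLaw ν₁ p c * G c := fun m G =>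
    sum_prod_coord (fun _ : Fin ν₂ => cloudLaw ν₁ p) (fun _ => sum_cloudLaw hp) m G
  -- A random map with independent values `r a ∼ V a` realizes the degrading channel inside the key.
  -- User 1 can then run the decoder of user 2 with exactly its error probability, and no comparison
  -- of `I(U;Y₁)` with `I(U;Y₂)` is needed.
  let R : (A₁ → A₂) → ℝ := fun r => ∏ a, V a (r a)
  have hR0 : ∀ r, 0 ≤ R r := fun r => Finset.prod_nonneg fun a _ => (hV a).1 _
  have hR1 : ∑ r, R r = 1 := sum_prod_eq_one V fun a => (hV a).2
  have hRc : ∀ (a : A₁) (G : A₂ → ℝ), ∑ r, R r * G (r a) = ∑ b, V a b * G b := fun a G =>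
    sum_prod_coord V (fun a => (hV a).2) a G
  let d₂ : A₂ → (Fin ν₂ → U × (Fin ν₁ → X)) → Fin ν₂ := fun b c =>
    uniqueIndex hν₂ fun m => test₂ p W₂ g₂ (c m).1 b
  let d₁ : A₁ → U × (Fin ν₁ → X) → Fin ν₁ := fun a c =>
    uniqueIndex hν₁ fun m => test₁ p W₁ g₁ c.1 (c.2 m) a
  -- the error of the second user
  have herr₂ : ∀ m₁ m₂, ∑ c, Q c * ∑ b, W₂ ((c m₂).2 m₁) b * (if d₂ b c ≠ m₂ then 1 else 0)
      ≤ miss₂ p W₂ g₂ + (ν₂ - 1 : ℝ) / g₂ := by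
    intro m₁ m₂
    have h1 : ∀ c, Q c * ∑ b, W₂ ((c m₂).2 m₁) b * (if d₂ b c ≠ m₂ then 1 else 0)
        ≤ Q c * (∑ b, W₂ ((c m₂).2 m₁) b * if test₂ p W₂ g₂ (c m₂).1 b then 0 else 1)
          + ∑ m' ∈ Finset.univ.erase m₂, Q c * (∑ b, W₂ ((c m₂).2 m₁) b *
              if test₂ p W₂ g₂ (c m').1 b then 1 else 0) := by
      intro c
      rw [← Finset.mul_sum, ← mul_add, Finset.sum_comm, ← Finset.sum_add_distrib]
      refine mul_le_mul_of_nonneg_left (Finset.sum_le_sum fun b _ => ?_) (hQ0 c)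
      rw [← Finset.mul_sum, ← mul_add]
      exact mul_le_mul_of_nonneg_left
        (uniqueIndex_ne_le hν₂ (fun m => test₂ p W₂ g₂ (c m).1 b) m₂) ((hW₂ _).1 b)
    refine (Finset.sum_le_sum fun c _ => h1 c).trans ?_
    rw [Finset.sum_add_distrib]
    refine add_le_add (le_of_eq ?_) ?_
    · rw [hQc m₂ (fun k => ∑ b, W₂ (k.2 m₁) b * if test₂ p W₂ g₂ k.1 b then 0 else 1),
        sum_cloudLaw_coord hp m₁ (fun u x => ∑ b, W₂ x b * if test₂ p W₂ g₂ u b then 0 else 1)]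
      rfl
    · rw [Finset.sum_comm]
      have h2 : ∀ m' ∈ Finset.univ.erase m₂, ∑ c, Q c * (∑ b, W₂ ((c m₂).2 m₁) b *
              if test₂ p W₂ g₂ (c m').1 b then 1 else 0) ≤ 1 / g₂ := by
        intro m' hm'
        have hne : m₂ ≠ m' := (Finset.ne_of_mem_erase hm').symm
        have h3 := sum_prod_coord₂ (fun _ : Fin ν₂ => cloudLaw ν₁ p) (fun _ => sum_cloudLaw hp) hne
          (fun k k' => ∑ b, W₂ (k.2 m₁) b * if test₂ p W₂ g₂ k'.1 b then 1 else 0)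
        refine le_trans (le_of_eq h3) ?_
        have h4 : ∀ k : U × (Fin ν₁ → X), ∑ k' : U × (Fin ν₁ → X), cloudLaw ν₁ p k' *
              ∑ b, W₂ (k.2 m₁) b * (if test₂ p W₂ g₂ k'.1 b then (1 : ℝ) else 0)
            = ∑ b, W₂ (k.2 m₁) b *
              ∑ u', ∑ x', p (u', x') * if test₂ p W₂ g₂ u' b then 1 else 0 := by
          intro k
          rw [sum_cloudLaw_coord hp m₁ (fun u' _ => ∑ b, W₂ (k.2 m₁) b *
            (if test₂ p W₂ g₂ u' b then (1 : ℝ) else 0))]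
          simp only [Finset.mul_sum]
          rw [Finset.sum_comm' (t' := Finset.univ) (s' := fun _ => Finset.univ) (by simp)]
          rw [Finset.sum_comm]
          conv_rhs => rw [Finset.sum_comm]
          refine Finset.sum_congr rfl fun u _ => ?_
          conv_rhs => rw [Finset.sum_comm]
          exact Finset.sum_congr rfl fun x _ => Finset.sum_congr rfl fun b _ => by ring
        simp only [h4]
        rw [sum_cloudLaw_coord hp m₁ (fun _ x => ∑ b, W₂ x b *
              ∑ u', ∑ x', p (u', x') * if test₂ p W₂ g₂ u' b then 1 else 0)]
        exact false_alarm₂ hp hW₂ hg₂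
      refine (Finset.sum_le_sum h2).trans (le_of_eq ?_)
      rw [Finset.sum_const, Finset.card_erase_of_mem (Finset.mem_univ _), Finset.card_univ,
        Fintype.card_fin, nsmul_eq_mul, Nat.cast_sub hν₂]
      push_cast
      ring
  -- the error of the first user given the right cloud
  have herr₁ : ∀ m₁, ∑ k, cloudLaw ν₁ p k * ∑ a, W₁ (k.2 m₁) a * (if d₁ a k ≠ m₁ then 1 else 0)
      ≤ miss₁ p W₁ g₁ + (ν₁ - 1 : ℝ) / g₁ := by
    intro m₁
    have h1 : ∀ k, cloudLaw ν₁ p k * ∑ a, W₁ (k.2 m₁) a * (if d₁ a k ≠ m₁ then 1 else 0)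
        ≤ cloudLaw ν₁ p k * (∑ a, W₁ (k.2 m₁) a * if test₁ p W₁ g₁ k.1 (k.2 m₁) a then 0 else 1)
          + ∑ m' ∈ Finset.univ.erase m₁, cloudLaw ν₁ p k * (∑ a, W₁ (k.2 m₁) a *
              if test₁ p W₁ g₁ k.1 (k.2 m') a then 1 else 0) := by
      intro k
      rw [← Finset.mul_sum, ← mul_add, Finset.sum_comm, ← Finset.sum_add_distrib]
      refine mul_le_mul_of_nonneg_left (Finset.sum_le_sum fun b _ => ?_) (cloudLaw_nonneg hp k)
      rw [← Finset.mul_sum, ← mul_add]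
      exact mul_le_mul_of_nonneg_left
        (uniqueIndex_ne_le hν₁ (fun m => test₁ p W₁ g₁ k.1 (k.2 m) b) m₁) ((hW₁ _).1 b)
    refine (Finset.sum_le_sum fun c _ => h1 c).trans ?_
    rw [Finset.sum_add_distrib]
    refine add_le_add (le_of_eq ?_) ?_
    · rw [sum_cloudLaw_coord hp m₁ (fun u x => ∑ a, W₁ x a *
        if test₁ p W₁ g₁ u x a then 0 else 1)]
      rfl
    · rw [Finset.sum_comm]
      have h2 : ∀ m' ∈ Finset.univ.erase m₁, ∑ k, cloudLaw ν₁ p k * (∑ a, W₁ (k.2 m₁) a *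
              if test₁ p W₁ g₁ k.1 (k.2 m') a then 1 else 0) ≤ 1 / g₁ := by
        intro m' hm'
        rw [sum_cloudLaw_coord₂ hp (Finset.ne_of_mem_erase hm').symm (fun u x x' =>
          ∑ a, W₁ x a * if test₁ p W₁ g₁ u x' a then 1 else 0)]
        exact false_alarm₁ hp hW₁ hg₁
      refine (Finset.sum_le_sum h2).trans (le_of_eq ?_)
      rw [Finset.sum_const, Finset.card_erase_of_mem (Finset.mem_univ _), Finset.card_univ,
        Fintype.card_fin, nsmul_eq_mul, Nat.cast_sub hν₁]
      push_cast
      ring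
  -- the code
  let E := Fintype.equivFin ((Fin ν₂ → U × (Fin ν₁ → X)) × (A₁ → A₂))
  have hsum : ∀ G : (Fin ν₂ → U × (Fin ν₁ → X)) × (A₁ → A₂) → ℝ,
      ∑ s, Q (E.symm s).1 * R (E.symm s).2 * G (E.symm s)
        = ∑ c, Q c * ∑ r, R r * G (c, r) := by
    intro G
    rw [Equiv.sum_comp E.symm (fun s => Q s.1 * R s.2 * G s), Fintype.sum_prod_type]
    refine Finset.sum_congr rfl fun c _ => ?_
    rw [Finset.mul_sum]
    exact Finset.sum_congr rfl fun r _ => by ring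
  have hsum' : ∀ G : (Fin ν₂ → U × (Fin ν₁ → X)) → ℝ,
      ∑ s, Q (E.symm s).1 * R (E.symm s).2 * G (E.symm s).1 = ∑ c, Q c * G c := by
    intro G
    rw [hsum (fun t => G t.1)]
    simp only [← Finset.sum_mul, hR1, one_mul]
  -- The key is numbered by `Fin` because it must be in `Type`.
  refine ⟨Fin (Fintype.card ((Fin ν₂ → U × (Fin ν₁ → X)) × (A₁ → A₂))), inferInstance,
    fun s => Q (E.symm s).1 * R (E.symm s).2,
    fun m₁ m₂ s => ((E.symm s).1 m₂).2 m₁,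
    fun a s => d₁ a ((E.symm s).1 (d₂ ((E.symm s).2 a) (E.symm s).1)),
    fun b s => d₂ b (E.symm s).1, ⟨fun s => mul_nonneg (hQ0 _) (hR0 _), ?_⟩,
    fun m₁ m₂ => ⟨?_, ?_, fun F => ?_⟩⟩
  · simpa [hQ1] using hsum' (fun _ => 1)
  -- User 1 errs only if the simulated decoder picks a wrong cloud or the satellite test errs within
  -- the true cloud.
  · have h1 : ∀ s, Q (E.symm s).1 * R (E.symm s).2 * ∑ a, W₁ (((E.symm s).1 m₂).2 m₁) a *
          (if d₁ a ((E.symm s).1 (d₂ ((E.symm s).2 a) (E.symm s).1)) ≠ m₁ then 1 else 0)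
        ≤ Q (E.symm s).1 * R (E.symm s).2 * (∑ a, W₁ (((E.symm s).1 m₂).2 m₁) a *
            (if d₂ ((E.symm s).2 a) (E.symm s).1 ≠ m₂ then 1 else 0))
          + Q (E.symm s).1 * R (E.symm s).2 * (∑ a, W₁ (((E.symm s).1 m₂).2 m₁) a *
            (if d₁ a ((E.symm s).1 m₂) ≠ m₁ then 1 else 0)) := by
      intro s
      rw [← mul_add, ← Finset.sum_add_distrib]
      refine mul_le_mul_of_nonneg_left (Finset.sum_le_sum fun a _ => ?_)
        (mul_nonneg (hQ0 _) (hR0 _))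
      rw [← mul_add]
      refine mul_le_mul_of_nonneg_left ?_ ((hW₁ _).1 a)
      by_cases h : d₂ ((E.symm s).2 a) (E.symm s).1 = m₂
      · simp only [h, ne_eq, not_true_eq_false, if_false, zero_add, le_refl]
      · have : (0 : ℝ) ≤ if d₁ a ((E.symm s).1 m₂) ≠ m₁ then 1 else 0 := by
          split_ifs <;> norm_num
        rw [if_pos h]
        split_ifs at this ⊢ <;> linarith
    refine (Finset.sum_le_sum fun s _ => h1 s).trans ?_
    rw [Finset.sum_add_distrib]
    refine add_le_add ?_ ?_
    · rw [hsum (fun t => ∑ a, W₁ ((t.1 m₂).2 m₁) a * (if d₂ (t.2 a) t.1 ≠ m₂ then 1 else 0))]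
      refine le_trans (le_of_eq ?_) (herr₂ m₁ m₂)
      refine Finset.sum_congr rfl fun c _ => ?_
      congr 1
      have h2 : ∀ a, ∑ r, R r * (W₁ ((c m₂).2 m₁) a * (if d₂ (r a) c ≠ m₂ then (1 : ℝ) else 0))
          = ∑ b, W₁ ((c m₂).2 m₁) a * V a b * (if d₂ b c ≠ m₂ then (1 : ℝ) else 0) := by
        intro a
        rw [hRc a (fun b => W₁ ((c m₂).2 m₁) a * (if d₂ b c ≠ m₂ then (1 : ℝ) else 0))]
        exact Finset.sum_congr rfl fun b _ => by ring
      simp only [Finset.mul_sum]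
      rw [Finset.sum_comm]
      simp only [h2]
      rw [Finset.sum_comm]
      simp only [← Finset.sum_mul, hdeg]
    · rw [hsum' (fun c => ∑ a, W₁ ((c m₂).2 m₁) a * (if d₁ a (c m₂) ≠ m₁ then 1 else 0)),
        hQc m₂ (fun k => ∑ a, W₁ (k.2 m₁) a * (if d₁ a k ≠ m₁ then 1 else 0))]
      exact herr₁ m₁
  · rw [hsum' (fun c => ∑ b, W₂ ((c m₂).2 m₁) b * (if d₂ b c ≠ m₂ then 1 else 0))]
    exact herr₂ m₁ m₂
  · rw [hsum' (fun c => F ((c m₂).2 m₁)), hQc m₂ (fun k => F (k.2 m₁)),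
      sum_cloudLaw_coord hp m₁ (fun _ x => F x)]

end OneShot

/-! ### Superposition codes for memoryless channels -/

/-- Failing the test forces a low density sum only on the support of the product law, where the
logarithms are meaningful. The other blocks have weight zero, so Chebyshev's inequality still
applies. -/
lemma miss_le {A : Type*} [Fintype A] {n : ℕ} {L : A → ℝ} (hL : L ∈ stdSimplex ℝ A) (i : A → ℝ)
    (T : (Fin n → A) → Prop) {γ t : ℝ} (ht : 0 < t) (hγ : γ + t ≤ n * ∑ a, L a * i a)
    (hT : ∀ f : Fin n → A, (∀ j, 0 < L (f j)) → ¬ T f → ∑ j, i (f j) ≤ γ) :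
    ∑ f : Fin n → A, (∏ j, L (f j)) * (if T f then 0 else 1)
      ≤ n * (∑ a, L a * i a ^ 2) / t ^ 2 := by
  have h := chebyshev_sum (ι := Fin n) L hL.1 hL.2 i ht (by simpa using hγ)
  rw [Fintype.card_fin] at h
  refine le_trans (Finset.sum_le_sum fun f _ => ?_) h
  by_cases hf : ∀ j, 0 < L (f j)
  · refine mul_le_mul_of_nonneg_left ?_ (Finset.prod_nonneg fun j _ => hL.1 _)
    by_cases hTf : T f
    · rw [if_pos hTf]
      split_ifs <;> norm_num
    · rw [if_neg hTf, if_pos (hT f hf hTf)]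
  · push Not at hf
    obtain ⟨j, hj⟩ := hf
    have : ∏ j, L (f j) = 0 :=
      Finset.prod_eq_zero (Finset.mem_univ j) (le_antisymm hj (hL.1 _))
    simp [this]

namespace WardenBC

variable {U X Y₁ Y₂ Z : Type*} [Fintype U] [Fintype X] [Fintype Y₁] [Fintype Y₂] [Fintype Z]
  (C : WardenBC X Y₁ Y₂ Z) (P : U × X → ℝ)

/-- The joint law of `(U, X, Y₁)`. -/
def law₁ (t : U × X × Y₁) : ℝ := P (t.1, t.2.1) * C.W₁ t.2.1 t.2.2

/-- The joint law of `(U, Y₂)`. -/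
def law₂ (t : U × Y₂) : ℝ := ∑ x, P (t.1, x) * C.W₂ x t.2

/-- The information density of `X` and `Y₁` given `U`. -/
def dens₁ (t : U × X × Y₁) : ℝ :=
  Real.logb 2 (C.W₁ t.2.1 t.2.2 * (∑ x, P (t.1, x)) / ∑ x, P (t.1, x) * C.W₁ x t.2.2)

/-- The information density of `U` and `Y₂`. -/
def dens₂ (t : U × Y₂) : ℝ :=
  Real.logb 2 (C.law₂ P t / ((∑ x, P (t.1, x)) * ∑ u, C.law₂ P (u, t.2)))

variable {C P}

lemma law₁_mem (hP : P ∈ stdSimplex ℝ (U × X)) : C.law₁ P ∈ stdSimplex ℝ (U × X × Y₁) := by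
  refine ⟨fun t => mul_nonneg (hP.1 _) ((C.W₁_mem _).1 _), ?_⟩
  simp only [Fintype.sum_prod_type, law₁, ← Finset.mul_sum, (C.W₁_mem _).2, mul_one]
  rw [← hP.2, Fintype.sum_prod_type]

omit [Fintype U] in
lemma sum_law₂_right (u : U) : ∑ y, C.law₂ P (u, y) = ∑ x, P (u, x) := by
  simp only [law₂]
  rw [Finset.sum_comm]
  simp only [← Finset.mul_sum, (C.W₂_mem _).2, mul_one]

lemma law₂_mem (hP : P ∈ stdSimplex ℝ (U × X)) : C.law₂ P ∈ stdSimplex ℝ (U × Y₂) := by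
  refine ⟨fun t => Finset.sum_nonneg fun x _ => mul_nonneg (hP.1 _) ((C.W₂_mem _).1 _), ?_⟩
  rw [Fintype.sum_prod_type]
  simp only [sum_law₂_right]
  rw [← hP.2, Fintype.sum_prod_type]

lemma infoU2_eq : C.infoU2 P = ∑ t, C.law₂ P t * C.dens₂ P t := by
  have h : C.infoU2 P = mutualInfo (C.law₂ P) := rfl
  rw [h, mutualInfo, Fintype.sum_prod_type]
  simp only [sum_law₂_right, dens₂]

lemma infoX1_eq : C.infoX1 P = ∑ t, C.law₁ P t * C.dens₁ P t := by
  have h : C.infoX1 P = condMutualInfo (C.law₁ P) := rfl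
  rw [h, condMutualInfo]
  simp only [Fintype.sum_prod_type]
  refine Finset.sum_congr rfl fun u _ => Finset.sum_congr rfl fun x _ =>
    Finset.sum_congr rfl fun y _ => ?_
  by_cases h0 : P (u, x) = 0
  · simp [law₁, h0]
  simp only [dens₁, law₁, ← Finset.mul_sum, (C.W₁_mem _).2, mul_one]
  rw [mul_assoc (P (u, x)) (C.W₁ x y) (∑ x, P (u, x)), mul_div_mul_left _ _ h0]

/-- The block law of the codewords. -/
def blockInput (n : ℕ) (P : U × X → ℝ) (t : (Fin n → U) × (Fin n → X)) : ℝ :=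
  ∏ j, P (t.1 j, t.2 j)

lemma sum_prod_fun {A B : Type*} [Fintype A] [Fintype B] {n : ℕ} (F : (Fin n → A) → (Fin n → B) → ℝ) :
    ∑ a, ∑ b, F a b = ∑ f : Fin n → A × B, F (fun j => (f j).1) (fun j => (f j).2) := by
  rw [← Fintype.sum_prod_type', ← Equiv.sum_comp
    (Equiv.arrowProdEquivProdArrow (Fin n) (fun _ => A) (fun _ => B))]
  rfl

lemma blockInput_mem {n : ℕ} (hP : P ∈ stdSimplex ℝ (U × X)) :
    blockInput n P ∈ stdSimplex ℝ ((Fin n → U) × (Fin n → X)) := by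
  refine ⟨fun t => Finset.prod_nonneg fun j _ => hP.1 _, ?_⟩
  rw [Fintype.sum_prod_type, sum_prod_fun]
  exact sum_prod_eq_one (fun _ : Fin n => P) fun _ => hP.2

omit [Fintype U] in
lemma sum_blockInput_mul {n : ℕ} {Y : Type*} (W : X → Y → ℝ) (u : Fin n → U) (y : Fin n → Y) :
    ∑ x, blockInput n P (u, x) * memoryless W x y = ∏ j, ∑ x, P (u j, x) * W x (y j) := by
  rw [Fintype.prod_sum]
  simp only [blockInput, memoryless, Finset.prod_mul_distrib]

omit [Fintype U] in
lemma sum_blockInput {n : ℕ} (u : Fin n → U) :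
    ∑ x, blockInput n P (u, x) = ∏ j, ∑ x, P (u j, x) := by
  rw [Fintype.prod_sum]
  rfl

/-- Both sides of the block test factor over the letters, so its logarithm compares a sum of i.i.d.
densities, of mean `C.infoU2 P` each, with `γ`. -/
lemma miss₂_block_le {n : ℕ} (hP : P ∈ stdSimplex ℝ (U × X)) {γ t : ℝ} (ht : 0 < t)
    (hγ : γ + t ≤ n * C.infoU2 P) :
    miss₂ (blockInput n P) (memoryless C.W₂) ((2 : ℝ) ^ γ)
      ≤ n * (∑ s, C.law₂ P s * C.dens₂ P s ^ 2) / t ^ 2 := by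
  rw [infoU2_eq] at hγ
  have hL := law₂_mem (C := C) hP
  refine le_trans (le_of_eq ?_) (miss_le (n := n) hL (C.dens₂ P)
    (fun f => test₂ (blockInput n P) (memoryless C.W₂) ((2 : ℝ) ^ γ) (fun j => (f j).1)
      (fun j => (f j).2)) ht hγ ?_)
  · rw [miss₂, ← sum_prod_fun (fun u y => (∏ j, C.law₂ P (u j, y j)) *
      if test₂ (blockInput n P) (memoryless C.W₂) ((2 : ℝ) ^ γ) u y then 0 else 1)]
    refine Finset.sum_congr rfl fun u _ => ?_
    simp only [Finset.mul_sum]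
    rw [Finset.sum_comm]
    refine Finset.sum_congr rfl fun y _ => ?_
    simp only [← mul_assoc]
    rw [← Finset.sum_mul, sum_blockInput_mul]
    rfl
  · intro f hf hT
    have hq : ∀ j, 0 < (∑ x, P ((f j).1, x)) * ∑ u, C.law₂ P (u, (f j).2) := by
      intro j
      refine mul_pos ?_ ?_
      · rw [← sum_law₂_right (C := C)]
        exact lt_of_lt_of_le (hf j)
          (Finset.single_le_sum (f := fun y => C.law₂ P ((f j).1, y)) (fun y _ => hL.1 _)
            (Finset.mem_univ (f j).2))
      · exact lt_of_lt_of_le (hf j)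
          (Finset.single_le_sum (f := fun u => C.law₂ P (u, (f j).2)) (fun y _ => hL.1 _)
            (Finset.mem_univ (f j).1))
    have h1 : ∑ j, C.dens₂ P (f j) = Real.logb 2 (∏ j, C.law₂ P (f j) /
        ((∑ x, P ((f j).1, x)) * ∑ u, C.law₂ P (u, (f j).2))) := by
      rw [Real.logb_prod _ _ fun j _ => (div_pos (hf j) (hq j)).ne']
      rfl
    have h2 : ∑ u', ∑ x, blockInput n P (u', x) * memoryless C.W₂ x (fun j => (f j).2)
        = ∏ j, ∑ u, C.law₂ P (u, (f j).2) := by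
      rw [Fintype.prod_sum]
      refine Finset.sum_congr rfl fun u _ => ?_
      rw [sum_blockInput_mul]
      rfl
    rw [test₂, sum_blockInput, h2, sum_blockInput_mul, not_lt, ← Finset.prod_mul_distrib] at hT
    rw [h1, Real.logb_le_iff_le_rpow one_lt_two
      (Finset.prod_pos fun j _ => div_pos (hf j) (hq j)), Finset.prod_div_distrib,
      div_le_iff₀ (Finset.prod_pos fun j _ => hq j)]
    exact hT

lemma miss₁_block_le {n : ℕ} (hP : P ∈ stdSimplex ℝ (U × X)) {γ t : ℝ} (ht : 0 < t)
    (hγ : γ + t ≤ n * C.infoX1 P) :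
    miss₁ (blockInput n P) (memoryless C.W₁) ((2 : ℝ) ^ γ)
      ≤ n * (∑ s, C.law₁ P s * C.dens₁ P s ^ 2) / t ^ 2 := by
  rw [infoX1_eq] at hγ
  have hL := law₁_mem (C := C) hP
  refine le_trans (le_of_eq ?_) (miss_le (n := n) hL (C.dens₁ P)
    (fun f => test₁ (blockInput n P) (memoryless C.W₁) ((2 : ℝ) ^ γ) (fun j => (f j).1)
      (fun j => (f j).2.1) (fun j => (f j).2.2)) ht hγ ?_)
  · rw [miss₁, ← sum_prod_fun (fun u (b : Fin n → X × Y₁) => (∏ j, C.law₁ P (u j, b j)) *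
      if test₁ (blockInput n P) (memoryless C.W₁) ((2 : ℝ) ^ γ) u (fun j => (b j).1)
        (fun j => (b j).2) then 0 else 1)]
    refine Finset.sum_congr rfl fun u _ => ?_
    rw [← sum_prod_fun (fun x y => (∏ j, C.law₁ P (u j, (x j, y j))) *
      if test₁ (blockInput n P) (memoryless C.W₁) ((2 : ℝ) ^ γ) u x y then 0 else 1)]
    refine Finset.sum_congr rfl fun x _ => ?_
    rw [Finset.mul_sum]
    refine Finset.sum_congr rfl fun y _ => ?_
    simp only [law₁, Finset.prod_mul_distrib, blockInput, memoryless, mul_assoc]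
  · intro f hf hT
    have hW : ∀ j, 0 < P ((f j).1, (f j).2.1) ∧ 0 < C.W₁ (f j).2.1 (f j).2.2 := by
      intro j
      have h := (hf j).ne'
      rw [law₁, mul_ne_zero_iff] at h
      exact ⟨lt_of_le_of_ne (hP.1 _) h.1.symm, lt_of_le_of_ne ((C.W₁_mem _).1 _) h.2.symm⟩
    have hq : ∀ j, 0 < ∑ x, P ((f j).1, x) * C.W₁ x (f j).2.2 := fun j =>
      lt_of_lt_of_le (hf j) (Finset.single_le_sum
        (f := fun x => P ((f j).1, x) * C.W₁ x (f j).2.2)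
        (fun x _ => mul_nonneg (hP.1 _) ((C.W₁_mem _).1 _)) (Finset.mem_univ (f j).2.1))
    have hu : ∀ j, 0 < ∑ x, P ((f j).1, x) := fun j =>
      lt_of_lt_of_le (hW j).1 (Finset.single_le_sum (f := fun x => P ((f j).1, x))
        (fun x _ => hP.1 _) (Finset.mem_univ (f j).2.1))
    have hpos : ∀ j, 0 < C.W₁ (f j).2.1 (f j).2.2 * (∑ x, P ((f j).1, x)) /
        ∑ x, P ((f j).1, x) * C.W₁ x (f j).2.2 := fun j =>
      div_pos (mul_pos (hW j).2 (hu j)) (hq j)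
    have h1 : ∑ j, C.dens₁ P (f j) = Real.logb 2 (∏ j,
        C.W₁ (f j).2.1 (f j).2.2 * (∑ x, P ((f j).1, x)) /
          ∑ x, P ((f j).1, x) * C.W₁ x (f j).2.2) := by
      rw [Real.logb_prod _ _ fun j _ => (hpos j).ne']
      rfl
    rw [test₁, sum_blockInput, sum_blockInput_mul, not_lt, memoryless,
      ← Finset.prod_mul_distrib] at hT
    rw [h1, Real.logb_le_iff_le_rpow one_lt_two (Finset.prod_pos fun j _ => hpos j),
      Finset.prod_div_distrib, div_le_iff₀ (Finset.prod_pos fun j _ => hq j)]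
    exact hT

/-- Every single-letter law that satisfies the divergence constraint yields covert codes whose
message lengths are below the informations. -/
theorem exists_code_of_law {V : Y₁ → Y₂ → ℝ} (hV : ∀ y₁, V y₁ ∈ stdSimplex ℝ Y₂)
    (hdeg : ∀ x y₂, C.W₂ x y₂ = ∑ y₁, C.W₁ x y₁ * V y₁ y₂) {n ν₁ ν₂ : ℕ} (hn : n ≠ 0)
    (hν₁ : 0 < ν₁) (hν₂ : 0 < ν₂) {δ ε : ℝ} (hP : P ∈ stdSimplex ℝ (U × X))
    (hD : klDivBits (C.outZ P) C.Q₀ ≤ ((δ / n : ℝ) : EReal)) {γ₁ γ₂ t : ℝ} (ht : 0 < t)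
    (hγ₁ : γ₁ + t ≤ n * C.infoX1 P) (hγ₂ : γ₂ + t ≤ n * C.infoU2 P)
    (hε : (n * (∑ s, C.law₂ P s * C.dens₂ P s ^ 2) / t ^ 2 + (ν₂ - 1 : ℝ) / 2 ^ γ₂)
      + (n * (∑ s, C.law₁ P s * C.dens₁ P s ^ 2) / t ^ 2 + (ν₁ - 1 : ℝ) / 2 ^ γ₁) ≤ ε) :
    ∃ c : Code X Y₁ Y₂ n ν₁ ν₂, c.IsCovert C ε δ := by
  have hn' : (n : ℝ) ≠ 0 := by exact_mod_cast hn
  have hnpos : (0 : ℝ) < n := by positivity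
  have hmem' : ∀ y : Fin n → Y₁, memoryless V y ∈ stdSimplex ℝ (Fin n → Y₂) := fun y =>
    ⟨fun _ => memoryless_nonneg hV y _, sum_memoryless hV y⟩
  have hmem₁ : ∀ x : Fin n → X, memoryless C.W₁ x ∈ stdSimplex ℝ (Fin n → Y₁) := fun y =>
    ⟨fun _ => memoryless_nonneg C.W₁_mem y _, sum_memoryless C.W₁_mem y⟩
  have hdeg' : ∀ (x : Fin n → X) (y : Fin n → Y₂), memoryless C.W₂ x y
      = ∑ a, memoryless C.W₁ x a * memoryless V a y := by
    intro x y
    simp only [memoryless, hdeg]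
    rw [Fintype.prod_sum]
    simp only [Finset.prod_mul_distrib]
  obtain ⟨S, _, PS, enc, dec₁, dec₂, hPS, hcode⟩ := exists_superposition_code
    (blockInput_mem (n := n) hP) hmem₁ hmem' hdeg' hν₁ hν₂
    (g₁ := 2 ^ γ₁) (g₂ := 2 ^ γ₂) (by positivity) (by positivity)
  have h1 := miss₁_block_le (C := C) hP ht hγ₁
  have h2 := miss₂_block_le (C := C) hP ht hγ₂
  have havg : ∀ (F : Fin ν₁ → Fin ν₂ → ℝ) (a : ℝ), (∀ m₁ m₂, F m₁ m₂ ≤ a) →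
      1 / ((ν₁ : ℝ) * ν₂) * ∑ m₁, ∑ m₂, F m₁ m₂ ≤ a := by
    intro F a hF
    have h : ∑ m₁, ∑ m₂, F m₁ m₂ ≤ (ν₁ : ℝ) * ν₂ * a := by
      refine (Finset.sum_le_sum fun m₁ _ => Finset.sum_le_sum fun m₂ _ => hF m₁ m₂).trans ?_
      simp [mul_assoc]
    have hpos : 0 < (ν₁ : ℝ) * ν₂ := by positivity
    rw [one_div, inv_mul_le_iff₀ hpos]
    exact h
  have hν₁' : (1 : ℝ) ≤ ν₁ := by exact_mod_cast hν₁
  have h3 : 0 ≤ n * (∑ s, C.law₁ P s * C.dens₁ P s ^ 2) / t ^ 2 :=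
    div_nonneg (mul_nonneg hnpos.le (Finset.sum_nonneg fun s _ =>
      mul_nonneg ((law₁_mem hP).1 s) (sq_nonneg _))) (sq_nonneg _)
  have h4 : 0 ≤ (ν₁ - 1 : ℝ) / 2 ^ γ₁ := div_nonneg (by linarith) (by positivity)
  let c : Code X Y₁ Y₂ n ν₁ ν₂ :=
    { S := S, PS := PS, PS_mem := hPS, enc := enc, dec₁ := dec₁, dec₂ := dec₂ }
  refine ⟨c, ?_, ?_, ?_⟩
  · rw [Code.err₁]
    refine havg _ _ fun m₁ m₂ => ?_
    refine le_trans (le_of_eq ?_) (((hcode m₁ m₂).1).trans (by linarith))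
    refine Finset.sum_congr rfl fun s _ => ?_
    simp only [Finset.sum_filter, mul_ite, mul_one, mul_zero]
    rfl
  · rw [Code.err₂]
    refine havg _ _ fun m₁ m₂ => ?_
    refine le_trans (le_of_eq ?_) (((hcode m₁ m₂).2.1).trans (by linarith))
    refine Finset.sum_congr rfl fun s _ => ?_
    simp only [Finset.sum_filter, mul_ite, mul_one, mul_zero]
    rfl
  -- For every message pair the key averages the codeword to the i.i.d. law. The warden's law is
  -- therefore an exact product, and its divergence is `n` times the single-letter one.
  · have hR : c.wardenLaw C = fun z => ∏ j, C.outZ P (z j) := by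
      funext z
      rw [Code.wardenLaw]
      have h5 : ∏ j, C.outZ P (z j) = ∑ u : Fin n → U, ∏ j, ∑ x, P (u j, x) * C.WZ x (z j) := by
        rw [← Fintype.prod_sum (fun (j : Fin n) u => ∑ x, P (u, x) * C.WZ x (z j))]
        rfl
      have h6 : (ν₁ : ℝ) ≠ 0 := by positivity
      have h7 : (ν₂ : ℝ) ≠ 0 := by positivity
      have h8 : ∀ m₁ m₂, ∑ s, c.PS s * memoryless C.WZ (c.enc m₁ m₂ s) z
          = ∏ j, C.outZ P (z j) := by
        intro m₁ m₂
        refine ((hcode m₁ m₂).2.2 (fun x => memoryless C.WZ x z)).trans ?_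
        simp only [sum_blockInput_mul, h5]
      simp only [h8]
      simp
      field_simp
    rw [klDivBits_le_coe_iff] at hD ⊢
    have hq0 : ∀ z, 0 ≤ C.outZ P z := fun z => Finset.sum_nonneg fun _ _ =>
      Finset.sum_nonneg fun _ _ => mul_nonneg (hP.1 _) ((C.WZ_mem _).1 _)
    have hq1 : ∑ z, C.outZ P z = 1 := by
      simp only [outZ]
      rw [Finset.sum_comm, ← hP.2, Fintype.sum_prod_type]
      refine Finset.sum_congr rfl fun u _ => ?_
      rw [Finset.sum_comm]
      simp only [← Finset.mul_sum, (C.WZ_mem _).2, mul_one]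
    rw [hR]
    refine ⟨fun z hz => ?_, ?_⟩
    · obtain ⟨j, -, hj⟩ := Finset.prod_eq_zero_iff.1 hz
      exact Finset.prod_eq_zero (Finset.mem_univ j) (hD.1 _ hj)
    · have h5 : ∀ z : Fin n → Z, (∏ j, C.outZ P (z j)) *
          Real.logb 2 ((∏ j, C.outZ P (z j)) / ∏ j, C.Q₀ (z j))
          = ∑ j, (∏ j, C.outZ P (z j)) * Real.logb 2 (C.outZ P (z j) / C.Q₀ (z j)) := by
        intro z
        by_cases h0 : ∏ j, C.outZ P (z j) = 0
        · simp [h0]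
        have h8 : ∀ j, C.outZ P (z j) ≠ 0 := fun j => (Finset.prod_ne_zero_iff.1 h0) j
          (Finset.mem_univ j)
        rw [← Finset.prod_div_distrib, Real.logb_prod, Finset.mul_sum]
        exact fun j _ => div_ne_zero (h8 j) fun h => h8 j (hD.1 _ h)
      simp only [h5]
      rw [Finset.sum_comm]
      have h6 : ∀ j : Fin n, ∑ z : Fin n → Z, (∏ j, C.outZ P (z j)) *
          Real.logb 2 (C.outZ P (z j) / C.Q₀ (z j))
          = ∑ z, C.outZ P z * Real.logb 2 (C.outZ P z / C.Q₀ z) := fun j =>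
        sum_prod_coord (fun _ : Fin n => C.outZ P) (fun _ => hq1) j
          (fun a => Real.logb 2 (C.outZ P a / C.Q₀ a))
      simp only [h6, Finset.sum_const, Finset.card_univ, Fintype.card_fin, nsmul_eq_mul]
      have := hD.2
      rw [le_div_iff₀ hnpos] at this
      linarith

end WardenBC

/-! ### Elementary bounds on logarithms -/

/-- With `t = s²` the left side is `4 (s log s)²`, and `|s log s| ≤ |s² - 1|` on each side of `s =
1`. -/
lemma mul_log_sq_le {t : ℝ} (ht : 0 < t) : t * Real.log t ^ 2 ≤ 4 * (t - 1) ^ 2 := by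
  obtain ⟨s, hs, rfl⟩ : ∃ s : ℝ, 0 < s ∧ s ^ 2 = t := ⟨√t, Real.sqrt_pos.2 ht, Real.sq_sqrt ht.le⟩
  have h1 := Real.log_le_sub_one_of_pos hs
  have h2 := Real.one_sub_inv_le_log_of_pos hs
  have h3 : s - 1 ≤ s * Real.log s := by
    have := mul_le_mul_of_nonneg_left h2 hs.le
    rwa [mul_sub, mul_one, mul_inv_cancel₀ hs.ne'] at this
  rw [Real.log_pow]
  push_cast
  have h4 : (s * Real.log s) ^ 2 ≤ (s ^ 2 - 1) ^ 2 := by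
    rcases le_total 1 s with h | h
    · have h5 : 0 ≤ Real.log s := Real.log_nonneg h
      have h6 : s * Real.log s ≤ s ^ 2 - 1 := by nlinarith
      exact pow_le_pow_left₀ (by positivity) h6 2
    · have h5 : Real.log s ≤ 0 := Real.log_nonpos hs.le h
      have h6 : -(s * Real.log s) ≤ 1 - s ^ 2 := by nlinarith
      have h7 := pow_le_pow_left₀ (by nlinarith) h6 2
      nlinarith
  nlinarith

/-- Summed over a joint law `a` and its reference `b`, this bounds the second moment of the
information density by a chi-square divergence. -/
lemma mul_logb_sq_le {a b : ℝ} (ha : 0 ≤ a) (hb : 0 ≤ b) (h : b = 0 → a = 0) :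
    a * Real.logb 2 (a / b) ^ 2 ≤ 4 / Real.log 2 ^ 2 * ((a - b) ^ 2 / b) := by
  have h2 : 0 < Real.log 2 := Real.log_pos one_lt_two
  rcases ha.eq_or_lt with rfl | ha
  · simp; positivity
  have hb : 0 < b := lt_of_le_of_ne hb fun h' => ha.ne' (h h'.symm)
  have key := mul_le_mul_of_nonneg_left (mul_log_sq_le (div_pos ha hb)) hb.le
  have e1 : a * Real.logb 2 (a / b) ^ 2 = b * (a / b * Real.log (a / b) ^ 2) / Real.log 2 ^ 2 := by
    rw [Real.logb]; field_simp
  have e2 : 4 / Real.log 2 ^ 2 * ((a - b) ^ 2 / b)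
      = b * (4 * (a / b - 1) ^ 2) / Real.log 2 ^ 2 := by field_simp
  rw [e1, e2]
  gcongr

lemma mul_logb_le_chi {a b : ℝ} (ha : 0 ≤ a) (hb : 0 ≤ b) (h : b = 0 → a = 0) :
    a * Real.logb 2 (a / b) ≤ ((a - b) ^ 2 / b + (a - b)) / Real.log 2 := by
  have h2 : 0 < Real.log 2 := Real.log_pos one_lt_two
  rw [Real.logb, ← mul_div_assoc]
  refine div_le_div_of_nonneg_right ?_ h2.le
  rcases hb.eq_or_lt with rfl | hb
  · simp [h]
  rcases ha.eq_or_lt with rfl | ha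
  · simp
    field_simp
    norm_num
  have key := mul_le_mul_of_nonneg_left (Real.log_le_sub_one_of_pos (div_pos ha hb)) ha.le
  have : a * (a / b - 1) = (a - b) ^ 2 / b + (a - b) := by field_simp; ring
  linarith

/-- The bound `1 - 1/x ≤ log x` is used at `x = √(a / b)`. The linear term `a - b` cancels when
summed over two probability laws. -/
lemma sqrt_sub_sqrt_sq_le {a b : ℝ} (ha : 0 ≤ a) (hb : 0 ≤ b) (h : b = 0 → a = 0) :
    ((√a - √b) ^ 2 + (a - b)) / Real.log 2 ≤ a * Real.logb 2 (a / b) := by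
  have h2 : 0 < Real.log 2 := Real.log_pos one_lt_two
  rw [Real.logb, ← mul_div_assoc]
  refine div_le_div_of_nonneg_right ?_ h2.le
  rcases ha.eq_or_lt with rfl | ha
  · simp [Real.sq_sqrt hb]
  have hb : 0 < b := lt_of_le_of_ne hb fun h' => ha.ne' (h h'.symm)
  obtain ⟨s, hs, rfl⟩ : ∃ s : ℝ, 0 < s ∧ s ^ 2 = a := ⟨√a, Real.sqrt_pos.2 ha, Real.sq_sqrt ha.le⟩
  obtain ⟨r, hr, rfl⟩ : ∃ s : ℝ, 0 < s ∧ s ^ 2 = b := ⟨√b, Real.sqrt_pos.2 hb, Real.sq_sqrt hb.le⟩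
  rw [Real.sqrt_sq hs.le, Real.sqrt_sq hr.le, ← div_pow, Real.log_pow]
  have key := mul_le_mul_of_nonneg_left (Real.one_sub_inv_le_log_of_pos (div_pos hs hr))
    (sq_nonneg s)
  have : s ^ 2 * (1 - (s / r)⁻¹) = s ^ 2 - s * r := by field_simp
  push_cast
  nlinarith

/-- The squared Hellinger distance is at most the divergence. -/
lemma sq_sub_le_klDiv {Z : Type*} [Fintype Z] {P Q : Z → ℝ} (hP : P ∈ stdSimplex ℝ Z)
    (hQ : Q ∈ stdSimplex ℝ Z) (h : ∀ z, Q z = 0 → P z = 0) (z : Z) :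
    (P z - Q z) ^ 2 ≤ 4 * Real.log 2 * ∑ z, P z * Real.logb 2 (P z / Q z) := by
  have h2 : 0 < Real.log 2 := Real.log_pos one_lt_two
  have h1 : (∑ z, (√(P z) - √(Q z)) ^ 2) / Real.log 2 ≤ ∑ z, P z * Real.logb 2 (P z / Q z) := by
    refine le_trans (le_of_eq ?_) (Finset.sum_le_sum fun z _ =>
      sqrt_sub_sqrt_sq_le (hP.1 z) (hQ.1 z) (h z))
    rw [← Finset.sum_div, Finset.sum_add_distrib, Finset.sum_sub_distrib, hP.2, hQ.2]
    simp
  rw [div_le_iff₀ h2] at h1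
  have h3 : (√(P z) - √(Q z)) ^ 2 ≤ ∑ z, (√(P z) - √(Q z)) ^ 2 :=
    Finset.single_le_sum (f := fun z => (√(P z) - √(Q z)) ^ 2) (fun _ _ => sq_nonneg _)
      (Finset.mem_univ z)
  have hle : ∀ {R : Z → ℝ}, R ∈ stdSimplex ℝ Z → √(R z) ≤ 1 := by
    intro R hR
    refine Real.sqrt_le_one.2 ?_
    rw [← hR.2]
    exact Finset.single_le_sum (f := R) (fun _ _ => hR.1 _) (Finset.mem_univ z)
  have h4 := hle hP
  have h5 := hle hQ
  have e : (P z - Q z) ^ 2 = (√(P z) - √(Q z)) ^ 2 * (√(P z) + √(Q z)) ^ 2 := by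
    rw [← mul_pow]
    congr 1
    nlinarith [Real.sq_sqrt (hP.1 z), Real.sq_sqrt (hQ.1 z)]
  have h6 : (√(P z) + √(Q z)) ^ 2 ≤ 4 := by
    nlinarith [Real.sqrt_nonneg (P z), Real.sqrt_nonneg (Q z)]
  rw [e]
  nlinarith [mul_le_mul_of_nonneg_left h6 (sq_nonneg (√(P z) - √(Q z)))]

/-! ### Inputs that are rarely different from the zero symbol -/

section Activity

variable {U X Y : Type*} [Fintype U] [Fintype X] [Fintype Y]

/-- The probability that `U = u` and that the input is not the zero symbol. -/
def act (x₀ : X) (P : U × X → ℝ) (u : U) : ℝ := ∑ x, if x = x₀ then 0 else P (u, x)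

variable {x₀ : X} {P : U × X → ℝ}

omit [Fintype U] in
lemma act_nonneg (hP : ∀ t, 0 ≤ P t) (u : U) : 0 ≤ act x₀ P u :=
  Finset.sum_nonneg fun x _ => by split_ifs <;> simp [hP]

omit [Fintype U] in
lemma sum_eq_add_act (F : X → ℝ) (u : U) :
    ∑ x, P (u, x) * F x = P (u, x₀) * F x₀ + ∑ x, (if x = x₀ then 0 else P (u, x)) * F x := by
  have h : ∀ x, P (u, x) * F x = (if x = x₀ then P (u, x₀) * F x₀ else 0)
      + (if x = x₀ then 0 else P (u, x)) * F x := by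
    intro x
    by_cases hx : x = x₀ <;> simp [hx]
  rw [Finset.sum_congr rfl fun x _ => h x, Finset.sum_add_distrib]
  simp

omit [Fintype U] in
lemma sum_eq_add_act' (u : U) : ∑ x, P (u, x) = P (u, x₀) + act x₀ P u := by
  simpa [act] using sum_eq_add_act (x₀ := x₀) (P := P) (fun _ => 1) u

omit [Fintype U] in
lemma act_le (hP : ∀ t, 0 ≤ P t) (u : U) : act x₀ P u ≤ ∑ x, P (u, x) := by
  rw [sum_eq_add_act' (x₀ := x₀)]
  linarith [hP (u, x₀)]

omit [Fintype U] in
lemma le_act (hP : ∀ t, 0 ≤ P t) (u : U) {x : X} (hx : x ≠ x₀) : P (u, x) ≤ act x₀ P u := by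
  refine le_trans (by simp [hx]) (Finset.single_le_sum
    (f := fun x => if x = x₀ then 0 else P (u, x)) (fun x _ => ?_) (Finset.mem_univ x))
  split_ifs <;> simp [hP]

variable {W : X → Y → ℝ} {K : ℝ}

-- The zero symbol cancels from the difference, and each other symbol moves the output law by at
-- most `K * W x₀ y`.
omit [Fintype U] in
lemma abs_output_sub_le (hP : ∀ t, 0 ≤ P t) (hW : ∀ x, W x ∈ stdSimplex ℝ Y) (hK : 1 ≤ K)
    (hWK : ∀ x y, W x y ≤ K * W x₀ y) (u : U) (y : Y) :
    |∑ x, P (u, x) * W x y - (∑ x, P (u, x)) * W x₀ y| ≤ K * act x₀ P u * W x₀ y := by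
  rw [sum_eq_add_act (x₀ := x₀) (fun x => W x y), sum_eq_add_act' (x₀ := x₀)]
  have e : P (u, x₀) * W x₀ y + ∑ x, (if x = x₀ then 0 else P (u, x)) * W x y
      - (P (u, x₀) + act x₀ P u) * W x₀ y
      = ∑ x, (if x = x₀ then 0 else P (u, x)) * (W x y - W x₀ y) := by
    simp only [mul_sub, Finset.sum_sub_distrib, ← Finset.sum_mul, act]
    ring
  have e' : K * act x₀ P u * W x₀ y = ∑ x, (if x = x₀ then 0 else P (u, x)) * (K * W x₀ y) := by
    rw [← Finset.sum_mul, act]; ring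
  rw [e, e']
  refine (Finset.abs_sum_le_sum_abs _ _).trans (Finset.sum_le_sum fun x _ => ?_)
  have h0 : 0 ≤ if x = x₀ then 0 else P (u, x) := by split_ifs <;> simp [hP]
  rw [abs_mul, abs_of_nonneg h0]
  refine mul_le_mul_of_nonneg_left ?_ h0
  rw [abs_le]
  have h1 := (hW x).1 y
  have h2 := (hW x₀).1 y
  have h3 := hWK x y
  constructor <;> nlinarith

/-- The chi-square information between `U` and the output is of second order in the activity. -/
lemma chi_sq_le (hP : P ∈ stdSimplex ℝ (U × X)) (hW : ∀ x, W x ∈ stdSimplex ℝ Y) (hK : 1 ≤ K)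
    (hWK : ∀ x y, W x y ≤ K * W x₀ y) (hα : ∑ u, act x₀ P u ≤ 1 / 2) :
    ∑ u, ∑ y, (∑ x, P (u, x) * W x y - (∑ x, P (u, x)) * ∑ u', ∑ x, P (u', x) * W x y) ^ 2 /
        ((∑ x, P (u, x)) * ∑ u', ∑ x, P (u', x) * W x y)
      ≤ 4 * K ^ 2 * ∑ u, (act x₀ P u ^ 2 / (∑ x, P (u, x))
        + (∑ u, act x₀ P u) ^ 2 * ∑ x, P (u, x)) := by
  set α := ∑ u, act x₀ P u with hαdef
  have hα0 : 0 ≤ α := Finset.sum_nonneg fun u _ => act_nonneg hP.1 u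
  have hq1 : ∑ u, ∑ x, P (u, x) = 1 := by rw [← hP.2, Fintype.sum_prod_type]
  rw [Finset.mul_sum]
  refine Finset.sum_le_sum fun u _ => ?_
  have e : 4 * K ^ 2 * (act x₀ P u ^ 2 / (∑ x, P (u, x)) + α ^ 2 * ∑ x, P (u, x))
      = ∑ y, W x₀ y * (4 * K ^ 2 * (act x₀ P u ^ 2 / (∑ x, P (u, x)) + α ^ 2 * ∑ x, P (u, x))) := by
    rw [← Finset.sum_mul, (hW x₀).2, one_mul]
  rw [e]
  refine Finset.sum_le_sum fun y _ => ?_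
  have h1 := abs_output_sub_le hP.1 hW hK hWK u y
  have h2 : |∑ u', ∑ x, P (u', x) * W x y - W x₀ y| ≤ K * α * W x₀ y := by
    have e1 : ∑ u', ∑ x, P (u', x) * W x y - W x₀ y
        = ∑ u', (∑ x, P (u', x) * W x y - (∑ x, P (u', x)) * W x₀ y) := by
      rw [Finset.sum_sub_distrib, ← Finset.sum_mul, hq1, one_mul]
    rw [e1, hαdef, Finset.mul_sum, Finset.sum_mul]
    exact (Finset.abs_sum_le_sum_abs _ _).trans
      (Finset.sum_le_sum fun u' _ => abs_output_sub_le hP.1 hW hK hWK u' y)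
  -- The zero symbol has probability at least `1/2`, which keeps the denominator comparable to `W x₀
  -- y`.
  have h3 : W x₀ y / 2 ≤ ∑ u', ∑ x, P (u', x) * W x y := by
    have e1 : ∀ u', (∑ x, P (u', x) - act x₀ P u') * W x₀ y ≤ ∑ x, P (u', x) * W x y := by
      intro u'
      rw [sum_eq_add_act (x₀ := x₀) (fun x => W x y), sum_eq_add_act' (x₀ := x₀)]
      have : 0 ≤ ∑ x, (if x = x₀ then 0 else P (u', x)) * W x y :=
        Finset.sum_nonneg fun x _ => mul_nonneg (by split_ifs <;> simp [hP.1]) ((hW x).1 y)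
      linarith
    have e2 := Finset.sum_le_sum fun u' (_ : u' ∈ Finset.univ) => e1 u'
    rw [← Finset.sum_mul, Finset.sum_sub_distrib, hq1, ← hαdef] at e2
    nlinarith [(hW x₀).1 y]
  set q := ∑ x, P (u, x) with hq
  set r := ∑ u', ∑ x, P (u', x) * W x y with hr
  set s := ∑ x, P (u, x) * W x y with hs
  set w := W x₀ y with hw
  set a := act x₀ P u with ha
  have hq0 : 0 ≤ q := Finset.sum_nonneg fun x _ => hP.1 _
  have ha0 : 0 ≤ a := act_nonneg hP.1 u
  have haq : a ≤ q := act_le hP.1 u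
  have hw0 : 0 ≤ w := (hW x₀).1 y
  rcases hq0.eq_or_lt with h0 | hqpos
  · simp [← h0, le_antisymm (h0 ▸ haq) ha0]
  rcases hw0.eq_or_lt with h0 | hwpos
  · rw [← h0] at h1 h2 ⊢
    simp only [mul_zero, sub_zero, abs_nonpos_iff] at h1 h2
    simp [h1, h2]
  have hrpos : 0 < r := by linarith
  have h4 : |s - q * r| ≤ K * w * (a + α * q) := by
    have e1 : s - q * r = (s - q * w) - q * (r - w) := by ring
    rw [e1]
    refine (abs_sub _ _).trans ?_
    rw [abs_mul, abs_of_pos hqpos]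
    nlinarith [mul_le_mul_of_nonneg_left h2 hq0]
  have h5 : (s - q * r) ^ 2 ≤ (K * w * (a + α * q)) ^ 2 := sq_le_sq' (by linarith [abs_le.1 h4])
    (abs_le.1 h4).2
  rw [div_le_iff₀ (mul_pos hqpos hrpos)]
  have e2 : w * (4 * K ^ 2 * (a ^ 2 / q + α ^ 2 * q)) * (q * r)
      = 4 * K ^ 2 * w * (a ^ 2 + (α * q) ^ 2) * r := by field_simp
  rw [e2]
  have h6 : (a + α * q) ^ 2 ≤ 2 * (a ^ 2 + (α * q) ^ 2) := by nlinarith [sq_nonneg (a - α * q)]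
  calc (s - q * r) ^ 2 ≤ K ^ 2 * w ^ 2 * (a + α * q) ^ 2 := by linarith [h5]
    _ ≤ K ^ 2 * w ^ 2 * (2 * (a ^ 2 + (α * q) ^ 2)) := by gcongr
    _ = 4 * K ^ 2 * w * (a ^ 2 + (α * q) ^ 2) * (w / 2) := by ring
    _ ≤ _ := by gcongr

/-- The conditional chi-square information between the input and the output is at most of first
order in the activity. -/
lemma cond_chi_sq_le (hP : P ∈ stdSimplex ℝ (U × X)) (hW : ∀ x, W x ∈ stdSimplex ℝ Y)
    (hK : 1 ≤ K) (hWK : ∀ x y, W x y ≤ K * W x₀ y) :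
    ∑ u, ∑ x, ∑ y, (P (u, x) * W x y - P (u, x) * ((∑ x', P (u, x') * W x' y) /
        ∑ x', P (u, x'))) ^ 2 / (P (u, x) * ((∑ x', P (u, x') * W x' y) / ∑ x', P (u, x')))
      ≤ K * Fintype.card X * ∑ u, act x₀ P u := by
  rw [Finset.mul_sum]
  refine Finset.sum_le_sum fun u _ => ?_
  set q := ∑ x', P (u, x') with hq
  have hq0 : 0 ≤ q := Finset.sum_nonneg fun x _ => hP.1 _
  have ha0 : 0 ≤ act x₀ P u := act_nonneg hP.1 u
  have hxq : ∀ x, P (u, x) ≤ q := fun x =>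
    Finset.single_le_sum (f := fun x => P (u, x)) (fun x _ => hP.1 _) (Finset.mem_univ x)
  rcases hq0.eq_or_lt with h0 | hqpos
  · have : ∀ x, P (u, x) = 0 := fun x => le_antisymm (h0 ▸ hxq x) (hP.1 _)
    simp only [this]
    simp
    positivity
  set s := fun y => ∑ x', P (u, x') * W x' y with hs
  have hxs : ∀ x y, P (u, x) * W x y ≤ s y := fun x y =>
    Finset.single_le_sum (f := fun x => P (u, x) * W x y)
      (fun x _ => mul_nonneg (hP.1 _) ((hW x).1 y)) (Finset.mem_univ x)
  have hs0 : ∀ y, 0 ≤ s y := fun y =>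
    Finset.sum_nonneg fun x _ => mul_nonneg (hP.1 _) ((hW x).1 y)
  have hsum : ∑ y, s y = q := by
    rw [hs, Finset.sum_comm]
    simp only [← Finset.mul_sum, (hW _).2, mul_one, hq]
  -- After summation the zero symbol contributes `q`, the cross term `-2 q` and the last term `q`.
  -- These cancel and leave only the terms of first order in the activity.
  have hpt : ∀ x y, (P (u, x) * W x y - P (u, x) * (s y / q)) ^ 2 / (P (u, x) * (s y / q))
      ≤ (if x = x₀ then q * W x₀ y else 0) + K * act x₀ P u * W x y
        - 2 * (P (u, x) * W x y) + P (u, x) / q * s y := by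
    intro x y
    have hW0 := (hW x).1 y
    have hWx₀ := (hW x₀).1 y
    have hKa : 0 ≤ K * act x₀ P u * W x y := by positivity
    rcases (hP.1 (u, x)).eq_or_lt with h0 | hpx
    · rw [← h0]
      simp
      split_ifs <;> nlinarith [mul_nonneg hq0 hWx₀]
    rcases (hs0 y).eq_or_lt with h0 | hsy
    · have h1 : W x y = 0 := by
        have := hxs x y
        rw [← h0] at this
        nlinarith
      rw [← h0, h1]
      simp
      split_ifs <;> nlinarith [mul_nonneg hq0 hWx₀]
    have hb : 0 < P (u, x) * (s y / q) := mul_pos hpx (div_pos hsy hqpos)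
    have e : (P (u, x) * W x y - P (u, x) * (s y / q)) ^ 2 / (P (u, x) * (s y / q))
        = P (u, x) * W x y * q / s y * W x y - 2 * (P (u, x) * W x y) + P (u, x) / q * s y := by
      field_simp
      ring
    rw [e]
    -- For `x = x₀` it suffices that one summand is at most `s y`. For `x ≠ x₀`, `q` is split into
    -- `P (u, x₀)` plus the activity, and both parts are compared with the summands of `s y` at `x₀`
    -- and `x`.
    have key : P (u, x) * W x y * q / s y * W x y
        ≤ (if x = x₀ then q * W x₀ y else 0) + K * act x₀ P u * W x y := by
      by_cases hx : x = x₀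
      · subst hx
        rw [if_pos rfl]
        have : P (u, x) * W x y * q / s y ≤ q := by
          rw [div_le_iff₀ hsy]
          nlinarith [hxs x y]
        nlinarith
      · rw [if_neg hx, zero_add]
        refine mul_le_mul_of_nonneg_right ?_ hW0
        rw [div_le_iff₀ hsy]
        have h1 : P (u, x₀) * W x₀ y + P (u, x) * W x y ≤ s y := by
          rw [hs]
          simp only
          rw [sum_eq_add_act (x₀ := x₀) (fun x => W x y)]
          have h2 := Finset.single_le_sum
            (f := fun x => (if x = x₀ then 0 else P (u, x)) * W x y)
            (fun x _ => mul_nonneg (by split_ifs <;> simp [hP.1]) ((hW x).1 y))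
            (Finset.mem_univ x)
          simp only [if_neg hx] at h2
          linarith
        have h2 : q = P (u, x₀) + act x₀ P u := sum_eq_add_act' u
        have h3 : P (u, x) ≤ act x₀ P u := le_act hP.1 u hx
        have h4 := hWK x y
        have h5 := hP.1 (u, x₀)
        calc P (u, x) * W x y * q
            = P (u, x) * (P (u, x₀) * W x y) + act x₀ P u * (P (u, x) * W x y) := by
              rw [h2]; ring
          _ ≤ act x₀ P u * (P (u, x₀) * (K * W x₀ y))
              + K * (act x₀ P u * (P (u, x) * W x y)) := by
              refine add_le_add ?_ (le_mul_of_one_le_left (by positivity) hK)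
              gcongr
          _ = K * act x₀ P u * (P (u, x₀) * W x₀ y + P (u, x) * W x y) := by ring
          _ ≤ K * act x₀ P u * s y := by gcongr
    linarith
  refine (Finset.sum_le_sum fun x _ => Finset.sum_le_sum fun y _ => hpt x y).trans ?_
  simp only [Finset.sum_add_distrib, Finset.sum_sub_distrib, ← Finset.mul_sum, (hW _).2, hsum,
    mul_one]
  have e1 : ∑ x, ∑ y, (if x = x₀ then q * W x₀ y else 0) = q := by
    rw [Finset.sum_comm]
    simp [← Finset.mul_sum, (hW x₀).2]
  have e2 : ∑ x, P (u, x) / q * q = q := by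
    simp only [div_mul_cancel₀ _ hqpos.ne']
    exact hq.symm
  rw [e1, e2, ← hq]
  simp
  linarith

end Activity

/-! ### Moments and informations in terms of the activity -/

namespace WardenBC

lemma exists_ratio_bound {X Y : Type*} [Fintype X] [Fintype Y] {W : X → Y → ℝ} (x₀ : X)
    (hW : ∀ x y, 0 ≤ W x y) (hac : ∀ x y, W x₀ y = 0 → W x y = 0) :
    ∃ K : ℝ, 1 ≤ K ∧ ∀ x y, W x y ≤ K * W x₀ y := by
  have hr : ∀ x y, 0 ≤ W x y / W x₀ y := fun x y => div_nonneg (hW _ _) (hW _ _)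
  refine ⟨1 + ∑ x, ∑ y, W x y / W x₀ y, ?_, fun x y => ?_⟩
  · have : 0 ≤ ∑ x, ∑ y, W x y / W x₀ y :=
      Finset.sum_nonneg fun x _ => Finset.sum_nonneg fun y _ => hr x y
    linarith
  · rcases (hW x₀ y).eq_or_lt with h0 | h0
    · rw [hac x y h0.symm, ← h0, mul_zero]
    · have h1 : W x y / W x₀ y ≤ ∑ y, W x y / W x₀ y :=
        Finset.single_le_sum (f := fun y => W x y / W x₀ y) (fun y _ => hr x y)
          (Finset.mem_univ y)
      have h2 : ∑ y, W x y / W x₀ y ≤ ∑ x, ∑ y, W x y / W x₀ y :=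
        Finset.single_le_sum (f := fun x => ∑ y, W x y / W x₀ y)
          (fun x _ => Finset.sum_nonneg fun y _ => hr x y) (Finset.mem_univ x)
      rw [← div_le_iff₀ h0]
      linarith

variable {U X Y₁ Y₂ Z : Type*} [Fintype U] [Fintype X] [Fintype Y₁] [Fintype Y₂] [Fintype Z]
  {C : WardenBC X Y₁ Y₂ Z} {P : U × X → ℝ} {K : ℝ}

lemma law₂_eq_zero_of_mul_eq_zero (hP : P ∈ stdSimplex ℝ (U × X)) (u : U) (y : Y₂)
    (h : (∑ x, P (u, x)) * ∑ u', C.law₂ P (u', y) = 0) : C.law₂ P (u, y) = 0 := by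
  have hL := law₂_mem (C := C) hP
  rcases mul_eq_zero.1 h with h | h
  · rw [← sum_law₂_right (C := C)] at h
    exact (Finset.sum_eq_zero_iff_of_nonneg fun _ _ => hL.1 _).1 h y (Finset.mem_univ y)
  · exact (Finset.sum_eq_zero_iff_of_nonneg fun _ _ => hL.1 _).1 h u (Finset.mem_univ u)

/-- The chi-square bound is weakened by `act² / P_U ≤ act` and `α² ≤ α`. This loses an order when
the centres are likely, but removes all dependence on `U`, which may vary with `n`. -/
lemma secondMoment₂_le (hP : P ∈ stdSimplex ℝ (U × X)) (hK : 1 ≤ K)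
    (hWK : ∀ x y, C.W₂ x y ≤ K * C.W₂ C.x₀ y) (hα : ∑ u, act C.x₀ P u ≤ 1 / 2) :
    ∑ s, C.law₂ P s * C.dens₂ P s ^ 2
      ≤ 4 / Real.log 2 ^ 2 * (8 * K ^ 2) * ∑ u, act C.x₀ P u := by
  have hL := law₂_mem (C := C) hP
  have h1 := chi_sq_le hP C.W₂_mem hK hWK hα
  have hα0 : 0 ≤ ∑ u, act C.x₀ P u := Finset.sum_nonneg fun u _ => act_nonneg hP.1 u
  have h2 : ∑ u, (act C.x₀ P u ^ 2 / (∑ x, P (u, x)) + (∑ u, act C.x₀ P u) ^ 2 * ∑ x, P (u, x))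
      ≤ 2 * ∑ u, act C.x₀ P u := by
    rw [Finset.sum_add_distrib, ← Finset.mul_sum, ← Fintype.sum_prod_type', hP.2, mul_one]
    have h3 : ∑ u, act C.x₀ P u ^ 2 / (∑ x, P (u, x)) ≤ ∑ u, act C.x₀ P u := by
      refine Finset.sum_le_sum fun u _ => ?_
      have ha := act_nonneg (x₀ := C.x₀) hP.1 u
      exact div_le_of_le_mul₀ (Finset.sum_nonneg fun _ _ => hP.1 _) ha
        (by nlinarith [act_le (x₀ := C.x₀) hP.1 u])
    nlinarith
  calc ∑ s, C.law₂ P s * C.dens₂ P s ^ 2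
      ≤ ∑ u, ∑ y, 4 / Real.log 2 ^ 2 * ((∑ x, P (u, x) * C.W₂ x y - (∑ x, P (u, x)) *
          ∑ u', ∑ x, P (u', x) * C.W₂ x y) ^ 2 /
          ((∑ x, P (u, x)) * ∑ u', ∑ x, P (u', x) * C.W₂ x y)) := by
        rw [Fintype.sum_prod_type]
        refine Finset.sum_le_sum fun u _ => Finset.sum_le_sum fun y _ => ?_
        exact mul_logb_sq_le (hL.1 _) (mul_nonneg (Finset.sum_nonneg fun _ _ => hP.1 _)
          (Finset.sum_nonneg fun _ _ => hL.1 _)) (law₂_eq_zero_of_mul_eq_zero hP u y)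
    _ ≤ 4 / Real.log 2 ^ 2 * (4 * K ^ 2 * (2 * ∑ u, act C.x₀ P u)) := by
        simp only [← Finset.mul_sum]
        refine mul_le_mul_of_nonneg_left (h1.trans ?_) (by positivity)
        exact mul_le_mul_of_nonneg_left h2 (by positivity)
    _ = _ := by ring

/-- From `log x ≤ x - 1`; the linear terms cancel because joint law and product law both have mass
one. The quadratic form in the activity is kept, as the statement on vanishing centres depends on
it. -/
lemma infoU2_le_chi (hP : P ∈ stdSimplex ℝ (U × X)) (hK : 1 ≤ K)
    (hWK : ∀ x y, C.W₂ x y ≤ K * C.W₂ C.x₀ y) (hα : ∑ u, act C.x₀ P u ≤ 1 / 2) :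
    C.infoU2 P ≤ 4 * K ^ 2 / Real.log 2 * ∑ u, (act C.x₀ P u ^ 2 / (∑ x, P (u, x))
        + (∑ u, act C.x₀ P u) ^ 2 * ∑ x, P (u, x)) := by
  have hL := law₂_mem (C := C) hP
  have h2 : 0 < Real.log 2 := Real.log_pos one_lt_two
  have h1 := chi_sq_le hP C.W₂_mem hK hWK hα
  have hq1 : ∑ u, ∑ x, P (u, x) = 1 := by rw [← hP.2, Fintype.sum_prod_type]
  have hL1 : ∑ u, ∑ y, C.law₂ P (u, y) = 1 := by rw [← hL.2, Fintype.sum_prod_type]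
  rw [infoU2_eq, Fintype.sum_prod_type]
  refine (Finset.sum_le_sum fun u _ => Finset.sum_le_sum fun y _ =>
    mul_logb_le_chi (hL.1 (u, y)) (mul_nonneg (Finset.sum_nonneg fun x _ => hP.1 (u, x))
    (Finset.sum_nonneg fun u' _ => hL.1 (u', y))) (law₂_eq_zero_of_mul_eq_zero hP u y)).trans ?_
  simp only [← Finset.sum_div, Finset.sum_add_distrib, Finset.sum_sub_distrib, ← Finset.mul_sum,
    hL1]
  rw [Finset.sum_comm (f := fun y u => C.law₂ P (u, y)), hL1, ← Finset.sum_mul, hq1,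
    div_mul_eq_mul_div]
  refine div_le_div_of_nonneg_right ?_ h2.le
  have h3 : ∀ u y, ∑ x, P (u, x) * C.W₂ x y = C.law₂ P (u, y) := fun _ _ => rfl
  simp only [h3] at h1
  simp only [Finset.sum_add_distrib, ← Finset.mul_sum, hq1] at h1 ⊢
  linarith

lemma secondMoment₁_le (hP : P ∈ stdSimplex ℝ (U × X)) (hK : 1 ≤ K)
    (hWK : ∀ x y, C.W₁ x y ≤ K * C.W₁ C.x₀ y) :
    ∑ s, C.law₁ P s * C.dens₁ P s ^ 2
      ≤ 4 / Real.log 2 ^ 2 * (K * Fintype.card X) * ∑ u, act C.x₀ P u := by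
  have h1 := cond_chi_sq_le hP C.W₁_mem hK hWK
  rw [mul_assoc]
  refine le_trans ?_ (mul_le_mul_of_nonneg_left h1 (by positivity))
  simp only [Fintype.sum_prod_type, Finset.mul_sum]
  refine Finset.sum_le_sum fun u _ => Finset.sum_le_sum fun x _ => Finset.sum_le_sum fun y _ => ?_
  rcases (hP.1 (u, x)).eq_or_lt with h0 | h0
  · simp [law₁, ← h0]
  set q := ∑ x', P (u, x') with hq
  set s := ∑ x', P (u, x') * C.W₁ x' y with hs
  have hqx : P (u, x) ≤ q := Finset.single_le_sum (f := fun x => P (u, x))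
    (fun x _ => hP.1 _) (Finset.mem_univ x)
  have hqpos : 0 < q := h0.trans_le hqx
  have hs0 : 0 ≤ s := Finset.sum_nonneg fun x _ => mul_nonneg (hP.1 _) ((C.W₁_mem x).1 y)
  have hsx : P (u, x) * C.W₁ x y ≤ s := Finset.single_le_sum
    (f := fun x => P (u, x) * C.W₁ x y)
    (fun x _ => mul_nonneg (hP.1 _) ((C.W₁_mem x).1 y)) (Finset.mem_univ x)
  have hW0 := (C.W₁_mem x).1 y
  have h2 := mul_logb_sq_le (a := P (u, x) * C.W₁ x y) (b := P (u, x) * (s / q))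
    (by positivity) (by positivity) (fun h => by
      have h3 : s = 0 := by
        rcases mul_eq_zero.1 h with h | h
        · exact absurd h h0.ne'
        · exact (div_eq_zero_iff.1 h).resolve_right hqpos.ne'
      nlinarith [mul_nonneg h0.le hW0])
  have h3 : P (u, x) * C.W₁ x y / (P (u, x) * (s / q)) = C.W₁ x y * q / s := by
    rw [mul_div_mul_left _ _ h0.ne', div_div_eq_mul_div]
  rw [h3] at h2
  exact h2

/-- A small divergence at the warden forces the input to be the zero symbol most of the time. -/
lemma exists_act_sq_le (hC : C.NonredundantAbsCont) :
    ∃ c : ℝ, 0 < c ∧ ∀ (U : Type*) [Fintype U] (P : U × X → ℝ) (η : ℝ),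
      P ∈ stdSimplex ℝ (U × X) → klDivBits (C.outZ P) C.Q₀ ≤ (η : EReal) →
      (∑ u, act C.x₀ P u) ^ 2 ≤ c * η := by
  -- The hull of finitely many points is compact, so `Q₀` lies at a positive distance `r` from it.
  have hclosed : IsClosed (convexHull ℝ (C.WZ '' {x | x ≠ C.x₀})) :=
    ((Set.toFinite _).isCompact_convexHull (𝕜 := ℝ)).isClosed
  obtain ⟨r, hr, hball⟩ := Metric.isOpen_iff.1 hclosed.isOpen_compl _ hC.not_redundant
  have hlog : 0 < Real.log 2 := Real.log_pos one_lt_two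
  refine ⟨4 * Real.log 2 / r ^ 2, by positivity, fun U _ P η hP hD => ?_⟩
  rw [klDivBits_le_coe_iff] at hD
  set α := ∑ u, act C.x₀ P u with hα
  have hα0 : 0 ≤ α := Finset.sum_nonneg fun u _ => act_nonneg hP.1 u
  have hP1 : ∑ u, ∑ x, P (u, x) = 1 := by rw [← hP.2, Fintype.sum_prod_type]
  have hmem : C.outZ P ∈ stdSimplex ℝ Z := by
    refine ⟨fun z => Finset.sum_nonneg fun _ _ =>
      Finset.sum_nonneg fun _ _ => mul_nonneg (hP.1 _) ((C.WZ_mem _).1 _), ?_⟩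
    simp only [outZ]
    rw [Finset.sum_comm, ← hP1]
    refine Finset.sum_congr rfl fun u _ => ?_
    rw [Finset.sum_comm]
    simp only [← Finset.mul_sum, (C.WZ_mem _).2, mul_one]
  have hell := sq_sub_le_klDiv hmem (C.WZ_mem C.x₀) hD.1
  -- When `α = 0` the nonzero symbols cannot be normalized to a law; only `0 ≤ η` is needed.
  rcases hα0.eq_or_lt with h0 | hαpos
  · obtain ⟨z⟩ : Nonempty Z := by
      by_contra h
      rw [not_nonempty_iff] at h
      have := hmem.2
      simp at this
    have h1 := (sq_nonneg _).trans (hell z)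
    have h2 : 0 ≤ ∑ z, C.outZ P z * Real.logb 2 (C.outZ P z / C.WZ C.x₀ z) := by
      by_contra hneg
      push Not at hneg
      nlinarith
    rw [← h0]
    have h3 : 0 ≤ η := h2.trans hD.2
    simp
    positivity
  -- the law of the nonzero input symbols
  set w : X → ℝ := fun x => (∑ u, if x = C.x₀ then 0 else P (u, x)) / α with hw
  have hw0 : ∀ x, 0 ≤ w x := fun x => div_nonneg
    (Finset.sum_nonneg fun u _ => by split_ifs <;> simp [hP.1]) hα0
  have hw1 : ∑ x, w x = 1 := by
    rw [hw, ← Finset.sum_div, Finset.sum_comm]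
    exact div_self hαpos.ne'
  have hwx₀ : w C.x₀ = 0 := by simp [hw]
  set R : Z → ℝ := ∑ x, w x • C.WZ x with hR
  have hRmem : R ∈ convexHull ℝ (C.WZ '' {x | x ≠ C.x₀}) := by
    have h1 : R = ∑ x ∈ Finset.univ.erase C.x₀, w x • C.WZ x := by
      rw [hR, ← Finset.add_sum_erase _ _ (Finset.mem_univ C.x₀), hwx₀, zero_smul, zero_add]
    rw [h1]
    refine (convex_convexHull ℝ _).sum_mem (fun x _ => hw0 x) ?_ (fun x hx => ?_)
    · rw [← hw1, ← Finset.add_sum_erase _ _ (Finset.mem_univ C.x₀), hwx₀, zero_add]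
    · exact subset_convexHull ℝ _ ⟨x, Finset.ne_of_mem_erase hx, rfl⟩
  have hdist : r ≤ dist R C.Q₀ := by
    by_contra h
    push Not at h
    exact hball h hRmem
  -- The warden's law is the mixture `(1 - α) Q₀ + α R` with `R` in the hull, so some coordinate
  -- moves by at least `α r`.
  have hout : ∀ z, C.outZ P z - C.Q₀ z = α * (R z - C.Q₀ z) := by
    intro z
    have h1 : C.outZ P z = ∑ u, (P (u, C.x₀) * C.WZ C.x₀ z
        + ∑ x, (if x = C.x₀ then 0 else P (u, x)) * C.WZ x z) :=
      Finset.sum_congr rfl fun u _ => sum_eq_add_act (fun x => C.WZ x z) u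
    have h2 : α * R z = ∑ u, ∑ x, (if x = C.x₀ then 0 else P (u, x)) * C.WZ x z := by
      rw [hR, Finset.sum_apply, Finset.mul_sum, Finset.sum_comm]
      refine Finset.sum_congr rfl fun x _ => ?_
      rw [← Finset.sum_mul, Pi.smul_apply, smul_eq_mul, hw]
      field_simp
    have h3 : ∑ u, P (u, C.x₀) = 1 - α := by
      rw [← hP1, hα, ← Finset.sum_sub_distrib]
      refine Finset.sum_congr rfl fun u _ => ?_
      rw [sum_eq_add_act' (x₀ := C.x₀)]
      ring
    rw [h1, Finset.sum_add_distrib, ← Finset.sum_mul, h3, mul_sub, h2, Q₀]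
    ring
  obtain ⟨z, hz⟩ : ∃ z, r ≤ |R z - C.Q₀ z| := by
    by_contra h
    push Not at h
    refine absurd hdist (not_le.2 ((dist_pi_lt_iff hr).2 fun z => ?_))
    rw [Real.dist_eq]
    exact h z
  have h1 := hell z
  have h2 : (α * r) ^ 2 ≤ (C.outZ P z - C.Q₀ z) ^ 2 := by
    rw [hout, ← sq_abs (α * (R z - C.Q₀ z)), abs_mul, abs_of_pos hαpos]
    gcongr
  have h3 : (α * r) ^ 2 ≤ 4 * Real.log 2 * η :=
    (h2.trans h1).trans (mul_le_mul_of_nonneg_left hD.2 (by positivity))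
  rw [div_mul_eq_mul_div, le_div_iff₀ (by positivity)]
  linarith

end WardenBC

/-! ### The two inclusions and the vanishing centres -/

namespace WardenBC

variable {X Y₁ Y₂ Z : Type*} [Fintype X] [Fintype Y₁] [Fintype Y₂] [Fintype Z]
  {C : WardenBC X Y₁ Y₂ Z} {δ : ℝ}

omit [Fintype X] in
lemma sqrt_div_mul_sqrt_mul (hδ : 0 < δ) (n : ℕ) : √(n / δ) * √(n * δ) = n := by
  rw [← Real.sqrt_mul (by positivity)]
  have : (n : ℝ) / δ * (n * δ) = n ^ 2 := by field_simp
  rw [this, Real.sqrt_sq (Nat.cast_nonneg n)]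

lemma tendsto_sqrt_mul_atTop (hδ : 0 < δ) : Tendsto (fun n : ℕ => √(n * δ)) atTop atTop :=
  Real.tendsto_sqrt_atTop.comp (tendsto_natCast_atTop_atTop.atTop_mul_const hδ)

/-- Keeping silent satisfies every divergence constraint. -/
lemma zero_mem_infoRegionAt (hδ : 0 < δ) (n : ℕ) : (0 : ℝ × ℝ) ∈ C.infoRegionAt δ n := by
  set P : Unit × X → ℝ := fun t => if t.2 = C.x₀ then 1 else 0 with hPdef
  have hP : P ∈ stdSimplex ℝ (Unit × X) := by
    refine ⟨fun t => ?_, ?_⟩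
    · rw [hPdef]; dsimp only; split_ifs <;> norm_num
    · rw [Fintype.sum_prod_type]
      simp [hPdef]
  have hout : C.outZ P = C.Q₀ := by
    funext z
    simp [outZ, hPdef, Q₀]
  have h1 : C.infoX1 P = 0 := by
    rw [infoX1_eq]
    refine Finset.sum_eq_zero fun t _ => ?_
    by_cases ht : t.2.1 = C.x₀
    · by_cases h0 : C.W₁ C.x₀ t.2.2 = 0
      · simp [law₁, ht, h0]
      · simp [dens₁, hPdef, ht, div_self h0]
    · simp [law₁, hPdef, ht]
  have h2 : C.infoU2 P = 0 := by
    rw [infoU2_eq]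
    refine Finset.sum_eq_zero fun t _ => ?_
    by_cases h0 : C.W₂ C.x₀ t.2 = 0
    · simp [law₂, hPdef, h0]
    · simp [dens₂, law₂, hPdef, div_self h0]
  refine ⟨le_refl _, le_refl _, Unit, inferInstance, P, hP, ?_, ?_, ?_⟩
  · rw [klDivBits_le_coe_iff, hout]
    refine ⟨fun a h => h, le_trans (le_of_eq ?_) (by positivity)⟩
    refine Finset.sum_eq_zero fun z _ => ?_
    by_cases h0 : C.Q₀ z = 0
    · simp [h0]
    · simp [div_self h0]
  · simp [h1]
  · simp [h2]

lemma logb_ceil_ge (a : ℝ) : a ≤ Real.logb 2 ⌈(2 : ℝ) ^ a⌉₊ := by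
  have h : (0 : ℝ) < 2 ^ a := by positivity
  rw [Real.le_logb_iff_rpow_le one_lt_two (h.trans_le (Nat.le_ceil _))]
  exact Nat.le_ceil _

/-- The loss in the converse: Fano's correction and the slack in the rate vanish. -/
lemma max_sub_le_of_fano (hδ : 0 < δ) {n : ℕ} (hn : 0 < n) {ε ρ η L I ℓ : ℝ} (hε1 : ε ≤ 1)
    (hε : 0 ≤ ε) (hρ : 0 ≤ ρ) (hI : 0 ≤ I) (hℓ : √(n * δ) * (L - ρ) ≤ ℓ)
    (hfano : (1 - ε) * ℓ - 1 ≤ n * I) (hη : ε * L + ρ + 1 / √(n * δ) ≤ η) :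
    max (L - η) 0 ≤ √(n / δ) * I := by
  refine max_le ?_ (by positivity)
  have hr : 0 < √(n * δ) := Real.sqrt_pos.2 (by positivity)
  have h1 : √(n / δ) * I = n * I / √(n * δ) := by
    rw [eq_div_iff hr.ne', mul_right_comm, sqrt_div_mul_sqrt_mul hδ]
  rw [h1, le_div_iff₀ hr]
  have h2 := mul_le_mul_of_nonneg_left hℓ (sub_nonneg.2 hε1)
  have h3 := mul_le_mul_of_nonneg_right hη hr.le
  have h4 : (ε * L + ρ + 1 / √(n * δ)) * √(n * δ) = (ε * L + ρ) * √(n * δ) + 1 := by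
    field_simp
  have h5 : 0 ≤ ε * ρ * √(n * δ) := by positivity
  nlinarith

/-- For each `η > 0` the pair lowered by `η` and truncated at zero eventually lies in the `n`-th
region. Distances to the regions thus tend to zero, and near-minimizers form the required sequence.
-/
lemma covertCapacityRegion_subset (hdeg : C.Degraded) (hδ : 0 < δ) :
    C.covertCapacityRegion δ ⊆ C.infoRegion δ := by
  obtain ⟨V, hV, hVW⟩ := hdeg
  rintro ⟨L₁, L₂⟩ ⟨hL₁, hL₂, hach⟩
  simp only at hL₁ hL₂ hach
  have hmem : ∀ η > 0, ∀ᶠ n : ℕ in atTop,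
      (max (L₁ - η) 0, max (L₂ - η) 0) ∈ C.infoRegionAt δ n := by
    intro η hη
    -- The loss `η` covers three shares of `η / 4`: `ε L`, the rate slack `ρ`, and Fano's one bit
    -- over `√(n δ)`.
    set ε : ℝ := min 1 (η / (4 * (L₁ + L₂ + 1))) with hε
    have hεpos : 0 < ε := lt_min one_pos (by positivity)
    have hε1 : ε ≤ 1 := min_le_left _ _
    have hεL : ε * (L₁ + L₂ + 1) ≤ η / 4 := by
      have h1 : ε ≤ η / (4 * (L₁ + L₂ + 1)) := min_le_right _ _
      rw [le_div_iff₀ (by positivity)] at h1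
      linarith
    have hsmall : ∀ᶠ n : ℕ in atTop, 4 / η ≤ √(n * δ) :=
      (tendsto_sqrt_mul_atTop hδ).eventually_ge_atTop _
    filter_upwards [hach ε hεpos (η / 4) (by positivity), hsmall, eventually_gt_atTop 0]
      with n hcode hlarge hn
    obtain ⟨c, hc⟩ := hcode
    have hpos : ∀ a : ℝ, 0 < ⌈(2 : ℝ) ^ a⌉₊ := fun a => Nat.ceil_pos.2 (by positivity)
    obtain ⟨U, _, P, hP, hD, h0₁, h0₂, hf₁, hf₂⟩ :=
      exists_law_of_code hV hVW hn.ne' (hpos _) (hpos _) c hc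
    have hr : 1 / √(n * δ) ≤ η / 4 := by
      have h4 : 0 < 4 / η := by positivity
      rw [div_le_iff₀ (h4.trans_le hlarge)]
      rw [div_le_iff₀ hη] at hlarge
      linarith
    refine ⟨le_max_right _ _, le_max_right _ _, U, inferInstance, P, hP, hD, ?_, ?_⟩
    · refine max_sub_le_of_fano hδ hn hε1 hεpos.le (by positivity) h0₁ (logb_ceil_ge _) hf₁ ?_
      nlinarith
    · refine max_sub_le_of_fano hδ hn hε1 hεpos.le (by positivity) h0₂ (logb_ceil_ge _) hf₂ ?_
      nlinarith
  have hdist : Tendsto (fun n : ℕ => Metric.infDist (L₁, L₂) (C.infoRegionAt δ n)) atTop (𝓝 0) := by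
    rw [Metric.tendsto_atTop']
    intro η hη
    obtain ⟨N, hN⟩ := eventually_atTop.1 (hmem (η / 2) (by positivity))
    refine ⟨N, fun n hn => ?_⟩
    rw [Real.dist_eq, sub_zero, abs_of_nonneg Metric.infDist_nonneg]
    refine (Metric.infDist_le_dist_of_mem (hN n hn.le)).trans_lt ?_
    have h1 : ∀ L : ℝ, 0 ≤ L → |L - max (L - η / 2) 0| ≤ η / 2 := by
      intro L hL
      rw [abs_le]
      rcases max_cases (L - η / 2) 0 with h | h <;> constructor <;> linarith
    rw [Prod.dist_eq, max_lt_iff, Real.dist_eq, Real.dist_eq]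
    constructor <;> linarith [h1 L₁ hL₁, h1 L₂ hL₂]
  have hex : ∀ n : ℕ, ∃ ℓ ∈ C.infoRegionAt δ n, dist (L₁, L₂) ℓ
      < Metric.infDist (L₁, L₂) (C.infoRegionAt δ n) + 1 / ((n : ℝ) + 1) := fun n =>
    (Metric.infDist_lt_iff ⟨0, zero_mem_infoRegionAt hδ n⟩).1
      (lt_add_of_pos_right _ Nat.one_div_pos_of_nat)
  choose ℓ hℓ hℓd using hex
  refine ⟨ℓ, fun n _ => hℓ n, ?_⟩
  rw [tendsto_iff_dist_tendsto_zero]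
  refine squeeze_zero (fun _ => dist_nonneg) (fun n => ?_)
    (by simpa using hdist.add (tendsto_one_div_add_atTop_nhds_zero_nat (𝕜 := ℝ)))
  rw [dist_comm, ← one_div]
  exact (hℓd n).le

/-- Only the competing messages are counted, and `⌈2 ^ a⌉₊ - 1 < 2 ^ a`, so rounding up costs
nothing in the union bound, even for negative `a`. -/
lemma ceil_sub_one_div_le {a b : ℝ} : ((⌈(2 : ℝ) ^ a⌉₊ : ℝ) - 1) / 2 ^ (a + b) ≤ 2 ^ (-b) := by
  have h0 : (0 : ℝ) < 2 ^ a := by positivity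
  have h1 := Nat.ceil_lt_add_one h0.le
  rw [div_le_iff₀ (by positivity), ← Real.rpow_add two_pos]
  have : -b + (a + b) = a := by ring
  rw [this]
  linarith

lemma infoRegion_subset (hC : C.NonredundantAbsCont) (hdeg : C.Degraded) (hδ : 0 < δ) :
    C.infoRegion δ ⊆ C.covertCapacityRegion δ := by
  obtain ⟨V, hV, hVW⟩ := hdeg
  obtain ⟨K₁, hK₁, hWK₁⟩ := exists_ratio_bound C.x₀ (fun x y => (C.W₁_mem x).1 y) hC.ac_user₁
  obtain ⟨K₂, hK₂, hWK₂⟩ := exists_ratio_bound C.x₀ (fun x y => (C.W₂_mem x).1 y) hC.ac_user₂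
  obtain ⟨c, hc, hact⟩ := exists_act_sq_le hC
  rintro ⟨L₁, L₂⟩ ⟨ℓ, hℓ, hlim⟩
  have hlim₁ : Tendsto (fun n => (ℓ n).1) atTop (𝓝 L₁) := (continuous_fst.tendsto _).comp hlim
  have hlim₂ : Tendsto (fun n => (ℓ n).2) atTop (𝓝 L₂) := (continuous_snd.tendsto _).comp hlim
  refine ⟨ge_of_tendsto hlim₁ ?_, ge_of_tendsto hlim₂ ?_, fun ε hε ρ hρ => ?_⟩
  · filter_upwards [eventually_ge_atTop 1] with n hn using (hℓ n hn).1
  · filter_upwards [eventually_ge_atTop 1] with n hn using (hℓ n hn).2.1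
  set B : ℝ := 4 / Real.log 2 ^ 2 * (8 * K₂ ^ 2) + 4 / Real.log 2 ^ 2 * (K₁ * Fintype.card X)
    with hB
  have hB0 : 0 ≤ B := by positivity
  have hα : Tendsto (fun n : ℕ => √(c * (δ / n))) atTop (𝓝 0) := by
    have h1 : Tendsto (fun n : ℕ => c * (δ / n)) atTop (𝓝 0) := by
      simpa using (tendsto_const_div_atTop_nhds_zero_nat δ).const_mul c
    simpa using h1.sqrt
  have hexp : Tendsto (fun n : ℕ => (2 : ℝ) ^ (-(√(n * δ) * ρ / 4))) atTop (𝓝 0) := by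
    have h1 : Tendsto (fun n : ℕ => √(n * δ) * (ρ / 4)) atTop atTop :=
      (tendsto_sqrt_mul_atTop hδ).atTop_mul_const (by positivity)
    have h2 := (tendsto_rpow_atTop_of_base_lt_one (1 / 2 : ℝ) (by norm_num) (by norm_num)).comp h1
    refine h2.congr fun n => ?_
    simp only [Function.comp_apply]
    rw [one_div, Real.inv_rpow two_pos.le, ← Real.rpow_neg two_pos.le, mul_div_assoc]
  have herr : Tendsto (fun n : ℕ => B * √(c * (δ / n)) * (16 / (δ * ρ ^ 2))
      + 2 * (2 : ℝ) ^ (-(√(n * δ) * ρ / 4))) atTop (𝓝 0) := by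
    simpa using ((hα.const_mul B).mul_const (16 / (δ * ρ ^ 2))).add (hexp.const_mul 2)
  filter_upwards [eventually_gt_atTop 0, hlim₁.eventually_const_le (show L₁ - ρ / 2 < L₁ by linarith),
    hlim₂.eventually_const_le (show L₂ - ρ / 2 < L₂ by linarith),
    hα.eventually_le_const (show (0 : ℝ) < 1 / 2 by norm_num), herr.eventually_le_const hε]
    with n hn hn₁ hn₂ hαn herrn
  obtain ⟨-, -, U, _, P, hP, hD, hI₁, hI₂⟩ := hℓ n hn
  have hnpos : (0 : ℝ) < n := by exact_mod_cast hn
  have hr : 0 < √(n * δ) := Real.sqrt_pos.2 (by positivity)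
  have hα0 : 0 ≤ ∑ u, act C.x₀ P u := Finset.sum_nonneg fun u _ => act_nonneg hP.1 u
  have hαle : ∑ u, act C.x₀ P u ≤ √(c * (δ / n)) := by
    rw [Real.le_sqrt hα0 (by positivity)]
    exact hact U P _ hP hD
  -- Of the slack `ρ`, half covers the convergence of `ℓ`, a quarter separates the threshold from
  -- the message length, and a quarter is the Chebyshev deviation.
  have hrate : ∀ {L ℓ I : ℝ}, L - ρ / 2 ≤ ℓ → ℓ ≤ √(n / δ) * I →
      √(n * δ) * (L - ρ) + √(n * δ) * ρ / 4 + √(n * δ) * ρ / 4 ≤ n * I := by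
    intro L ℓ I h1 h2
    have h3 := mul_le_mul_of_nonneg_left (h1.trans h2) hr.le
    have h4 : √(n * δ) * (√(n / δ) * I) = n * I := by
      rw [← mul_assoc, mul_comm (√(n * δ)), sqrt_div_mul_sqrt_mul hδ]
    rw [h4] at h3
    linarith
  have hpos : ∀ a : ℝ, 0 < ⌈(2 : ℝ) ^ a⌉₊ := fun a => Nat.ceil_pos.2 (by positivity)
  have hm₁ := secondMoment₁_le hP hK₁ hWK₁
  have hm₂ := secondMoment₂_le hP hK₂ hWK₂ (hαle.trans hαn)
  refine exists_code_of_law hV hVW hn.ne' (hpos _) (hpos _) hP hD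
    (t := √(n * δ) * ρ / 4) (by positivity) (hrate hn₁ hI₁) (hrate hn₂ hI₂) (le_trans ?_ herrn)
  have h1 := ceil_sub_one_div_le (a := √(n * δ) * (L₁ - ρ)) (b := √(n * δ) * ρ / 4)
  have h2 := ceil_sub_one_div_le (a := √(n * δ) * (L₂ - ρ)) (b := √(n * δ) * ρ / 4)
  have h3 : ∀ m : ℝ, n * m / (√(n * δ) * ρ / 4) ^ 2 = m * (16 / (δ * ρ ^ 2)) := by
    intro m
    rw [div_pow, mul_pow, Real.sq_sqrt (by positivity)]
    field_simp
    norm_num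
  rw [h3, h3]
  have h4 : (∑ s, C.law₂ P s * C.dens₂ P s ^ 2) + ∑ s, C.law₁ P s * C.dens₁ P s ^ 2
      ≤ B * √(c * (δ / n)) := by
    refine le_trans ?_ (mul_le_mul_of_nonneg_left hαle hB0)
    rw [hB, add_mul]
    exact add_le_add hm₂ hm₁
  have h5 := mul_le_mul_of_nonneg_right h4 (show 0 ≤ 16 / (δ * ρ ^ 2) by positivity)
  linarith

/-- A positive rate for the second user forces cloud centres whose probability vanishes without
being zero. -/
lemma exists_vanishing_centres (hC : C.NonredundantAbsCont) (hδ : 0 < δ) {U : Type*} [Fintype U]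
    {P : ℕ → U × X → ℝ} {Plim : U × X → ℝ} {L₂ : ℝ} (hP : ∀ n, P n ∈ stdSimplex ℝ (U × X))
    (hlim : Tendsto P atTop (𝓝 Plim))
    (hD : ∀ᶠ n : ℕ in atTop, klDivBits (C.outZ (P n)) C.Q₀ ≤ ((δ / n : ℝ) : EReal))
    (hL₂ : 0 < L₂) (hI : ∀ᶠ n : ℕ in atTop, L₂ ≤ √(n / δ) * C.infoU2 (P n)) :
    ∃ B : Finset U, (∀ᶠ n : ℕ in atTop, 0 < ∑ u ∈ B, ∑ x, P n (u, x)) ∧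
      Tendsto (fun n => ∑ u ∈ B, ∑ x, P n (u, x)) atTop (𝓝 0) := by
  obtain ⟨K, hK, hWK⟩ := exists_ratio_bound C.x₀ (fun x y => (C.W₂_mem x).1 y) hC.ac_user₂
  obtain ⟨c, hc, hact⟩ := exists_act_sq_le hC
  have hcoord : ∀ u, Tendsto (fun n => ∑ x, P n (u, x)) atTop (𝓝 (∑ x, Plim (u, x))) := fun u =>
    tendsto_finsetSum _ fun x _ => (continuous_apply (u, x)).continuousAt.tendsto.comp hlim
  set q : U → ℝ := fun u => ∑ x, Plim (u, x) with hq
  have hq0 : ∀ u, 0 ≤ q u := fun u =>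
    ge_of_tendsto' (hcoord u) fun n => Finset.sum_nonneg fun x _ => (hP n).1 _
  -- The set consists of the centres whose limiting probability is zero, so its mass tends to zero
  -- at once; only positivity requires work.
  refine ⟨Finset.univ.filter fun u => q u = 0, ?_, ?_⟩
  swap
  · have h := tendsto_finsetSum (Finset.univ.filter fun u => q u = 0) fun u _ => hcoord u
    rwa [Finset.sum_eq_zero fun u hu => (Finset.mem_filter.1 hu).2] at h
  -- Centres with `q u = 0` contribute `2 / 0 = 0`. This is harmless: under the contrary assumption
  -- they are unused, and their chi-square term is zero as well.
  set D : ℝ := 4 * K ^ 2 / Real.log 2 * (∑ u, 2 / q u + 1) with hDdef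
  have hlog : 0 < Real.log 2 := Real.log_pos one_lt_two
  have hD0 : 0 ≤ D := by
    have : 0 ≤ ∑ u, 2 / q u := Finset.sum_nonneg fun u _ => div_nonneg two_pos.le (hq0 u)
    positivity
  have hα : Tendsto (fun n : ℕ => c * (δ / n)) atTop (𝓝 0) := by
    simpa using (tendsto_const_div_atTop_nhds_zero_nat δ).const_mul c
  have hsmall : Tendsto (fun n : ℕ => D * c * δ / √(n * δ)) atTop (𝓝 0) :=
    (tendsto_sqrt_mul_atTop hδ).const_div_atTop _
  have hlarge : ∀ᶠ n : ℕ in atTop, ∀ u, q u / 2 ≤ ∑ x, P n (u, x) ∨ q u = 0 := by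
    rw [eventually_all]
    intro u
    rcases (hq0 u).eq_or_lt with h | h
    · exact Eventually.of_forall fun n => Or.inr h.symm
    · filter_upwards [(hcoord u).eventually_const_le (half_lt_self h)] with n hn using Or.inl hn
  filter_upwards [hD, hI, hα.eventually_le_const (show (0 : ℝ) < 1 / 4 by norm_num),
    hsmall.eventually_lt_const hL₂, hlarge, eventually_gt_atTop 0] with n hDn hIn hαn hsn hln hn
  have hnpos : (0 : ℝ) < n := by exact_mod_cast hn
  have hr : 0 < √(n * δ) := Real.sqrt_pos.2 (by positivity)
  have hqn0 : ∀ u, 0 ≤ ∑ x, P n (u, x) := fun u => Finset.sum_nonneg fun x _ => (hP n).1 _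
  refine lt_of_le_of_ne (Finset.sum_nonneg fun u _ => hqn0 u) fun hzero => ?_
  have hvanish : ∀ u, q u = 0 → ∑ x, P n (u, x) = 0 := fun u hu =>
    (Finset.sum_eq_zero_iff_of_nonneg fun u _ => hqn0 u).1 hzero.symm u (by simp [hu])
  have hact2 := hact U (P n) _ (hP n) hDn
  set α := ∑ u, act C.x₀ (P n) u with hαdef
  have hact0 : ∀ u, 0 ≤ act C.x₀ (P n) u := fun u => act_nonneg (hP n).1 u
  have hα0 : 0 ≤ α := Finset.sum_nonneg fun u _ => hact0 u
  have hαhalf : α ≤ 1 / 2 := by nlinarith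
  have hchi := infoU2_le_chi (hP n) hK hWK hαhalf
  have hq1 : ∑ u, ∑ x, P n (u, x) = 1 := by rw [← (hP n).2, Fintype.sum_prod_type]
  have hterm : ∀ u, act C.x₀ (P n) u ^ 2 / (∑ x, P n (u, x)) ≤ α ^ 2 * (2 / q u) := by
    intro u
    have hle : act C.x₀ (P n) u ≤ α :=
      Finset.single_le_sum (f := act C.x₀ (P n)) (fun u _ => hact0 u) (Finset.mem_univ u)
    rcases (hq0 u).eq_or_lt with h | h
    · rw [hvanish u h.symm, ← h]
      simp
    · have h1 : q u / 2 ≤ ∑ x, P n (u, x) := (hln u).resolve_right h.ne'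
      have h2 : act C.x₀ (P n) u ^ 2 ≤ α ^ 2 := pow_le_pow_left₀ (hact0 u) hle 2
      calc act C.x₀ (P n) u ^ 2 / (∑ x, P n (u, x)) ≤ α ^ 2 / (q u / 2) := by gcongr
        _ = α ^ 2 * (2 / q u) := by field_simp
  -- Every centre in use has probability at least `q u / 2`, so the information is of order `α²`,
  -- that is `1 / n`.
  have hinfo : C.infoU2 (P n) ≤ D * (c * (δ / n)) := by
    have h1 : ∑ u, (act C.x₀ (P n) u ^ 2 / (∑ x, P n (u, x)) + α ^ 2 * ∑ x, P n (u, x))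
        ≤ α ^ 2 * (∑ u, 2 / q u + 1) := by
      rw [Finset.sum_add_distrib, ← Finset.mul_sum, hq1, mul_add, Finset.mul_sum]
      exact add_le_add (Finset.sum_le_sum fun u _ => hterm u) le_rfl
    calc C.infoU2 (P n) ≤ 4 * K ^ 2 / Real.log 2 * (α ^ 2 * (∑ u, 2 / q u + 1)) :=
          hchi.trans (mul_le_mul_of_nonneg_left h1 (by positivity))
      _ = D * α ^ 2 := by rw [hDdef]; ring
      _ ≤ D * (c * (δ / n)) := mul_le_mul_of_nonneg_left hact2 hD0
  have hcontr : √(n / δ) * C.infoU2 (P n) ≤ D * c * δ / √(n * δ) := by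
    rw [le_div_iff₀ hr, mul_right_comm, sqrt_div_mul_sqrt_mul hδ]
    have h1 := mul_le_mul_of_nonneg_left hinfo hnpos.le
    have h2 : n * (D * (c * (δ / n))) = D * c * δ := by field_simp
    linarith
  linarith

end WardenBC

end CovertBC

end

theorem theorem1 {X Y₁ Y₂ Z : Type*} [Fintype X] [Fintype Y₁] [Fintype Y₂] [Fintype Z]
    (C : CovertBC.WardenBC X Y₁ Y₂ Z) (hC : C.NonredundantAbsCont) (hdeg : C.Degraded)
    (δ : ℝ) (hδ : 0 < δ) :
    C.covertCapacityRegion δ = C.infoRegion δ ∧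
    ∀ (U : Type*) [Fintype U] (P : ℕ → U × X → ℝ) (Plim : U × X → ℝ) (L₂ : ℝ),
      (∀ n, P n ∈ stdSimplex ℝ (U × X)) →
      Tendsto P atTop (𝓝 Plim) →
      (∀ᶠ n : ℕ in atTop, CovertBC.klDivBits (C.outZ (P n)) C.Q₀ ≤ ((δ / n : ℝ) : EReal)) →
      0 < L₂ →
      (∀ᶠ n : ℕ in atTop, L₂ ≤ √(n / δ) * C.infoU2 (P n)) →
      ∃ B : Finset U,
        (∀ᶠ n : ℕ in atTop, 0 < ∑ u ∈ B, ∑ x, P n (u, x)) ∧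
        Tendsto (fun n => ∑ u ∈ B, ∑ x, P n (u, x)) atTop (𝓝 0) := by
  refine ⟨Set.Subset.antisymm (CovertBC.WardenBC.covertCapacityRegion_subset hdeg hδ)
    (CovertBC.WardenBC.infoRegion_subset hC hdeg hδ), ?_⟩
  intro U _ P Plim L₂ hP hlim hD hL₂ hI
  exact CovertBC.WardenBC.exists_vanishing_centres hC hδ hP hlim hD hL₂ hI
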